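/- **Setting.** Let $q^+$ and $q^-$ be the output probability densities, under inputs $+1$ and $-1$, of a memoryless binary-input channel whose outputs lie in a measurable space with a $\sigma$-finite reference measure (for example $\mathbb R$ with Lebesgue measure). Put $l(y)=\ln\frac{q^+(y)}{q^-(y)}\in[-\infty,\infty]$, and $\mathrm{sgn}(t)=1$ for $t\ge 0$, $\mathrm{sgn}(t)=-1$ for $t<0$. For $x\in\{\pm1\}^n$ and an output vector $y=(y_1,\dots,y_n)$ the ORBGRAND metric is $$D(x,y)=\frac1n\sum_{i=1}^n\frac{r_i}{n}\,\mathbf 1\bigl(\mathrm{sgn}(l(y_i))\,x_i<0\bigr),$$ where $r_i\in\{1,\dots,n\}$ is the rank of $|l(y_i)|$ among $|l(y_1)|,\dots,|l(y_n)|$ ($1$ = smallest; equal values are ranked by position). For a codebook $x(1),\dots,x(M)\in\{\pm1\}^n$ an ORBGRAND decoder outputs some $\hat m\in\arg\min_m D(x(m),y)$. Let $M^\star_{\mathrm{ORB}}(n,\epsilon)$ be the largest $M$ for which there is a codebook of $M$ codewords of length $n$ whose average error probability (uniform message) under ORBGRAND decoding is at most $\epsilon$, however ties among minimizers are (measurably)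 resolved, and let $R^\star_{\mathrm{ORB}}(n,\epsilon)=\frac1n\ln M^\star_{\mathrm{ORB}}(n,\epsilon)$. Let $X$ be uniform on $\{\pm1\}$ and $Y$ the corresponding output of one channel use; put $\Lambda=|l(Y)|$, $E=\mathbf 1(\mathrm{sgn}(l(Y))X<0)$, $\Psi(t)=\Pr[\Lambda\le t]$, $a(t)=\Pr[E=1,\Lambda\ge t]$, $$\mu=\mathbb E[\Psi(\Lambda)E],\qquad \sigma^2=\mathrm{Var}\bigl(E\,\Psi(\Lambda)+a(\Lambda)\bigr),$$ $$K(\theta)=\int_0^1\ln\frac{1+e^{\theta x}}2\,dx,\qquad I(d)=\sup_{\theta\in\mathbb R}\{\theta d-K(\theta)\}.$$ Let $Q(x)=\int_x^\infty\frac1{\sqrt{2\pi}}e^{-t^2/2}\,dt$ be the Gaussian tail function and $Q^{-1}$ its inverse. **Theorem (achievable lower bounds).** Assume $0<\mu<\frac14$. Then $\theta\mapsto\theta\mu-K(\theta)$ has a unique maximizer $\theta_\mu$ on $\mathbb R$. Put $V_{\mathrm{ORB}}=\theta_\mu^2\sigma^2$. For every $\epsilon\in(0,1)$ there are constants $C$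 and $n_0$, depending only on $\epsilon$ and the channel, such that for all $n\ge n_0$ $$\ln M^\star_{\mathrm{ORB}}(n,\epsilon)\ \ge\ nI(\mu)-\sqrt{nV_{\mathrm{ORB}}}\,Q^{-1}(\epsilon)+\tfrac12\ln n-C,$$ and, equivalently, $$R^\star_{\mathrm{ORB}}(n,\epsilon)\ \ge\ I(\mu)-\sqrt{\frac{V_{\mathrm{ORB}}}{n}}\,Q^{-1}(\epsilon)+\frac{\ln n}{2n}-\frac Cn.$$ -/

import Mathlib

open MeasureTheory ProbabilityTheory
open scoped ENNReal

namespace Orbgrand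

/-- A memoryless channel with binary input alphabet `{+1, -1}` (the units of `ℤ`) and output space
`𝒴`, given by the output densities `qPos`, `qNeg` (under input `+1`, `-1`) with respect to a
reference measure `ref` (Lebesgue measure when `𝒴` is the real line). -/
structure BinaryChannel (𝒴 : Type*) [MeasurableSpace 𝒴] where
  ref : Measure 𝒴
  sigmaFinite_ref : SigmaFinite ref
  qPos : 𝒴 → ℝ≥0∞
  qNeg : 𝒴 → ℝ≥0∞
  measurable_qPos : Measurable qPos
  measurable_qNeg : Measurable qNeg
  lintegral_qPos : ∫⁻ y, qPos y ∂ref = 1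
  lintegral_qNeg : ∫⁻ y, qNeg y ∂ref = 1

noncomputable section

namespace BinaryChannel

/-- Output law of one channel use under input `x`. -/
def law {𝒴 : Type*} [MeasurableSpace 𝒴] (W : BinaryChannel 𝒴) (x : ℤˣ) : Measure 𝒴 :=
  W.ref.withDensity (if x = 1 then W.qPos else W.qNeg)

instance {𝒴 : Type*} [MeasurableSpace 𝒴] (W : BinaryChannel 𝒴) (x : ℤˣ) :
    IsProbabilityMeasure (W.law x) := by
  constructor
  unfold law
  rw [withDensity_apply _ MeasurableSet.univ, Measure.restrict_univ]
  split_ifs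
  · exact W.lintegral_qPos
  · exact W.lintegral_qNeg

/-- Output law of `n` memoryless channel uses under the input word `x`. -/
def blockLaw {𝒴 : Type*} [MeasurableSpace 𝒴] (W : BinaryChannel 𝒴) {n : ℕ} (x : Fin n → ℤˣ) :
    Measure (Fin n → 𝒴) :=
  Measure.pi fun i => W.law (x i)

/-- Log-likelihood ratio `ln (q⁺(y) / q⁻(y))`, with the values `±∞` where one density vanishes. -/
def llr {𝒴 : Type*} [MeasurableSpace 𝒴] (W : BinaryChannel 𝒴) (y : 𝒴) : EReal :=
  ENNReal.log (W.qPos y / W.qNeg y)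

/-- Reliability `|ln (q⁺(y) / q⁻(y))|`. -/
def reliability {𝒴 : Type*} [MeasurableSpace 𝒴] (W : BinaryChannel 𝒴) (y : 𝒴) : ℝ≥0∞ :=
  (W.llr y).abs

open Classical in
/-- Hard decision: the sign of the log-likelihood ratio, with `sgn 0 = 1`. -/
def hard {𝒴 : Type*} [MeasurableSpace 𝒴] (W : BinaryChannel 𝒴) (y : 𝒴) : ℤˣ :=
  if 0 ≤ W.llr y then 1 else -1

/-- Indicator that the hard decision differs from the input, i.e. `sgn(l) * x < 0`. -/
def flip {𝒴 : Type*} [MeasurableSpace 𝒴] (W : BinaryChannel 𝒴) (x : ℤˣ) (y : 𝒴) : ℝ :=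
  if ((W.hard y * x : ℤˣ) : ℤ) < 0 then 1 else 0

open Classical in
/-- Rank of the `i`-th reliability within the vector of reliabilities, from `1` (the smallest) to
`n` (the largest); equal reliabilities are ranked by position, so the ranks are always a permutation
of `1, …, n`. Without ties this is the number of `j` with `Λ_j ≤ Λ_i`. -/
def rank {𝒴 : Type*} [MeasurableSpace 𝒴] (W : BinaryChannel 𝒴) {n : ℕ} (y : Fin n → 𝒴)
    (i : Fin n) : ℕ :=
  (Finset.univ.filter fun j : Fin n =>
    W.reliability (y j) < W.reliability (y i) ∨
      (W.reliability (y j) = W.reliability (y i) ∧ j ≤ i)).card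

/-- The ORBGRAND decoding metric. -/
def metric {𝒴 : Type*} [MeasurableSpace 𝒴] (W : BinaryChannel 𝒴) {n : ℕ} (x : Fin n → ℤˣ)
    (y : Fin n → 𝒴) : ℝ :=
  (1 / (n : ℝ)) * ∑ i, ((W.rank y i : ℝ) / n) * W.flip (x i) (y i)

/-- `dec` is an ORBGRAND decoder for the codebook `c`: it outputs a minimizer of the metric
(ties among minimizers may be resolved in any measurable way). -/
def IsDecoder {𝒴 : Type*} [MeasurableSpace 𝒴] (W : BinaryChannel 𝒴) {n M : ℕ}
    (c : Fin M → Fin n → ℤˣ) (dec : (Fin n → 𝒴) → Fin M) : Prop :=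
  Measurable dec ∧ ∀ y m, W.metric (c (dec y)) y ≤ W.metric (c m) y

/-- Average error probability, for uniformly distributed messages. -/
def avgError {𝒴 : Type*} [MeasurableSpace 𝒴] (W : BinaryChannel 𝒴) {n M : ℕ}
    (c : Fin M → Fin n → ℤˣ) (dec : (Fin n → 𝒴) → Fin M) : ℝ :=
  (1 / (M : ℝ)) * ∑ m, (W.blockLaw (c m)).real {y | dec y ≠ m}

/-- The largest number `M` of messages for which some codebook of length `n` has average error
probability at most `ε` under ORBGRAND decoding, however ties are resolved. For `0 ≤ ε < 1` the set
below contains `1` and is bounded by `2 ^ n / (1 - ε)`. -/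
def maxSize {𝒴 : Type*} [MeasurableSpace 𝒴] (W : BinaryChannel 𝒴) (n : ℕ) (ε : ℝ) : ℕ :=
  sSup {M : ℕ | 0 < M ∧ ∃ c : Fin M → Fin n → ℤˣ,
    ∀ dec : (Fin n → 𝒴) → Fin M, W.IsDecoder c dec → W.avgError c dec ≤ ε}

/-- The corresponding largest rate, in nats per channel use. -/
def maxRate {𝒴 : Type*} [MeasurableSpace 𝒴] (W : BinaryChannel 𝒴) (n : ℕ) (ε : ℝ) : ℝ :=
  (1 / (n : ℝ)) * Real.log (W.maxSize n ε)

/-- Joint law of one input-output pair `(X, Y)` with `X` uniform on `{+1, -1}`. -/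
def joint {𝒴 : Type*} [MeasurableSpace 𝒴] (W : BinaryChannel 𝒴) : Measure (ℤˣ × 𝒴) :=
  (2⁻¹ : ℝ≥0∞) • ∑ x : ℤˣ, (W.law x).map (fun y => (x, y))

/-- The cumulative distribution function `Ψ` of the reliability. -/
def relCdf {𝒴 : Type*} [MeasurableSpace 𝒴] (W : BinaryChannel 𝒴) (t : ℝ≥0∞) : ℝ :=
  W.joint.real {z | W.reliability z.2 ≤ t}

/-- `a(t) = Pr[E = 1, Λ ≥ t]`. -/
def errTail {𝒴 : Type*} [MeasurableSpace 𝒴] (W : BinaryChannel 𝒴) (t : ℝ≥0∞) : ℝ :=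
  W.joint.real {z | W.flip z.1 z.2 = 1 ∧ t ≤ W.reliability z.2}

/-- `μ = 𝔼[Ψ(Λ) E]`. -/
def mu {𝒴 : Type*} [MeasurableSpace 𝒴] (W : BinaryChannel 𝒴) : ℝ :=
  ∫ z, W.relCdf (W.reliability z.2) * W.flip z.1 z.2 ∂W.joint

/-- `σ² = Var(E Ψ(Λ) + a(Λ))`. -/
def sigmaSq {𝒴 : Type*} [MeasurableSpace 𝒴] (W : BinaryChannel 𝒴) : ℝ :=
  variance (fun z : ℤˣ × 𝒴 =>
    W.flip z.1 z.2 * W.relCdf (W.reliability z.2) + W.errTail (W.reliability z.2)) W.joint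

end BinaryChannel

/-- Limiting cumulant generating function `K(θ) = ∫₀¹ ln ((1 + e^{θ x}) / 2) dx`. -/
def cgf (θ : ℝ) : ℝ := ∫ x in (0 : ℝ)..1, Real.log ((1 + Real.exp (θ * x)) / 2)

/-- Rate function `I(d) = sup_θ (θ d - K(θ))`. -/
def rateFn (d : ℝ) : ℝ := ⨆ θ : ℝ, (θ * d - cgf θ)

/-- `θ` attains the supremum that defines `I(d)`. -/
def IsMaximizer (d θ : ℝ) : Prop := ∀ θ' : ℝ, θ' * d - cgf θ' ≤ θ * d - cgf θ

/-- Gaussian tail function `Q(x) = ∫_x^∞ (2π)^{-1/2} e^{-t²/2} dt`. -/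
def gaussQ (x : ℝ) : ℝ :=
  ∫ t in Set.Ioi x, (1 / Real.sqrt (2 * Real.pi)) * Real.exp (-t ^ 2 / 2)

/-- The inverse of the Gaussian tail function (meaningful on its range `(0, 1)`). -/
def gaussQInv : ℝ → ℝ := Function.invFun gaussQ

end

end Orbgrand

namespace Orbgrand

/-! ### The limiting cumulant generating function -/

/-! The proof is a random coding argument over uniformly drawn codebooks in which both polynomial
factors are tracked. Throughout, the tilt `θ` is frozen at the maximizer of `θ μ - K(θ)`, which is
negative because `μ < 1/4`.

For a fixed channel output, multiplying by the hard decisions is a bijection from words to flip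
patterns, and the ranks are a permutation of `1, …, n`. So the number of words of metric at most `d`
is a count of weighted sign vectors. Exponential tilting, together with an anti-concentration bound
under the tilted law, bounds that count by `2^n · O(n^{-1/2}) · exp(n K(θ) - θ n d)`
(`card_metric_le`).

For the transmitted word, `n` times the metric is at most `H = U/n + 1`, where `U` is the quadratic
statistic of the kernel `E · 1{Λ' ≤ Λ}` over i.i.d. input-output pairs (`mul_metric_le`). The kernel
has mean `μ`, and its projection is `E Ψ(Λ) + a(Λ)`, whose variance is `σ²`. Splitting on `H ≤ t`
and averaging over codebooks, some codebook has error at most `P(H > t) + (M - 1) · O(n^{-1/2}) ·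
exp(n K(θ) - θ t) · E[exp(-θ (H - t)); H ≤ t]` (`exists_codebook_avgError_le`).

A Berry–Esseen bound for U-statistics, obtained by Stein's method for exchangeable pairs, is used
twice in `exists_threshold`. It allows `t = n μ + √n σ Q⁻¹(ε) + O(1)` with `P(H > t) ≤ ε - η` and `η
= n^{-1/2}`. It also gives every unit interval probability `O(n^{-1/2})` under `H`, so the truncated
exponential moment is `O(η)`. When `σ = 0`, Chebyshev's inequality does the same with a constant
`η`. In both cases the truncated moment is paid for by the slack `η`, so `M` may be of order `√n ·
exp(θ t - n K(θ))`. The surviving `√n` is the term `(1/2) ln n`. Since `θ` is the maximizer, `θ μ -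
K(θ) = I(μ)`, and since `θ < 0`, `θ √(n σ²) = -√(n V)`. -/

lemma continuous_log_one_add_exp_half : Continuous fun t : ℝ => Real.log ((1 + Real.exp t) / 2) :=
  Continuous.log (by fun_prop) fun t => by positivity

lemma continuous_cgf_integrand (θ : ℝ) :
    Continuous fun x : ℝ => Real.log ((1 + Real.exp (θ * x)) / 2) :=
  continuous_log_one_add_exp_half.comp (by fun_prop : Continuous fun x : ℝ => θ * x)

lemma intervalIntegrable_cgf_integrand (θ a b : ℝ) :
    IntervalIntegrable (fun x : ℝ => Real.log ((1 + Real.exp (θ * x)) / 2)) volume a b :=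
  (continuous_cgf_integrand θ).intervalIntegrable a b

lemma half_le_log_one_add_exp_half (t : ℝ) : t / 2 ≤ Real.log ((1 + Real.exp t) / 2) := by
  rw [Real.le_log_iff_exp_le (by positivity)]
  have h : Real.exp t = Real.exp (t / 2) ^ 2 := by rw [← Real.exp_nat_mul]; congr 1; push_cast; ring
  rw [h]
  nlinarith [sq_nonneg (Real.exp (t / 2) - 1)]

lemma log_one_add_exp_half_le (t : ℝ) :
    Real.log ((1 + Real.exp t) / 2) ≤ t / 2 + t ^ 2 / 8 := by
  rw [Real.log_le_iff_le_exp (by positivity), Real.exp_add]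
  have h : (1 + Real.exp t) / 2 = Real.exp (t / 2) * Real.cosh (t / 2) := by
    rw [Real.cosh_eq, mul_div_assoc', mul_add, ← Real.exp_add, ← Real.exp_add]
    ring_nf
    simp
    ring
  rw [h]
  refine mul_le_mul_of_nonneg_left ((Real.cosh_le_exp_half_sq _).trans_eq ?_) (Real.exp_nonneg _)
  congr 1
  ring

lemma neg_log_two_le (t : ℝ) : -Real.log 2 ≤ Real.log ((1 + Real.exp t) / 2) := by
  rw [← Real.log_inv]
  exact Real.log_le_log (by norm_num) (by linarith [Real.exp_pos t])

lemma sub_log_two_le (t : ℝ) : t - Real.log 2 ≤ Real.log ((1 + Real.exp t) / 2) := by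
  rw [Real.le_log_iff_exp_le (by positivity), Real.exp_sub, Real.exp_log (by norm_num)]
  linarith

lemma log_one_add_exp_half_mono {s t : ℝ} (h : s ≤ t) :
    Real.log ((1 + Real.exp s) / 2) ≤ Real.log ((1 + Real.exp t) / 2) :=
  Real.log_le_log (by positivity) (by linarith [Real.exp_le_exp.2 h])

lemma log_one_add_exp_half_sub_le {s t : ℝ} (h : s ≤ t) :
    Real.log ((1 + Real.exp t) / 2) ≤ Real.log ((1 + Real.exp s) / 2) + (t - s) := by
  rw [← Real.log_exp (t - s), ← Real.log_mul (by positivity) (by positivity)]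
  refine Real.log_le_log (by positivity) ?_
  have h1 : Real.exp s * Real.exp (t - s) = Real.exp t := by rw [← Real.exp_add]; congr 1; ring
  have h2 : 1 ≤ Real.exp (t - s) := Real.one_le_exp (by linarith)
  nlinarith

lemma abs_log_one_add_exp_half_sub_le (s t : ℝ) :
    |Real.log ((1 + Real.exp s) / 2) - Real.log ((1 + Real.exp t) / 2)| ≤ |s - t| := by
  rcases le_total s t with h | h
  · rw [abs_sub_comm, abs_sub_comm s, abs_of_nonneg (by linarith [log_one_add_exp_half_mono h]),
      abs_of_nonneg (by linarith)]
    linarith [log_one_add_exp_half_sub_le h]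
  · rw [abs_of_nonneg (by linarith [log_one_add_exp_half_mono h]), abs_of_nonneg (by linarith)]
    linarith [log_one_add_exp_half_sub_le h]

/-- With `a = e^{s/2}` and `b = e^{t/2}` this is the strict Cauchy–Schwarz inequality `(1 + a b)² <
(1 + a²)(1 + b²)`, whose gap is `(a - b)²`. Strictness is what makes the maximizer unique. -/
lemma log_one_add_exp_half_midpoint_lt {s t : ℝ} (h : s ≠ t) :
    Real.log ((1 + Real.exp ((s + t) / 2)) / 2) <
      (Real.log ((1 + Real.exp s) / 2) + Real.log ((1 + Real.exp t) / 2)) / 2 := by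
  have key : Real.log (((1 + Real.exp ((s + t) / 2)) / 2) ^ 2) <
      Real.log ((1 + Real.exp s) / 2 * ((1 + Real.exp t) / 2)) := by
    refine Real.log_lt_log (by positivity) ?_
    have e1 : Real.exp ((s + t) / 2) = Real.exp (s / 2) * Real.exp (t / 2) := by
      rw [← Real.exp_add]; congr 1; ring
    have e2 : ∀ u : ℝ, Real.exp u = Real.exp (u / 2) ^ 2 := fun u => by
      rw [← Real.exp_nat_mul]; congr 1; push_cast; ring
    rw [e1, e2 s, e2 t]
    have hne : Real.exp (s / 2) - Real.exp (t / 2) ≠ 0 := by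
      rw [sub_ne_zero, Ne, Real.exp_eq_exp]
      intro h'; apply h; linarith
    nlinarith [sq_pos_of_ne_zero hne]
  rw [Real.log_pow, Real.log_mul (by positivity) (by positivity)] at key
  push_cast at key
  linarith

lemma le_cgf_of_forall {θ : ℝ} {f : ℝ → ℝ} (hf : Continuous f)
    (h : ∀ x ∈ Set.Icc (0 : ℝ) 1, f x ≤ Real.log ((1 + Real.exp (θ * x)) / 2)) :
    ∫ x in (0 : ℝ)..1, f x ≤ cgf θ :=
  intervalIntegral.integral_mono_on zero_le_one (hf.intervalIntegrable _ _)
    (intervalIntegrable_cgf_integrand _ _ _) h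

lemma quarter_le_cgf (θ : ℝ) : θ / 4 ≤ cgf θ := by
  refine le_trans (le_of_eq ?_) (le_cgf_of_forall (f := fun x => θ / 2 * x) (by fun_prop)
    fun x _ => by convert half_le_log_one_add_exp_half (θ * x) using 1; ring)
  rw [intervalIntegral.integral_const_mul, integral_id]
  ring

lemma neg_log_two_le_cgf (θ : ℝ) : -Real.log 2 ≤ cgf θ := by
  refine le_trans (le_of_eq ?_) (le_cgf_of_forall (f := fun _ => -Real.log 2) (by fun_prop)
    fun x _ => neg_log_two_le _)
  simp

lemma half_sub_log_two_le_cgf (θ : ℝ) : θ / 2 - Real.log 2 ≤ cgf θ := by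
  refine le_trans (le_of_eq ?_) (le_cgf_of_forall (f := fun x => θ * x - Real.log 2) (by fun_prop)
    fun x _ => sub_log_two_le _)
  rw [intervalIntegral.integral_sub (by apply Continuous.intervalIntegrable; fun_prop) (by simp),
    intervalIntegral.integral_const_mul, integral_id]
  simp
  ring

lemma cgf_le_quadratic (θ : ℝ) : cgf θ ≤ θ / 4 + θ ^ 2 / 24 := by
  have h : cgf θ ≤ ∫ x in (0 : ℝ)..1, (θ / 2 * x + θ ^ 2 / 8 * x ^ 2) :=
    intervalIntegral.integral_mono_on zero_le_one (intervalIntegrable_cgf_integrand _ _ _)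
      (by apply Continuous.intervalIntegrable; fun_prop)
      fun x _ => (log_one_add_exp_half_le (θ * x)).trans_eq (by ring)
  refine h.trans_eq ?_
  rw [intervalIntegral.integral_add (by apply Continuous.intervalIntegrable; fun_prop)
    (by apply Continuous.intervalIntegrable; fun_prop), intervalIntegral.integral_const_mul,
    intervalIntegral.integral_const_mul, integral_id, integral_pow]
  norm_num
  ring

lemma cgf_zero : cgf 0 = 0 := by
  simp [cgf]

lemma abs_cgf_sub_le (s t : ℝ) : |cgf s - cgf t| ≤ |s - t| := by
  rw [cgf, cgf, ← intervalIntegral.integral_sub (intervalIntegrable_cgf_integrand _ _ _)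
    (intervalIntegrable_cgf_integrand _ _ _)]
  have h := intervalIntegral.norm_integral_le_of_norm_le_const (a := (0 : ℝ)) (b := 1)
    (C := |s - t|) (f := fun x => Real.log ((1 + Real.exp (s * x)) / 2) -
      Real.log ((1 + Real.exp (t * x)) / 2)) ?_
  · simpa using h
  · intro x hx
    rw [Set.uIoc_of_le zero_le_one] at hx
    refine (abs_log_one_add_exp_half_sub_le _ _).trans ?_
    rw [← sub_mul, abs_mul, abs_of_pos hx.1]
    exact mul_le_of_le_one_right (abs_nonneg _) hx.2

lemma continuous_cgf : Continuous cgf := by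
  refine LipschitzWith.continuous (K := 1) (LipschitzWith.of_dist_le_mul fun s t => ?_)
  simpa [Real.dist_eq] using abs_cgf_sub_le s t

lemma cgf_midpoint_lt {s t : ℝ} (h : s ≠ t) : cgf ((s + t) / 2) < (cgf s + cgf t) / 2 := by
  have h1 : ∫ x in (0 : ℝ)..1, Real.log ((1 + Real.exp ((s + t) / 2 * x)) / 2) <
      ∫ x in (0 : ℝ)..1, (Real.log ((1 + Real.exp (s * x)) / 2) +
        Real.log ((1 + Real.exp (t * x)) / 2)) / 2 := by
    have key : ∀ x ∈ Set.Ioc (0 : ℝ) 1, Real.log ((1 + Real.exp ((s + t) / 2 * x)) / 2) <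
        (Real.log ((1 + Real.exp (s * x)) / 2) + Real.log ((1 + Real.exp (t * x)) / 2)) / 2 := by
      intro x hx
      have := log_one_add_exp_half_midpoint_lt (s := s * x) (t := t * x)
        (fun h' => h (mul_right_cancel₀ hx.1.ne' h'))
      convert this using 5
      ring
    refine intervalIntegral.integral_lt_integral_of_continuousOn_of_le_of_exists_lt zero_lt_one
      (continuous_cgf_integrand _).continuousOn
      (((continuous_cgf_integrand s).add (continuous_cgf_integrand t)).div_const 2).continuousOn
      (fun x hx => (key x hx).le) ⟨1, by simp, key 1 (by simp)⟩
  rw [intervalIntegral.integral_div, intervalIntegral.integral_add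
    (intervalIntegrable_cgf_integrand _ _ _) (intervalIntegrable_cgf_integrand _ _ _)] at h1
  exact h1

/-- Coercivity: the objective vanishes at `0`. It is negative for `θ < -R` by `cgf ≥ -log 2` and for
`θ > R` by `cgf θ ≥ θ/2 - log 2` with `d < 1/4`. A maximum over `[-R, R]` is therefore global. -/
lemma exists_isMaximizer {d : ℝ} (h0 : 0 < d) (h1 : d < 1 / 4) : ∃ θ, IsMaximizer d θ := by
  set R := max (4 * Real.log 2) (Real.log 2 / d)
  have hlog : 0 < Real.log 2 := Real.log_pos (by norm_num)
  have hR : 0 ≤ R := le_trans (by positivity) (le_max_left _ _)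
  obtain ⟨θ, -, hθ⟩ := (isCompact_Icc (a := -R) (b := R)).exists_isMaxOn ⟨0, by simp [hR]⟩
    (f := fun θ => θ * d - cgf θ) ((by fun_prop : Continuous fun θ : ℝ => θ * d).sub
      continuous_cgf).continuousOn
  refine ⟨θ, fun θ' => ?_⟩
  have hz : 0 ≤ θ * d - cgf θ := by
    have := hθ (show (0 : ℝ) ∈ Set.Icc (-R) R by simp [hR])
    simpa [cgf_zero] using this
  by_cases hm : θ' ∈ Set.Icc (-R) R
  · exact hθ hm
  · refine le_trans ?_ hz
    rw [Set.mem_Icc, not_and_or, not_le, not_le] at hm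
    rcases hm with hm | hm
    · have := neg_log_two_le_cgf θ'
      have h2 : Real.log 2 / d ≤ R := le_max_right _ _
      rw [div_le_iff₀ h0] at h2
      nlinarith
    · have := half_sub_log_two_le_cgf θ'
      have h2 : 4 * Real.log 2 ≤ R := le_max_left _ _
      nlinarith

lemma isMaximizer_unique {d s t : ℝ} (hs : IsMaximizer d s) (ht : IsMaximizer d t) : s = t := by
  by_contra h
  have h1 := cgf_midpoint_lt h
  have h2 := hs ((s + t) / 2)
  have h3 := ht ((s + t) / 2)
  linarith

/-- For `θ ≥ 0` the bound `cgf θ ≥ θ/4` makes the objective nonpositive. At `6 (d - 1/4)` the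
quadratic upper bound on `cgf` makes it strictly positive. -/
lemma IsMaximizer.neg {d θ : ℝ} (h : IsMaximizer d θ) (hd : d < 1 / 4) : θ < 0 := by
  by_contra! hθ
  have h1 := h (6 * (d - 1 / 4))
  have h2 := cgf_le_quadratic (6 * (d - 1 / 4))
  have h3 := quarter_le_cgf θ
  nlinarith [mul_nonneg hθ (sub_pos.2 hd).le, sq_pos_of_neg (sub_neg.2 hd)]

lemma IsMaximizer.rateFn_eq {d θ : ℝ} (h : IsMaximizer d θ) : rateFn d = θ * d - cgf θ :=
  le_antisymm (ciSup_le h) (le_ciSup (f := fun θ => θ * d - cgf θ) ⟨_, by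
    rintro _ ⟨θ', rfl⟩; exact h θ'⟩ θ)

/-- For `θ ≤ 0` the integrand is nonincreasing, so its right-endpoint Riemann sum lies below the
integral and replacing ranks by the integral costs nothing. -/
lemma sum_log_le_mul_cgf {θ : ℝ} (hθ : θ ≤ 0) {n : ℕ} (hn : 0 < n) :
    ∑ i ∈ Finset.range n, Real.log ((1 + Real.exp (θ * ((i + 1 : ℕ) / n))) / 2) ≤ n * cgf θ := by
  have hn' : (0 : ℝ) < n := by exact_mod_cast hn
  have h := AntitoneOn.sum_le_integral (x₀ := 0) (a := n)
    (f := fun x : ℝ => Real.log ((1 + Real.exp (θ * (x / n))) / 2)) (fun x _ y _ hxy =>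
      log_one_add_exp_half_mono (mul_le_mul_of_nonpos_left (by gcongr) hθ))
  simp only [zero_add] at h
  refine h.trans_eq ?_
  rw [intervalIntegral.integral_comp_div (fun x => Real.log ((1 + Real.exp (θ * x)) / 2)) hn'.ne']
  simp [cgf, hn'.ne']

/-! ### The Gaussian tail function and the Stein equation -/

/-- The standard Gaussian density. -/
noncomputable def gaussDensity (x : ℝ) : ℝ :=
  1 / Real.sqrt (2 * Real.pi) * Real.exp (-x ^ 2 / 2)

lemma gaussDensity_pos (x : ℝ) : 0 < gaussDensity x := by
  unfold gaussDensity; positivity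

lemma continuous_gaussDensity : Continuous gaussDensity := by
  unfold gaussDensity; fun_prop

lemma one_le_sqrt_two_pi : 1 ≤ Real.sqrt (2 * Real.pi) :=
  Real.one_le_sqrt.2 (by linarith [Real.pi_gt_three])

lemma gaussDensity_le_exp (x : ℝ) : gaussDensity x ≤ Real.exp (-x ^ 2 / 2) := by
  unfold gaussDensity
  refine mul_le_of_le_one_left (Real.exp_nonneg _) ?_
  rw [div_le_one (by positivity)]
  exact one_le_sqrt_two_pi

lemma gaussDensity_le_one (x : ℝ) : gaussDensity x ≤ 1 :=
  (gaussDensity_le_exp x).trans (Real.exp_le_one_iff.2 (by nlinarith [sq_nonneg x]))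

lemma gaussDensity_neg (x : ℝ) : gaussDensity (-x) = gaussDensity x := by
  simp [gaussDensity]

lemma gaussDensity_le_of_abs_le {x y : ℝ} (h : |x| ≤ |y|) : gaussDensity y ≤ gaussDensity x := by
  unfold gaussDensity
  have := sq_le_sq.2 h
  gcongr

lemma integrable_gaussDensity : Integrable gaussDensity := by
  have h := (integrable_exp_neg_mul_sq (b := 1 / 2) (by norm_num)).const_mul
    (1 / Real.sqrt (2 * Real.pi))
  refine h.congr (ae_of_all _ fun x => ?_)
  simp only [gaussDensity]
  ring_nf

lemma integrable_mul_gaussDensity : Integrable fun x => x * gaussDensity x := by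
  have h := (integrable_mul_exp_neg_mul_sq (b := 1 / 2) (by norm_num)).const_mul
    (1 / Real.sqrt (2 * Real.pi))
  refine h.congr (ae_of_all _ fun x => ?_)
  simp only [gaussDensity]
  ring_nf

lemma integral_gaussDensity : ∫ x, gaussDensity x = 1 := by
  have h := integral_gaussian (1 / 2)
  have h2 : ∀ x : ℝ,
      gaussDensity x = 1 / Real.sqrt (2 * Real.pi) * Real.exp (-(1 / 2) * x ^ 2) := by
    intro x; unfold gaussDensity; ring_nf
  simp_rw [h2]
  rw [integral_const_mul, h]
  rw [show Real.pi / (1 / 2) = 2 * Real.pi by ring]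
  have : Real.sqrt (2 * Real.pi) ≠ 0 := by positivity
  field_simp

lemma gaussQ_eq (x : ℝ) : gaussQ x = ∫ t in Set.Ioi x, gaussDensity t := rfl

lemma gaussQ_sub (x y : ℝ) : gaussQ x - gaussQ y = ∫ t in x..y, gaussDensity t := by
  rw [gaussQ_eq, gaussQ_eq]
  exact (intervalIntegral.integral_Ioi_sub_Ioi' integrable_gaussDensity.integrableOn
    integrable_gaussDensity.integrableOn)

lemma hasDerivAt_gaussQ (x : ℝ) : HasDerivAt gaussQ (-gaussDensity x) x := by
  have h : gaussQ = fun y => gaussQ 0 - ∫ t in (0 : ℝ)..y, gaussDensity t := by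
    funext y; rw [← gaussQ_sub]; ring
  rw [h]
  exact ((continuous_gaussDensity.integral_hasStrictDerivAt 0 x).hasDerivAt).const_sub _

lemma continuous_gaussQ : Continuous gaussQ :=
  continuous_iff_continuousAt.2 fun x => (hasDerivAt_gaussQ x).continuousAt

lemma strictAnti_gaussQ : StrictAnti gaussQ :=
  strictAnti_of_hasDerivAt_neg (fun x => hasDerivAt_gaussQ x)
    fun x => neg_neg_of_pos (gaussDensity_pos x)

lemma gaussQ_nonneg (x : ℝ) : 0 ≤ gaussQ x :=
  integral_nonneg fun t => (gaussDensity_pos t).le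

lemma gaussQ_neg (x : ℝ) : gaussQ (-x) = 1 - gaussQ x := by
  have h : gaussQ x = ∫ t in Set.Iic (-x), gaussDensity t := by
    rw [gaussQ_eq, ← integral_comp_neg_Ioi]
    simp [gaussDensity_neg]
  rw [h, ← integral_gaussDensity, gaussQ_eq,
    ← intervalIntegral.integral_Iic_add_Ioi (b := -x) integrable_gaussDensity.integrableOn
      integrable_gaussDensity.integrableOn]
  ring

lemma gaussQ_le_one (x : ℝ) : gaussQ x ≤ 1 := by
  linarith [gaussQ_nonneg (-x), gaussQ_neg x]

lemma gaussQ_zero : gaussQ 0 = 1 / 2 := by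
  have := gaussQ_neg 0
  rw [neg_zero] at this
  linarith

lemma gaussQ_sub_le {x y : ℝ} (h : x ≤ y) : gaussQ x - gaussQ y ≤ y - x := by
  rw [gaussQ_sub]
  calc ∫ t in x..y, gaussDensity t ≤ ∫ t in x..y, (1 : ℝ) :=
        intervalIntegral.integral_mono_on h (continuous_gaussDensity.intervalIntegrable _ _)
          (by simp) fun t _ => gaussDensity_le_one t
    _ = y - x := by simp

/-- An explicit slope for the tail near `x`: it turns a shift of the threshold by `O(n^{-1/2})` into
a gain in probability of the same order. -/
lemma le_gaussQ_sub {x h : ℝ} (h0 : 0 ≤ h) (h1 : h ≤ 1) :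
    gaussDensity (|x| + 1) * h ≤ gaussQ x - gaussQ (x + h) := by
  rw [gaussQ_sub]
  calc gaussDensity (|x| + 1) * h = ∫ t in x..(x + h), gaussDensity (|x| + 1) := by simp; ring
    _ ≤ _ := by
      refine intervalIntegral.integral_mono_on (by linarith) (by simp)
        (continuous_gaussDensity.intervalIntegrable _ _) fun t ht => ?_
      refine gaussDensity_le_of_abs_le ?_
      rw [abs_of_nonneg (by positivity : 0 ≤ |x| + 1), abs_le]
      constructor <;> linarith [ht.1, ht.2, le_abs_self x, neg_abs_le x]

lemma hasDerivAt_gaussDensity (x : ℝ) : HasDerivAt gaussDensity (-(x * gaussDensity x)) x := by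
  have h : HasDerivAt (fun x : ℝ => -x ^ 2 / 2) (-x) x := by
    refine HasDerivAt.congr_deriv (((hasDerivAt_pow 2 x).neg).div_const 2) ?_
    simp; ring
  refine HasDerivAt.congr_deriv ((h.exp).const_mul (1 / Real.sqrt (2 * Real.pi))) ?_
  unfold gaussDensity
  ring

lemma exp_neg_sq_half_le {x : ℝ} (hx : 0 < x) : x * Real.exp (-x ^ 2 / 2) ≤ 2 / x := by
  rw [le_div_iff₀ hx]
  have h := Real.add_one_le_exp (x ^ 2 / 2)
  have h2 : Real.exp (-x ^ 2 / 2) * Real.exp (x ^ 2 / 2) = 1 := by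
    rw [← Real.exp_add]; ring_nf; simp
  nlinarith [Real.exp_pos (-x ^ 2 / 2)]

lemma tendsto_gaussDensity : Filter.Tendsto gaussDensity Filter.atTop (nhds 0) := by
  refine squeeze_zero' (g := fun x => 2 / x) (Filter.Eventually.of_forall fun x =>
    (gaussDensity_pos x).le) ?_ (tendsto_const_nhds.div_atTop Filter.tendsto_id)
  filter_upwards [Filter.eventually_ge_atTop 1] with x hx
  refine (gaussDensity_le_exp x).trans (le_trans ?_ (exp_neg_sq_half_le (by linarith)))
  exact le_mul_of_one_le_left (Real.exp_nonneg _) hx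

/-- The density at `w` is `∫ t φ(t) dt` over `t > w`, and there `t ≥ w`. -/
lemma mul_gaussQ_le (w : ℝ) : w * gaussQ w ≤ gaussDensity w := by
  have h1 : ∫ t in Set.Ioi w, t * gaussDensity t = gaussDensity w := by
    have := integral_Ioi_of_hasDerivAt_of_tendsto (a := w) (f := fun x => -gaussDensity x)
      (f' := fun t => t * gaussDensity t) (m := 0) continuous_gaussDensity.neg.continuousWithinAt
      (fun x _ => (hasDerivAt_gaussDensity x).neg.congr_deriv (neg_neg _))
      integrable_mul_gaussDensity.integrableOn (by simpa using tendsto_gaussDensity.neg)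
    rw [this]; ring
  rw [← h1, gaussQ_eq, ← integral_const_mul]
  refine setIntegral_mono_on (integrable_gaussDensity.const_mul w).integrableOn
    integrable_mul_gaussDensity.integrableOn measurableSet_Ioi fun t ht => ?_
  exact mul_le_mul_of_nonneg_right (le_of_lt ht) (gaussDensity_pos t).le

/-- The difference `(1 + w²) Q(w) - w φ(w)` has derivative `-2 (φ - w Q) ≤ 0`, and for large `x` it
is at least `-2/x`. A nonincreasing function with such a lower bound at infinity is nonnegative. -/
lemma mul_gaussDensity_le (w : ℝ) : w * gaussDensity w ≤ (1 + w ^ 2) * gaussQ w := by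
  have hd : ∀ x, HasDerivAt (fun w => (1 + w ^ 2) * gaussQ w - w * gaussDensity w)
      (-2 * (gaussDensity x - x * gaussQ x)) x := by
    intro x
    refine HasDerivAt.congr_deriv ((((hasDerivAt_pow 2 x).const_add 1).mul
      (hasDerivAt_gaussQ x)).sub ((hasDerivAt_id x).mul (hasDerivAt_gaussDensity x))) ?_
    simp; ring
  have hanti : Antitone fun w => (1 + w ^ 2) * gaussQ w - w * gaussDensity w :=
    antitone_of_hasDerivAt_nonpos hd fun x => by
      simp only [Pi.zero_apply]; linarith [mul_gaussQ_le x]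
  have hlim : Filter.Tendsto (fun x : ℝ => -(2 / x)) Filter.atTop (nhds 0) := by
    simpa using (tendsto_const_nhds.div_atTop Filter.tendsto_id : Filter.Tendsto
      (fun x : ℝ => 2 / x) Filter.atTop (nhds 0)).neg
  have := le_of_tendsto hlim (b := (1 + w ^ 2) * gaussQ w - w * gaussDensity w) (by
    filter_upwards [Filter.eventually_ge_atTop w, Filter.eventually_gt_atTop 0] with x hx hx0
    have h1 := hanti hx
    have h2 := exp_neg_sq_half_le hx0
    have h3 := mul_le_mul_of_nonneg_left (gaussDensity_le_exp x) hx0.le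
    have h4 := gaussQ_nonneg x
    simp only at h1
    nlinarith [mul_nonneg (by positivity : 0 ≤ 1 + x ^ 2) h4])
  linarith

lemma exists_gaussQ_eq {ε : ℝ} (h0 : 0 < ε) (h1 : ε < 1) : ∃ x, gaussQ x = ε := by
  have small : ∀ δ : ℝ, 0 < δ → ∃ x, gaussQ x ≤ δ := by
    intro δ hδ
    refine ⟨1 / δ, ?_⟩
    have h := (mul_gaussQ_le (1 / δ)).trans (gaussDensity_le_one _)
    rwa [one_div_mul_eq_div, div_le_one hδ] at h
  obtain ⟨x, hx⟩ := small ε h0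
  obtain ⟨y, hy⟩ := small (1 - ε) (by linarith)
  exact mem_range_of_exists_le_of_exists_ge continuous_gaussQ ⟨x, hx⟩
    ⟨-y, by rw [gaussQ_neg]; linarith⟩

lemma gaussQ_gaussQInv {ε : ℝ} (h0 : 0 < ε) (h1 : ε < 1) : gaussQ (gaussQInv ε) = ε :=
  Function.invFun_eq (exists_gaussQ_eq h0 h1)

/-- The Mills ratio of the standard Gaussian law. -/
noncomputable def millsRatio (w : ℝ) : ℝ :=
  Real.sqrt (2 * Real.pi) * Real.exp (w ^ 2 / 2) * gaussQ w

lemma sqrt_two_pi_mul_gaussDensity (w : ℝ) :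
    Real.sqrt (2 * Real.pi) * Real.exp (w ^ 2 / 2) * gaussDensity w = 1 := by
  have : Real.sqrt (2 * Real.pi) ≠ 0 := by positivity
  have h2 : Real.exp (w ^ 2 / 2) * Real.exp (-w ^ 2 / 2) = 1 := by
    rw [← Real.exp_add]; ring_nf; simp
  unfold gaussDensity
  rw [mul_mul_mul_comm, mul_one_div_cancel this, one_mul, h2]

lemma millsRatio_nonneg (w : ℝ) : 0 ≤ millsRatio w :=
  mul_nonneg (by positivity) (gaussQ_nonneg w)

lemma mul_millsRatio_le_one (w : ℝ) : w * millsRatio w ≤ 1 := by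
  rw [← sqrt_two_pi_mul_gaussDensity w, millsRatio, mul_left_comm]
  exact mul_le_mul_of_nonneg_left (mul_gaussQ_le w) (by positivity)

lemma le_mul_millsRatio (w : ℝ) : w ≤ (1 + w ^ 2) * millsRatio w := by
  have h := mul_le_mul_of_nonneg_left (mul_gaussDensity_le w)
    (by positivity : 0 ≤ Real.sqrt (2 * Real.pi) * Real.exp (w ^ 2 / 2))
  have h2 := sqrt_two_pi_mul_gaussDensity w
  unfold millsRatio
  linear_combination h - w * h2

lemma hasDerivAt_millsRatio (w : ℝ) : HasDerivAt millsRatio (w * millsRatio w - 1) w := by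
  have h : HasDerivAt (fun x : ℝ => x ^ 2 / 2) w w := by
    exact ((hasDerivAt_pow 2 w).div_const 2).congr_deriv (by simp)
  refine HasDerivAt.congr_deriv
    (((h.exp).const_mul (Real.sqrt (2 * Real.pi))).mul (hasDerivAt_gaussQ w)) ?_
  rw [← sqrt_two_pi_mul_gaussDensity w, millsRatio]
  ring

lemma antitone_millsRatio : Antitone millsRatio :=
  antitone_of_hasDerivAt_nonpos hasDerivAt_millsRatio fun x => by
    simp only [Pi.zero_apply]; linarith [mul_millsRatio_le_one x]

lemma monotone_mul_millsRatio : Monotone fun w => w * millsRatio w := by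
  refine monotone_of_hasDerivAt_nonneg (f' := fun w => (1 + w ^ 2) * millsRatio w - w)
    (fun w => ?_) fun w => sub_nonneg.2 (le_mul_millsRatio w)
  refine HasDerivAt.congr_deriv ((hasDerivAt_id w).mul (hasDerivAt_millsRatio w)) ?_
  simp; ring

lemma millsRatio_le_two {w : ℝ} (hw : 0 ≤ w) : millsRatio w ≤ 2 := by
  refine (antitone_millsRatio hw).trans ?_
  have h : Real.sqrt (2 * Real.pi) ≤ 4 := by
    rw [Real.sqrt_le_left (by norm_num)]
    linarith [Real.pi_lt_four]
  rw [millsRatio, gaussQ_zero, zero_pow two_ne_zero, zero_div, Real.exp_zero]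
  linarith

lemma millsRatio_mul_gaussQ_neg (w : ℝ) :
    millsRatio w * gaussQ (-w) = millsRatio (-w) * gaussQ w := by
  simp only [millsRatio, neg_sq]; ring

/-- For `w ≥ 0` the Mills ratio is itself at most `2`. For `w ≤ 0`, `z ≤ w` allows `gaussQ (-z)` to
be enlarged to `gaussQ (-w)`, and the reflection identity reduces to `-w ≥ 0`. -/
lemma millsRatio_mul_le_two {z w : ℝ} (h : z ≤ w) : millsRatio w * gaussQ (-z) ≤ 2 := by
  rcases le_total 0 w with hw | hw
  · nlinarith [millsRatio_le_two hw, millsRatio_nonneg w, gaussQ_nonneg (-z), gaussQ_le_one (-z)]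
  · have h1 : gaussQ (-z) ≤ gaussQ (-w) := strictAnti_gaussQ.antitone (neg_le_neg h)
    have h2 := mul_le_mul_of_nonneg_left h1 (millsRatio_nonneg w)
    rw [millsRatio_mul_gaussQ_neg] at h2
    nlinarith [millsRatio_le_two (neg_nonneg.2 hw), millsRatio_nonneg (-w), gaussQ_nonneg w,
      gaussQ_le_one w]

lemma abs_mul_millsRatio_mul_le_one {z w : ℝ} (h : z ≤ w) :
    |w * (millsRatio w * gaussQ (-z))| ≤ 1 := by
  have hm := millsRatio_nonneg w
  have hq := gaussQ_nonneg (-z)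
  have hq1 := gaussQ_le_one (-z)
  rw [abs_mul, abs_of_nonneg (mul_nonneg hm hq)]
  rcases le_total 0 w with hw | hw
  · rw [abs_of_nonneg hw]
    nlinarith [mul_millsRatio_le_one w, mul_nonneg hw hm]
  · rw [abs_of_nonpos hw]
    have h1 : gaussQ (-z) ≤ gaussQ (-w) := strictAnti_gaussQ.antitone (neg_le_neg h)
    have h2 := mul_le_mul_of_nonneg_left h1 (millsRatio_nonneg w)
    rw [millsRatio_mul_gaussQ_neg] at h2
    have h3 := mul_le_mul_of_nonneg_left h2 (neg_nonneg.2 hw)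
    have h4 := mul_millsRatio_le_one (-w)
    have h5 := mul_nonneg (neg_nonneg.2 hw) (millsRatio_nonneg (-w))
    nlinarith [gaussQ_nonneg w, gaussQ_le_one w]

/-- The bounded solution of the Stein equation `f' w - w f w = 1_{w ≤ z} - Φ z`. -/
noncomputable def steinSol (z w : ℝ) : ℝ :=
  if w ≤ z then millsRatio (-w) * gaussQ z else millsRatio w * gaussQ (-z)

/-- The indicator of the half-line `(-∞, z]`. -/
noncomputable def stepFun (z w : ℝ) : ℝ := if w ≤ z then 1 else 0

/-- The derivative of `steinSol z`, as given by the Stein equation. -/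
noncomputable def steinDeriv (z w : ℝ) : ℝ := w * steinSol z w + stepFun z w - gaussQ (-z)

lemma steinSol_of_le {z w : ℝ} (h : w ≤ z) : steinSol z w = millsRatio (-w) * gaussQ z := if_pos h

lemma steinSol_of_ge {z w : ℝ} (h : z ≤ w) : steinSol z w = millsRatio w * gaussQ (-z) := by
  rcases h.eq_or_lt with rfl | h
  · rw [steinSol_of_le le_rfl, millsRatio_mul_gaussQ_neg]
  · exact if_neg (not_le.2 h)

lemma continuous_millsRatio : Continuous millsRatio :=
  continuous_iff_continuousAt.2 fun x => (hasDerivAt_millsRatio x).continuousAt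

lemma measurable_steinSol (z : ℝ) : Measurable (steinSol z) :=
  Measurable.ite measurableSet_Iic
    ((continuous_millsRatio.comp continuous_neg).measurable.mul_const _)
    (continuous_millsRatio.measurable.mul_const _)

lemma measurable_stepFun (z : ℝ) : Measurable (stepFun z) :=
  Measurable.ite measurableSet_Iic measurable_const measurable_const

lemma measurable_steinDeriv (z : ℝ) : Measurable (steinDeriv z) :=
  ((measurable_id.mul (measurable_steinSol z)).add (measurable_stepFun z)).sub_const _

lemma abs_steinSol_le (z w : ℝ) : |steinSol z w| ≤ 2 := by
  rcases le_total w z with h | h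
  · rw [steinSol_of_le h, abs_of_nonneg (mul_nonneg (millsRatio_nonneg _) (gaussQ_nonneg _))]
    simpa using millsRatio_mul_le_two (neg_le_neg h)
  · rw [steinSol_of_ge h, abs_of_nonneg (mul_nonneg (millsRatio_nonneg _) (gaussQ_nonneg _))]
    exact millsRatio_mul_le_two h

lemma abs_mul_steinSol_le (z w : ℝ) : |w * steinSol z w| ≤ 1 := by
  rcases le_total w z with h | h
  · rw [steinSol_of_le h]
    have := abs_mul_millsRatio_mul_le_one (neg_le_neg h)
    rwa [neg_neg, neg_mul, abs_neg] at this
  · rw [steinSol_of_ge h]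
    exact abs_mul_millsRatio_mul_le_one h

lemma stepFun_mem (z w : ℝ) : 0 ≤ stepFun z w ∧ stepFun z w ≤ 1 := by
  unfold stepFun; split_ifs <;> norm_num

lemma abs_steinDeriv_le (z w : ℝ) : |steinDeriv z w| ≤ 2 := by
  have h1 := abs_le.1 (abs_mul_steinSol_le z w)
  have h2 := stepFun_mem z w
  have h3 := gaussQ_nonneg (-z)
  have h4 := gaussQ_le_one (-z)
  unfold steinDeriv
  rw [abs_le]
  constructor <;> linarith

lemma monotone_mul_steinSol (z : ℝ) : Monotone fun w => w * steinSol z w := by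
  have hl : ∀ u v : ℝ, u ≤ v → v ≤ z → u * steinSol z u ≤ v * steinSol z v := by
    intro u v huv hv
    rw [steinSol_of_le hv, steinSol_of_le (huv.trans hv)]
    have := mul_le_mul_of_nonneg_right (monotone_mul_millsRatio (neg_le_neg huv)) (gaussQ_nonneg z)
    simp only at this
    linarith
  have hr : ∀ u v : ℝ, u ≤ v → z ≤ u → u * steinSol z u ≤ v * steinSol z v := by
    intro u v huv hu
    rw [steinSol_of_ge hu, steinSol_of_ge (hu.trans huv)]
    have := mul_le_mul_of_nonneg_right (monotone_mul_millsRatio huv) (gaussQ_nonneg (-z))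
    simp only at this
    linarith
  intro u v huv
  rcases le_total v z with hv | hv
  · exact hl u v huv hv
  rcases le_total z u with hu | hu
  · exact hr u v huv hu
  · exact (hl u z hu le_rfl).trans (hr z v hv le_rfl)

lemma antitone_stepFun (z : ℝ) : Antitone (stepFun z) := by
  intro u v huv
  unfold stepFun
  split_ifs with h1 h2 h2
  · exact le_rfl
  · exact absurd (huv.trans h1) h2
  · exact zero_le_one
  · exact le_rfl

lemma sub_le_mul_of_hasDerivAt_le {F F' : ℝ → ℝ} {v u C : ℝ} (hvu : v ≤ u)
    (hF : ∀ x, HasDerivAt F (F' x) x) (hC : ∀ x ∈ Set.Ioo v u, F' x ≤ C) :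
    F u - F v ≤ C * (u - v) := by
  rcases hvu.eq_or_lt with rfl | h
  · simp
  · obtain ⟨c, hc, he⟩ := exists_hasDerivAt_eq_slope F F' h
      (fun x _ => (hF x).continuousAt.continuousWithinAt) fun x _ => hF x
    rw [eq_div_iff (sub_pos.2 h).ne'] at he
    rw [← he]
    exact mul_le_mul_of_nonneg_right (hC c hc) (sub_pos.2 h).le

/-- On each side of `z` the derivative is `w f(w)` plus a constant, and `w f(w)` is nondecreasing,
so the mean value theorem bounds it by its value at the right endpoint. When `z` separates `v` and
`u` the two pieces are added, and the larger constant, from the left side, serves for both. -/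
lemma steinSol_sub_le {z v u : ℝ} (hvu : v ≤ u) :
    steinSol z u - steinSol z v ≤
      (u * steinSol z u + stepFun z v - gaussQ (-z)) * (u - v) := by
  have hQ : gaussQ (-z) = 1 - gaussQ z := gaussQ_neg z
  have hl : ∀ u v : ℝ, v ≤ u → u ≤ z → steinSol z u - steinSol z v ≤
      (u * steinSol z u + 1 - gaussQ (-z)) * (u - v) := by
    intro u v hvu hu
    rw [steinSol_of_le hu, steinSol_of_le (hvu.trans hu)]
    refine sub_le_mul_of_hasDerivAt_le (F := fun w => millsRatio (-w) * gaussQ z)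
      (F' := fun w => -((-w) * millsRatio (-w) - 1) * gaussQ z) hvu (fun x => ?_) fun x hx => ?_
    · have := ((hasDerivAt_millsRatio (-x)).comp x (hasDerivAt_neg x)).mul_const (gaussQ z)
      exact this.congr_deriv (by ring)
    · have := mul_le_mul_of_nonneg_right (monotone_mul_millsRatio (neg_le_neg hx.2.le))
        (gaussQ_nonneg z)
      simp only at this
      rw [hQ]
      linarith
  have hr : ∀ u v : ℝ, v ≤ u → z ≤ v → steinSol z u - steinSol z v ≤
      (u * steinSol z u - gaussQ (-z)) * (u - v) := by
    intro u v hvu hv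
    rw [steinSol_of_ge hv, steinSol_of_ge (hv.trans hvu)]
    refine sub_le_mul_of_hasDerivAt_le (F := fun w => millsRatio w * gaussQ (-z))
      (F' := fun w => (w * millsRatio w - 1) * gaussQ (-z)) hvu (fun x => ?_) fun x hx => ?_
    · exact (hasDerivAt_millsRatio x).mul_const (gaussQ (-z))
    · have := mul_le_mul_of_nonneg_right (monotone_mul_millsRatio hx.2.le) (gaussQ_nonneg (-z))
      simp only at this
      linarith
  rcases le_or_gt v z with hv | hv
  · have hs : stepFun z v = 1 := if_pos hv
    rw [hs]
    rcases le_total u z with hu | hu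
    · exact hl u v hvu hu
    · have h1 := hl z v hv le_rfl
      have h2 := hr u z hu le_rfl
      have h3 := monotone_mul_steinSol z hu
      simp only at h3
      nlinarith [mul_le_mul_of_nonneg_right h3 (sub_nonneg.2 hv)]
  · have hs : stepFun z v = 0 := if_neg (not_le.2 hv)
    rw [hs]
    simpa using hr u v hvu hv.le

/-- Compares the increment with the trapezoidal average of the derivative. Since `G(w) = w f(w) -
1{w ≤ z}` is monotone, the error is at most `a/2` times `(u - v)(G u - G v)`. This error has the
same shape as the left side, so exchangeability evaluates its expectation exactly and no third
moments or smoothing are needed. -/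
lemma steinSol_increment_le (z : ℝ) {u v a : ℝ} (h : |u - v| ≤ a) :
    (u - v) * (steinSol z u - steinSol z v) ≤
      (u - v) ^ 2 * ((steinDeriv z u + steinDeriv z v) / 2) +
        a / 2 * ((u - v) * ((u * steinSol z u - stepFun z u) -
          (v * steinSol z v - stepFun z v))) := by
  have key : ∀ u v : ℝ, v ≤ u → u - v ≤ a → (u - v) * (steinSol z u - steinSol z v) ≤
      (u - v) ^ 2 * ((steinDeriv z u + steinDeriv z v) / 2) +
        a / 2 * ((u - v) * ((u * steinSol z u - stepFun z u) -
          (v * steinSol z v - stepFun z v))) := by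
    intro u v hvu ha
    have h1 := mul_le_mul_of_nonneg_left (steinSol_sub_le (z := z) hvu) (sub_nonneg.2 hvu)
    have h2 := monotone_mul_steinSol z hvu
    have h3 := antitone_stepFun z hvu
    simp only at h2
    have h4 : (u - v) * ((u - v) * ((u * steinSol z u - stepFun z u) -
          (v * steinSol z v - stepFun z v))) ≤ a * ((u - v) * ((u * steinSol z u - stepFun z u) -
          (v * steinSol z v - stepFun z v))) :=
      mul_le_mul_of_nonneg_right ha (mul_nonneg (sub_nonneg.2 hvu) (by linarith))
    unfold steinDeriv
    linarith
  rcases le_total v u with hvu | hvu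
  · exact key u v hvu ((le_abs_self _).trans h)
  · have := key v u hvu (by rw [abs_sub_comm] at h; exact (le_abs_self _).trans h)
    linarith

/-! ### Bounded measurable functions -/

/-- Bounded measurable real functions. -/
structure IsBddMeas {Ω : Type*} [MeasurableSpace Ω] (f : Ω → ℝ) : Prop where
  measurable : Measurable f
  bdd : ∃ C : ℝ, ∀ ω, |f ω| ≤ C

namespace IsBddMeas

variable {Ω Ω' : Type*} [MeasurableSpace Ω] [MeasurableSpace Ω'] {f g : Ω → ℝ}

lemma of_le (hf : Measurable f) (C : ℝ) (h : ∀ ω, |f ω| ≤ C) : IsBddMeas f := ⟨hf, C, h⟩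

lemma const (c : ℝ) : IsBddMeas fun _ : Ω => c := ⟨measurable_const, |c|, fun _ => le_rfl⟩

lemma add (hf : IsBddMeas f) (hg : IsBddMeas g) : IsBddMeas fun ω => f ω + g ω := by
  obtain ⟨C, hC⟩ := hf.bdd
  obtain ⟨D, hD⟩ := hg.bdd
  exact ⟨hf.measurable.add hg.measurable, C + D, fun ω =>
    (abs_add_le _ _).trans (add_le_add (hC ω) (hD ω))⟩

lemma mul (hf : IsBddMeas f) (hg : IsBddMeas g) : IsBddMeas fun ω => f ω * g ω := by
  obtain ⟨C, hC⟩ := hf.bdd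
  obtain ⟨D, hD⟩ := hg.bdd
  exact ⟨hf.measurable.mul hg.measurable, C * D, fun ω => by
    rw [abs_mul]
    exact mul_le_mul (hC ω) (hD ω) (abs_nonneg _) ((abs_nonneg _).trans (hC ω))⟩

lemma const_mul (hf : IsBddMeas f) (c : ℝ) : IsBddMeas fun ω => c * f ω := (const c).mul hf

lemma neg (hf : IsBddMeas f) : IsBddMeas fun ω => -f ω := by
  simpa using hf.const_mul (-1)

lemma sub (hf : IsBddMeas f) (hg : IsBddMeas g) : IsBddMeas fun ω => f ω - g ω := by
  simpa [sub_eq_add_neg] using hf.add hg.neg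

lemma pow (hf : IsBddMeas f) (k : ℕ) : IsBddMeas fun ω => f ω ^ k := by
  induction k with
  | zero => simpa using const 1
  | succ k ih => simpa [pow_succ] using ih.mul hf

lemma abs (hf : IsBddMeas f) : IsBddMeas fun ω => |f ω| := by
  obtain ⟨C, hC⟩ := hf.bdd
  exact ⟨hf.measurable.abs, C, fun ω => by simpa using hC ω⟩

lemma sum {ι : Type*} (s : Finset ι) {f : ι → Ω → ℝ} (hf : ∀ i ∈ s, IsBddMeas (f i)) :
    IsBddMeas fun ω => ∑ i ∈ s, f i ω := by
  classical
  induction s using Finset.induction_on with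
  | empty => simpa using const 0
  | insert i s hi ih =>
    simp_rw [Finset.sum_insert hi]
    exact (hf i (by simp)).add (ih fun j hj => hf j (by simp [hj]))

lemma comp (hf : IsBddMeas f) {τ : Ω' → Ω} (hτ : Measurable τ) : IsBddMeas fun ω => f (τ ω) := by
  obtain ⟨C, hC⟩ := hf.bdd
  exact ⟨hf.measurable.comp hτ, C, fun ω => hC _⟩

lemma integrable (hf : IsBddMeas f) (P : Measure Ω) [IsFiniteMeasure P] : Integrable f P := by
  obtain ⟨C, hC⟩ := hf.bdd
  exact Integrable.of_bound hf.measurable.aestronglyMeasurable C (ae_of_all _ hC)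

lemma memLp (hf : IsBddMeas f) (P : Measure Ω) [IsFiniteMeasure P] {p : ℝ≥0∞} : MemLp f p P := by
  obtain ⟨C, hC⟩ := hf.bdd
  exact MemLp.of_bound hf.measurable.aestronglyMeasurable C (ae_of_all _ hC)

end IsBddMeas

/-! ### A Berry–Esseen bound for exchangeable families -/

section Exchangeable

variable {Ω ι : Type*} [MeasurableSpace Ω] [Fintype ι]

/-- Each pair `(T, T' i)` is exchangeable under `P`, and the regressions of the increments
`T - T' i` on `T` add up to that of `L`. -/
structure IsExchangeable (P : Measure Ω) (T : Ω → ℝ) (T' : ι → Ω → ℝ) (L : Ω → ℝ) : Prop where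
  bddMeas : IsBddMeas T
  bddMeas_drift : IsBddMeas L
  swap : ∀ i, ∃ τ : Ω → Ω, MeasurePreserving τ P P ∧ (∀ ω, T (τ ω) = T' i ω) ∧
    ∀ ω, T' i (τ ω) = T ω
  regression : ∀ φ : ℝ → ℝ, Measurable φ → (∃ C : ℝ, ∀ ω, |φ (T ω)| ≤ C) →
    ∑ i, ∫ ω, (T ω - T' i ω) * φ (T ω) ∂P = ∫ ω, L ω * φ (T ω) ∂P

namespace IsExchangeable

variable {P : Measure Ω} {T L : Ω → ℝ} {T' : ι → Ω → ℝ}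

lemma bddMeas' (h : IsExchangeable P T T' L) (i : ι) : IsBddMeas (T' i) := by
  obtain ⟨τ, hτ, h1, -⟩ := h.swap i
  rw [show T' i = fun ω => T (τ ω) from funext fun ω => (h1 ω).symm]
  exact h.bddMeas.comp hτ.measurable

lemma bddMeas_comp (h : IsExchangeable P T T' L)
    {φ : ℝ → ℝ} (hφ : Measurable φ)
    (hb : ∃ C : ℝ, ∀ ω, |φ (T ω)| ≤ C) : IsBddMeas fun ω => φ (T ω) :=
  ⟨hφ.comp h.bddMeas.measurable, hb⟩

lemma bddMeas_comp' (h : IsExchangeable P T T' L)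
    {φ : ℝ → ℝ} (hφ : Measurable φ)
    (hb : ∃ C : ℝ, ∀ ω, |φ (T ω)| ≤ C) (i : ι) : IsBddMeas fun ω => φ (T' i ω) := by
  obtain ⟨τ, hτ, h1, -⟩ := h.swap i
  simp_rw [← h1]
  exact (h.bddMeas_comp hφ hb).comp hτ.measurable

lemma integral_swap (h : IsExchangeable P T T' L) (i : ι) {F : ℝ → ℝ → ℝ}
    (hF : Measurable fun p : ℝ × ℝ => F p.1 p.2) :
    ∫ ω, F (T' i ω) (T ω) ∂P = ∫ ω, F (T ω) (T' i ω) ∂P := by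
  obtain ⟨τ, hτ, h1, h2⟩ := h.swap i
  have hm : Measurable fun ω => F (T ω) (T' i ω) :=
    hF.comp (h.bddMeas.measurable.prodMk (h.bddMeas' i).measurable)
  conv_rhs => rw [← hτ.map_eq]
  rw [integral_map hτ.measurable.aemeasurable hm.aestronglyMeasurable]
  simp_rw [h1, h2]

/-- Exchangeability makes `(T - T') φ(T')` minus `(T - T') φ(T)` in mean, so the increment doubles
the regression term. -/
lemma sum_integral_increment [IsFiniteMeasure P] (h : IsExchangeable P T T' L)
    {φ : ℝ → ℝ} (hφ : Measurable φ)
    (hb : ∃ C : ℝ, ∀ ω, |φ (T ω)| ≤ C) :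
    ∑ i, ∫ ω, (T ω - T' i ω) * (φ (T ω) - φ (T' i ω)) ∂P = 2 * ∫ ω, L ω * φ (T ω) ∂P := by
  rw [← h.regression φ hφ hb, Finset.mul_sum]
  refine Finset.sum_congr rfl fun i _ => ?_
  have h1 := h.integral_swap i (F := fun u v => (u - v) * φ v) (by fun_prop)
  have hd := h.bddMeas.sub (h.bddMeas' i)
  simp_rw [mul_sub]
  rw [integral_sub ((hd.mul (h.bddMeas_comp hφ hb)).integrable P)
    ((hd.mul (h.bddMeas_comp' hφ hb i)).integrable P), ← h1]
  simp_rw [← neg_sub (T _) (T' i _), neg_mul]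
  rw [integral_neg]
  ring

/-- Integrating the Stein equation writes `P(T ≤ z) - Φ(z)` as `E f'(T) - E T f(T)`. The
exchangeable identity applied to `f` replaces `E L f(T)` by half the sum of `(T - T')² f'(T)`, up to
the monotone error. The same identity applied to `G` turns that error into `E L G(T)`, which is
bounded because `|G| ≤ 2`. A lower bound is enough: the upper tail follows by applying it to `-T`.
-/
theorem one_sub_gaussQ_le [IsProbabilityMeasure P] (h : IsExchangeable P T T' L)
    {R : Ω → ℝ} (hR : IsBddMeas R)
    (hL : ∀ ω, L ω = T ω + R ω) {a : ℝ} (ha : ∀ i ω, |T ω - T' i ω| ≤ a) (z : ℝ) :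
    1 - gaussQ z - (2 * ∫ ω, |1 - 1 / 2 * ∑ i, (T ω - T' i ω) ^ 2| ∂P + 2 * ∫ ω, |R ω| ∂P +
      |a| * ∫ ω, |L ω| ∂P) ≤ P.real {ω | T ω ≤ z} := by
  set G : ℝ → ℝ := fun w => w * steinSol z w - stepFun z w
  have hGm : Measurable G := (measurable_id.mul (measurable_steinSol z)).sub (measurable_stepFun z)
  have hGb : ∀ w, |G w| ≤ 2 := fun w => by
    have h1 := abs_le.1 (abs_mul_steinSol_le z w)
    have h2 := stepFun_mem z w
    rw [abs_le]
    constructor <;> simp only [G] <;> linarith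
  have bf := h.bddMeas_comp (measurable_steinSol z) ⟨2, fun ω => abs_steinSol_le z _⟩
  have bf' := h.bddMeas_comp (measurable_steinDeriv z) ⟨2, fun ω => abs_steinDeriv_le z _⟩
  have bs : IsBddMeas fun ω => stepFun z (T ω) := h.bddMeas_comp (measurable_stepFun z)
    ⟨1, fun ω => abs_le.2 ⟨by linarith [(stepFun_mem z (T ω)).1], (stepFun_mem z (T ω)).2⟩⟩
  have bG := h.bddMeas_comp hGm ⟨2, fun ω => hGb _⟩
  have bd : ∀ i, IsBddMeas fun ω => T ω - T' i ω := fun i => h.bddMeas.sub (h.bddMeas' i)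
  have bsum : IsBddMeas fun ω => ∑ i, (T ω - T' i ω) ^ 2 := IsBddMeas.sum _ fun i _ => (bd i).pow 2
  have e1 := h.sum_integral_increment (measurable_steinSol z) ⟨2, fun ω => abs_steinSol_le z _⟩
  have e2 := h.sum_integral_increment hGm ⟨2, fun ω => hGb _⟩
  have e3 : ∀ i, ∫ ω, (T ω - T' i ω) * (steinSol z (T ω) - steinSol z (T' i ω)) ∂P ≤
      ∫ ω, (T ω - T' i ω) ^ 2 * steinDeriv z (T ω) ∂P +
        a / 2 * ∫ ω, (T ω - T' i ω) * (G (T ω) - G (T' i ω)) ∂P := by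
    intro i
    have bf2 := h.bddMeas_comp' (measurable_steinSol z) ⟨2, fun ω => abs_steinSol_le z _⟩ i
    have bf2' := h.bddMeas_comp' (measurable_steinDeriv z) ⟨2, fun ω => abs_steinDeriv_le z _⟩ i
    have bG2 := h.bddMeas_comp' hGm ⟨2, fun ω => hGb _⟩ i
    have i1 := (((bd i).pow 2).mul bf').integrable P
    have i2 := (((bd i).pow 2).mul bf2').integrable P
    have i3 := ((bd i).mul (bG.sub bG2)).integrable P
    have h1 : ∫ ω, (T ω - T' i ω) ^ 2 * steinDeriv z (T' i ω) ∂P =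
        ∫ ω, (T ω - T' i ω) ^ 2 * steinDeriv z (T ω) ∂P := by
      have := h.integral_swap i (F := fun u v => (u - v) ^ 2 * steinDeriv z v) (by
        have := measurable_steinDeriv z
        fun_prop)
      rw [← this]
      refine integral_congr_ae (ae_of_all _ fun ω => ?_)
      simp only
      ring
    have h2 : ∫ ω, (T ω - T' i ω) * (steinSol z (T ω) - steinSol z (T' i ω)) ∂P ≤
        ∫ ω, (1 / 2 * ((T ω - T' i ω) ^ 2 * steinDeriv z (T ω)) +
          1 / 2 * ((T ω - T' i ω) ^ 2 * steinDeriv z (T' i ω))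
          + a / 2 * ((T ω - T' i ω) * (G (T ω) - G (T' i ω)))) ∂P := by
      refine integral_mono (((bd i).mul (bf.sub bf2)).integrable P)
        (((i1.const_mul _).add (i2.const_mul _)).add (i3.const_mul _)) fun ω => ?_
      refine (steinSol_increment_le z (ha i ω)).trans_eq ?_
      simp only [G]
      ring
    refine h2.trans_eq ?_
    rw [integral_add ((((((bd i).pow 2).mul bf').const_mul _).add
      ((((bd i).pow 2).mul bf2').const_mul _)).integrable P) (i3.const_mul _),
      integral_add (i1.const_mul _) (i2.const_mul _), integral_const_mul, integral_const_mul,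
      integral_const_mul, h1]
    ring
  have e4 := Finset.sum_le_sum fun i (_ : i ∈ Finset.univ) => e3 i
  rw [e1, Finset.sum_add_distrib, ← Finset.mul_sum, e2, ← integral_finsetSum _
    fun i _ => (((bd i).pow 2).mul bf').integrable P] at e4
  have e5 : ∫ ω, steinDeriv z (T ω) ∂P - ∫ ω, T ω * steinSol z (T ω) ∂P =
      P.real {ω | T ω ≤ z} - (1 - gaussQ z) := by
    rw [← integral_sub (bf'.integrable P) ((h.bddMeas.mul bf).integrable P), ← gaussQ_neg]
    have h1 : ∀ ω, steinDeriv z (T ω) - T ω * steinSol z (T ω) =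
        stepFun z (T ω) - gaussQ (-z) := fun ω => by
      rw [steinDeriv]; ring
    simp_rw [h1]
    rw [integral_sub (bs.integrable P) (integrable_const _)]
    congr 1
    · have h2 : (fun ω => stepFun z (T ω)) = Set.indicator {ω | T ω ≤ z} fun _ => (1 : ℝ) := by
        ext ω; simp [stepFun, Set.indicator_apply]
      rw [h2, integral_indicator_const _ (measurableSet_le h.bddMeas.measurable measurable_const)]
      simp
    · simp
  have e6 : ∫ ω, L ω * steinSol z (T ω) ∂P =
      ∫ ω, T ω * steinSol z (T ω) ∂P + ∫ ω, R ω * steinSol z (T ω) ∂P := by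
    rw [← integral_add ((h.bddMeas.mul bf).integrable P) ((hR.mul bf).integrable P)]
    exact integral_congr_ae (ae_of_all _ fun ω => by
      simp only [hL ω, add_mul])
  have e7 : ∫ ω, steinDeriv z (T ω) ∂P -
      1 / 2 * ∫ ω, ∑ i, (T ω - T' i ω) ^ 2 * steinDeriv z (T ω) ∂P =
      ∫ ω, (1 - 1 / 2 * ∑ i, (T ω - T' i ω) ^ 2) * steinDeriv z (T ω) ∂P := by
    rw [← integral_const_mul, ← integral_sub (bf'.integrable P)
      ((IsBddMeas.sum _ fun i _ => (((bd i).pow 2).mul bf')).integrable P |>.const_mul _)]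
    refine integral_congr_ae (ae_of_all _ fun ω => ?_)
    simp only [← Finset.sum_mul]
    ring
  have absb : ∀ {X Y : Ω → ℝ}, IsBddMeas X → IsBddMeas Y → (∀ ω, |Y ω| ≤ 2) →
      |∫ ω, X ω * Y ω ∂P| ≤ 2 * ∫ ω, |X ω| ∂P := by
    intro X Y hX hY hb
    refine (abs_integral_le_integral_abs).trans ?_
    rw [← integral_const_mul]
    refine integral_mono ((hX.mul hY).abs.integrable P) ((hX.abs.integrable P).const_mul _)
      fun ω => ?_
    simp only [abs_mul]
    nlinarith [abs_nonneg (X ω), hb ω]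
  have b1 := neg_le_of_abs_le (absb ((IsBddMeas.const 1).sub (bsum.const_mul (1 / 2))) bf'
    fun ω => abs_steinDeriv_le z _)
  have b2 := neg_le_of_abs_le (absb hR bf fun ω => abs_steinSol_le z _)
  have b3 : a * ∫ ω, L ω * G (T ω) ∂P ≤ |a| * (2 * ∫ ω, |L ω| ∂P) := by
    refine (le_abs_self _).trans ?_
    rw [abs_mul]
    exact mul_le_mul_of_nonneg_left (absb h.bddMeas_drift bG fun ω => hGb _) (abs_nonneg _)
  linarith

end IsExchangeable

end Exchangeable

/-! ### Swapping one coordinate of two independent samples -/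

section CoordSwap

variable {ι S : Type*} [DecidableEq ι]

/-- Exchange the `i`-th coordinates of two samples. -/
def coordSwap (i : ι) (p : (ι → S) × (ι → S)) : (ι → S) × (ι → S) :=
  (Function.update p.1 i (p.2 i), Function.update p.2 i (p.1 i))

@[simp] lemma coordSwap_coordSwap (i : ι) (p : (ι → S) × (ι → S)) :
    coordSwap i (coordSwap i p) = p := by
  simp [coordSwap]

/-- A pair of samples is a sample of pairs. In that form the map swaps the two entries of a single
pair, whose law is symmetric. -/
lemma measurePreserving_coordSwap [Fintype ι] [MeasurableSpace S] (ν : ι → Measure S)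
    [∀ i, IsProbabilityMeasure (ν i)] (i : ι) :
    MeasurePreserving (coordSwap i) ((Measure.pi ν).prod (Measure.pi ν))
      ((Measure.pi ν).prod (Measure.pi ν)) := by
  have he := measurePreserving_arrowProdEquivProdArrow S S ι ν ν
  have hs : MeasurePreserving (fun (ω : ι → S × S) j => (if j = i then Prod.swap else id) (ω j))
      (Measure.pi fun j => (ν j).prod (ν j)) (Measure.pi fun j => (ν j).prod (ν j)) := by
    refine measurePreserving_pi _ _ fun j => ?_
    split_ifs
    · exact Measure.measurePreserving_swap
    · exact MeasurePreserving.id _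
  have h := (he.comp hs).comp he.symm
  convert h using 1
  funext p
  refine Prod.ext (funext fun j => ?_) (funext fun j => ?_) <;>
  · by_cases hj : j = i
    · subst hj
      simp [coordSwap, MeasurableEquiv.arrowProdEquivProdArrow, Equiv.arrowProdEquivProdArrow]
    · simp [coordSwap, hj, MeasurableEquiv.arrowProdEquivProdArrow,
        Equiv.arrowProdEquivProdArrow]

end CoordSwap

/-! ### Linear and quadratic statistics of an i.i.d. sample -/

section Moments

lemma integral_abs_le_sqrt {Ω : Type*} [MeasurableSpace Ω] (P : Measure Ω)
    [IsProbabilityMeasure P] {X : Ω → ℝ} (hX : IsBddMeas X) :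
    ∫ ω, |X ω| ∂P ≤ Real.sqrt (∫ ω, X ω ^ 2 ∂P) := by
  refine Real.le_sqrt_of_sq_le ?_
  have h := variance_nonneg (fun ω => |X ω|) P
  rw [variance_eq_sub (hX.abs.memLp P)] at h
  simp only [Pi.pow_apply, sq_abs] at h
  linarith

variable {ι : Type*} [Fintype ι] {S : ι → Type*} [∀ i, MeasurableSpace (S i)]

lemma integral_sum_sq_pi (ν : ∀ i, Measure (S i)) [∀ i, IsProbabilityMeasure (ν i)]
    {ψ : ∀ i, S i → ℝ} (hb : ∀ i, IsBddMeas (ψ i)) (h0 : ∀ i, ∫ x, ψ i x ∂ν i = 0) :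
    ∫ x, (∑ i, ψ i (x i)) ^ 2 ∂Measure.pi ν = ∑ i, ∫ x, ψ i x ^ 2 ∂ν i := by
  have h := variance_sum_pi (μ := ν) (X := ψ) fun i => (hb i).memLp _
  have hm : IsBddMeas fun x : ∀ i, S i => ∑ i, ψ i (x i) :=
    IsBddMeas.sum _ fun i _ => (hb i).comp (measurable_pi_apply i)
  have hs : (∑ i, fun x : ∀ i, S i => ψ i (x i)) = fun x => ∑ i, ψ i (x i) := by
    ext x; simp
  rw [hs, variance_of_integral_eq_zero hm.measurable.aemeasurable] at h
  · rw [h]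
    exact Finset.sum_congr rfl fun i _ =>
      variance_of_integral_eq_zero (hb i).measurable.aemeasurable (h0 i)
  · rw [integral_finsetSum _ fun i _ => ((hb i).comp (measurable_pi_apply i)).integrable _]
    refine Finset.sum_eq_zero fun i _ => ?_
    rw [integral_comp_eval (hb i).measurable.aestronglyMeasurable, h0 i]

lemma integral_sum_sq_pi_le (ν : ∀ i, Measure (S i)) [∀ i, IsProbabilityMeasure (ν i)]
    {ψ : ∀ i, S i → ℝ} (hm : ∀ i, Measurable (ψ i)) (h0 : ∀ i, ∫ x, ψ i x ∂ν i = 0) {b : ℝ}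
    (hb : ∀ i x, |ψ i x| ≤ b) :
    ∫ x, (∑ i, ψ i (x i)) ^ 2 ∂Measure.pi ν ≤ Fintype.card ι * b ^ 2 := by
  rw [integral_sum_sq_pi ν (fun i => .of_le (hm i) b (hb i)) h0]
  calc ∑ i, ∫ x, ψ i x ^ 2 ∂ν i ≤ ∑ i : ι, b ^ 2 := by
        refine Finset.sum_le_sum fun i _ => ?_
        calc ∫ x, ψ i x ^ 2 ∂ν i ≤ ∫ x, b ^ 2 ∂ν i :=
              integral_mono (((IsBddMeas.of_le (hm i) b (hb i)).pow 2).integrable _)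
                (integrable_const _) fun x => by
                  simpa using sq_le_sq.2 ((hb i x).trans (le_abs_self b))
          _ = b ^ 2 := by simp
    _ = _ := by simp

lemma integral_abs_sum_pi_le (ν : ∀ i, Measure (S i)) [∀ i, IsProbabilityMeasure (ν i)]
    {ψ : ∀ i, S i → ℝ} (hm : ∀ i, Measurable (ψ i)) (h0 : ∀ i, ∫ x, ψ i x ∂ν i = 0) {b : ℝ}
    (hb0 : 0 ≤ b) (hb : ∀ i x, |ψ i x| ≤ b) :
    ∫ x, |∑ i, ψ i (x i)| ∂Measure.pi ν ≤ Real.sqrt (Fintype.card ι) * b := by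
  have hbm : IsBddMeas fun x : ∀ i, S i => ∑ i, ψ i (x i) :=
    IsBddMeas.sum _ fun i _ => (IsBddMeas.of_le (hm i) b (hb i)).comp (measurable_pi_apply i)
  refine (integral_abs_le_sqrt _ hbm).trans ?_
  refine (Real.sqrt_le_sqrt (integral_sum_sq_pi_le ν hm h0 hb)).trans_eq ?_
  rw [Real.sqrt_mul (by positivity), Real.sqrt_sq hb0]

end Moments

/-! ### Linear and degenerate quadratic statistics: increments and exchangeability. -/

section Statistics

variable {S : Type*}

/-- The sum `∑ i, g (x i)`. -/
def linStat {n : ℕ} (g : S → ℝ) (x : Fin n → S) : ℝ := ∑ i, g (x i)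

/-- The sum `∑ j ≠ i, q t (x j)`. -/
def rowStat {n : ℕ} (q : S → S → ℝ) (i : Fin n) (x : Fin n → S) (t : S) : ℝ :=
  ∑ j ∈ Finset.univ.erase i, q t (x j)

/-- The sum `∑ i, ∑ j ≠ i, q (x i) (x j)`. -/
def quadStat {n : ℕ} (q : S → S → ℝ) (x : Fin n → S) : ℝ := ∑ i, rowStat q i x (x i)

/-- The sum of `q (x a) (x b)` over the ordered pairs of distinct indices other than `i`. -/
def restStat {n : ℕ} (q : S → S → ℝ) (i : Fin n) (x : Fin n → S) : ℝ :=
  ∑ a ∈ Finset.univ.erase i, ∑ b ∈ (Finset.univ.erase a).erase i, q (x a) (x b)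

variable {n : ℕ} {g : S → ℝ} {q : S → S → ℝ}

lemma linStat_sub_update (i : Fin n) (x : Fin n → S) (s : S) :
    linStat g x - linStat g (Function.update x i s) = g (x i) - g s := by
  unfold linStat
  rw [← Finset.sum_sub_distrib, Finset.sum_eq_single i]
  · simp
  · intro j _ hj; simp [hj]
  · simp

lemma rowStat_update (i : Fin n) (x : Fin n → S) (s t : S) :
    rowStat q i (Function.update x i s) t = rowStat q i x t :=
  Finset.sum_congr rfl fun j hj => by simp [Finset.ne_of_mem_erase hj]

lemma restStat_update (i : Fin n) (x : Fin n → S) (s : S) :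
    restStat q i (Function.update x i s) = restStat q i x :=
  Finset.sum_congr rfl fun a ha => Finset.sum_congr rfl fun b hb => by
    simp [Finset.ne_of_mem_erase ha, Finset.ne_of_mem_erase hb]

/-- Isolates the dependence on coordinate `i`. By symmetry its row and its column agree, and
`restStat` does not involve `x i`. -/
lemma quadStat_eq (hq : ∀ x y, q x y = q y x) (i : Fin n) (x : Fin n → S) :
    quadStat q x = 2 * rowStat q i x (x i) + restStat q i x := by
  unfold quadStat restStat
  rw [← Finset.add_sum_erase _ _ (Finset.mem_univ i), two_mul, add_assoc]
  congr 1
  rw [rowStat, ← Finset.sum_add_distrib]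
  refine Finset.sum_congr rfl fun a ha => ?_
  rw [rowStat, ← Finset.add_sum_erase _ _
    (Finset.mem_erase.2 ⟨(Finset.ne_of_mem_erase ha).symm, Finset.mem_univ i⟩), hq]

lemma quadStat_sub_update (hq : ∀ x y, q x y = q y x) (i : Fin n) (x : Fin n → S) (s : S) :
    quadStat q x - quadStat q (Function.update x i s) =
      2 * (rowStat q i x (x i) - rowStat q i x s) := by
  rw [quadStat_eq hq i x, quadStat_eq hq i, rowStat_update, restStat_update]
  simp
  ring

lemma abs_rowStat_le {b : ℝ} (hq : ∀ x y, |q x y| ≤ b) (i : Fin n) (x : Fin n → S) (t : S) :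
    |rowStat q i x t| ≤ (n - 1) * b := by
  refine (Finset.abs_sum_le_sum_abs _ _).trans ?_
  refine (Finset.sum_le_sum fun j _ => hq t (x j)).trans_eq ?_
  have : 1 ≤ n := by have := i.2; omega
  simp [Nat.cast_sub this]

variable [MeasurableSpace S]

/-- `g` is bounded by `b` and centred; `q` is bounded by `b`, symmetric and degenerate. -/
structure IsHoeffdingPair (P : Measure S) (g : S → ℝ) (q : S → S → ℝ) (b : ℝ) : Prop where
  measurable_lin : Measurable g
  measurable_quad : Measurable (Function.uncurry q)
  abs_lin_le : ∀ x, |g x| ≤ b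
  abs_quad_le : ∀ x y, |q x y| ≤ b
  integral_lin : ∫ x, g x ∂P = 0
  symm : ∀ x y, q x y = q y x
  integral_quad : ∀ x, ∫ y, q x y ∂P = 0

namespace IsHoeffdingPair

variable {P : Measure S} {b : ℝ}

lemma neg (h : IsHoeffdingPair P g q b) :
    IsHoeffdingPair P (fun x => -g x) (fun x y => -q x y) b where
  measurable_lin := h.measurable_lin.neg
  measurable_quad := h.measurable_quad.neg
  abs_lin_le x := by simpa using h.abs_lin_le x
  abs_quad_le x y := by simpa using h.abs_quad_le x y
  integral_lin := by rw [integral_neg, h.integral_lin, neg_zero]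
  symm x y := by rw [h.symm]
  integral_quad x := by rw [integral_neg, h.integral_quad, neg_zero]

lemma nonneg [IsProbabilityMeasure P] (h : IsHoeffdingPair P g q b) : 0 ≤ b := by
  obtain ⟨x⟩ := P.nonempty_of_neZero
  exact (abs_nonneg _).trans (h.abs_lin_le x)

lemma bddMeas_lin (h : IsHoeffdingPair P g q b) : IsBddMeas g :=
  .of_le h.measurable_lin b h.abs_lin_le

lemma bddMeas_quad {Ω : Type*} [MeasurableSpace Ω] (h : IsHoeffdingPair P g q b) {u v : Ω → S}
    (hu : Measurable u) (hv : Measurable v) : IsBddMeas fun ω => q (u ω) (v ω) :=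
  .of_le (h.measurable_quad.comp (hu.prodMk hv)) b fun _ => h.abs_quad_le _ _

lemma bddMeas_linStat (h : IsHoeffdingPair P g q b) :
    IsBddMeas fun x : Fin n → S => linStat g x :=
  IsBddMeas.sum _ fun i _ => h.bddMeas_lin.comp (measurable_pi_apply i)

lemma bddMeas_rowStat {Ω : Type*} [MeasurableSpace Ω] (h : IsHoeffdingPair P g q b)
    (i : Fin n) {u : Ω → Fin n → S} {v : Ω → S} (hu : Measurable u) (hv : Measurable v) :
    IsBddMeas fun ω => rowStat q i (u ω) (v ω) :=
  IsBddMeas.sum _ fun j _ => h.bddMeas_quad hv ((measurable_pi_apply j).comp hu)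

lemma bddMeas_quadStat (h : IsHoeffdingPair P g q b) :
    IsBddMeas fun x : Fin n → S => quadStat q x :=
  IsBddMeas.sum _ fun i _ => h.bddMeas_rowStat i measurable_id' (measurable_pi_apply i)

variable [IsProbabilityMeasure P]

lemma integral_rowStat (h : IsHoeffdingPair P g q b) (i : Fin n) (x : Fin n → S) :
    ∫ t, rowStat q i x t ∂P = 0 := by
  unfold rowStat
  rw [integral_finsetSum _ fun j _ =>
    (h.bddMeas_quad measurable_id' measurable_const).integrable P]
  refine Finset.sum_eq_zero fun j _ => ?_
  simp_rw [h.symm _ (x j)]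
  exact h.integral_quad _

/-- Two independent samples of size `n`. -/
lemma isExchangeable (h : IsHoeffdingPair P g q b) (A B : ℝ) :
    IsExchangeable ((Measure.pi fun _ : Fin n => P).prod (Measure.pi fun _ : Fin n => P))
      (fun p => A * linStat g p.1 + B * quadStat q p.1)
      (fun i p => A * linStat g (coordSwap i p).1 + B * quadStat q (coordSwap i p).1)
      (fun p => A * linStat g p.1 + 2 * B * quadStat q p.1) where
  bddMeas := ((h.bddMeas_linStat.const_mul A).add (h.bddMeas_quadStat.const_mul B)).comp
    measurable_fst
  bddMeas_drift := ((h.bddMeas_linStat.const_mul A).add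
    (h.bddMeas_quadStat.const_mul (2 * B))).comp measurable_fst
  swap i := ⟨coordSwap i, measurePreserving_coordSwap _ i, fun _ => rfl, fun _ => by simp⟩
  regression φ hφ hb := by
    set Pn := Measure.pi fun _ : Fin n => P
    obtain ⟨C, hC⟩ := hb
    have bφ : IsBddMeas fun x : Fin n → S => φ (A * linStat g x + B * quadStat q x) := by
      refine .of_le (hφ.comp ((h.bddMeas_linStat.const_mul A).add
        (h.bddMeas_quadStat.const_mul B)).measurable) C fun x => hC (x, x)
    -- Averaging over the fresh coordinate `p.2 i` removes its linear term by centring and its row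
    -- by degeneracy.
    have key : ∀ i : Fin n, ∫ p, ((A * linStat g p.1 + B * quadStat q p.1) -
        (A * linStat g (coordSwap i p).1 + B * quadStat q (coordSwap i p).1)) *
        φ (A * linStat g p.1 + B * quadStat q p.1) ∂(Pn.prod Pn) =
        ∫ x, (A * g (x i) + 2 * B * rowStat q i x (x i)) *
          φ (A * linStat g x + B * quadStat q x) ∂Pn := by
      intro i
      have b1 : IsBddMeas fun p : (Fin n → S) × (Fin n → S) =>
          A * (g (p.1 i) - g (p.2 i)) +
            2 * B * (rowStat q i p.1 (p.1 i) - rowStat q i p.1 (p.2 i)) :=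
        (((h.bddMeas_lin.comp (by fun_prop)).sub (h.bddMeas_lin.comp (by fun_prop))).const_mul
          A).add (((h.bddMeas_rowStat i (by fun_prop) (by fun_prop)).sub
            (h.bddMeas_rowStat i (by fun_prop) (by fun_prop))).const_mul (2 * B))
      have e1 : ∀ p : (Fin n → S) × (Fin n → S), ((A * linStat g p.1 + B * quadStat q p.1) -
          (A * linStat g (coordSwap i p).1 + B * quadStat q (coordSwap i p).1)) =
          A * (g (p.1 i) - g (p.2 i)) +
            2 * B * (rowStat q i p.1 (p.1 i) - rowStat q i p.1 (p.2 i)) := by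
        intro p
        rw [← linStat_sub_update i p.1 (p.2 i)]
        have := quadStat_sub_update h.symm i p.1 (p.2 i)
        simp only [coordSwap]
        linear_combination B * this
      simp_rw [e1]
      rw [integral_prod _ ((b1.mul (bφ.comp measurable_fst)).integrable _)]
      refine integral_congr_ae (ae_of_all _ fun x => ?_)
      simp only
      rw [integral_mul_const]
      congr 1
      have i1 := h.bddMeas_lin.comp (measurable_pi_apply (X := fun _ : Fin n => S) i)
      have i2 : IsBddMeas fun t : S => rowStat q i x t :=
        h.bddMeas_rowStat i measurable_const measurable_id'
      have i3 := i2.comp (measurable_pi_apply (X := fun _ : Fin n => S) i)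
      rw [integral_add ((((IsBddMeas.const _).sub i1).const_mul A).integrable _)
        ((((IsBddMeas.const _).sub i3).const_mul (2 * B)).integrable _), integral_const_mul,
        integral_const_mul, integral_sub (integrable_const _) (i1.integrable _),
        integral_sub (integrable_const _) (i3.integrable _),
        integral_comp_eval (μ := fun _ : Fin n => P) (i := i)
          h.bddMeas_lin.measurable.aestronglyMeasurable,
        integral_comp_eval (μ := fun _ : Fin n => P) (i := i)
          i2.measurable.aestronglyMeasurable, h.integral_lin, h.integral_rowStat]
      simp
    rw [Finset.sum_congr rfl fun i _ => key i, ← integral_finsetSum _ fun i _ =>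
      ((((h.bddMeas_lin.comp (measurable_pi_apply i)).const_mul A).add
        ((h.bddMeas_rowStat i measurable_id' (measurable_pi_apply i)).const_mul (2 * B))).mul
        bφ).integrable _]
    have b2 : IsBddMeas fun x : Fin n → S => (A * linStat g x + 2 * B * quadStat q x) *
        φ (A * linStat g x + B * quadStat q x) :=
      ((h.bddMeas_linStat.const_mul A).add (h.bddMeas_quadStat.const_mul (2 * B))).mul bφ
    rw [integral_prod _ ((b2.comp measurable_fst).integrable _)]
    refine integral_congr_ae (ae_of_all _ fun x => ?_)
    simp only [integral_const, probReal_univ, one_smul]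
    -- Summing the rows over `i` gives the whole quadratic statistic, still with coefficient `2 *
    -- B`: each pair is hit through both of its indices, which is why the drift exceeds `T` by `B *
    -- quadStat`.
    rw [← Finset.sum_mul, Finset.sum_add_distrib, ← Finset.mul_sum, ← Finset.mul_sum]
    rfl

end IsHoeffdingPair

end Statistics

/-! ### Moment bounds for linear and degenerate quadratic statistics. -/

section Statistics

lemma integral_fst_prod {Ω Ω' : Type*} [MeasurableSpace Ω] [MeasurableSpace Ω'] (P : Measure Ω)
    (P' : Measure Ω') [IsProbabilityMeasure P] [IsProbabilityMeasure P'] {F : Ω → ℝ}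
    (hF : IsBddMeas F) : ∫ p, F p.1 ∂(P.prod P') = ∫ x, F x ∂P := by
  rw [integral_prod _ ((hF.comp measurable_fst).integrable _)]
  simp

lemma integral_snd_prod {Ω Ω' : Type*} [MeasurableSpace Ω] [MeasurableSpace Ω'] (P : Measure Ω)
    (P' : Measure Ω') [IsProbabilityMeasure P] [IsProbabilityMeasure P'] {F : Ω' → ℝ}
    (hF : IsBddMeas F) : ∫ p, F p.2 ∂(P.prod P') = ∫ x, F x ∂P' := by
  rw [integral_prod _ ((hF.comp measurable_snd).integrable _)]
  simp

variable {S : Type*} [MeasurableSpace S] {n : ℕ} {g : S → ℝ} {q : S → S → ℝ}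

namespace IsHoeffdingPair

variable {P : Measure S} {b : ℝ} [IsProbabilityMeasure P]

lemma integral_linStat_sq (h : IsHoeffdingPair P g q b) :
    ∫ x, linStat g x ^ 2 ∂(Measure.pi fun _ : Fin n => P) = n * ∫ x, g x ^ 2 ∂P := by
  unfold linStat
  rw [integral_sum_sq_pi (fun _ => P) (fun _ => h.bddMeas_lin) fun _ => h.integral_lin]
  simp

/-- With the fresh point `p.2 i` held fixed, the row is a sum of independent terms, centred by
degeneracy, so only the diagonal survives in the second moment. -/
lemma integral_rowStat_sq_le (h : IsHoeffdingPair P g q b) (i : Fin n) :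
    ∫ p, rowStat q i p.1 (p.2 i) ^ 2
      ∂((Measure.pi fun _ : Fin n => P).prod (Measure.pi fun _ : Fin n => P)) ≤ n * b ^ 2 := by
  have hb : IsBddMeas fun p : (Fin n → S) × (Fin n → S) => rowStat q i p.1 (p.2 i) ^ 2 :=
    (h.bddMeas_rowStat i (by fun_prop) (by fun_prop)).pow 2
  rw [integral_prod_symm _ (hb.integrable _)]
  have key : ∀ s : Fin n → S, ∫ x, rowStat q i x (s i) ^ 2 ∂(Measure.pi fun _ : Fin n => P) ≤
      n * b ^ 2 := by
    intro s
    have := integral_sum_sq_pi_le (fun _ : Fin n => P)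
      (ψ := fun j y => if j = i then 0 else q (s i) y) (fun j => by
        split_ifs
        · exact measurable_const
        · exact (h.bddMeas_quad measurable_const measurable_id').measurable)
      (fun j => by split_ifs <;> simp [h.integral_quad]) (b := b) (fun j y => by
        split_ifs
        · simpa using h.nonneg
        · exact h.abs_quad_le _ _)
    rw [Fintype.card_fin] at this
    refine le_trans (le_of_eq ?_) this
    congr 1 with x
    rw [rowStat, ← Finset.add_sum_erase _ _ (Finset.mem_univ i)]
    simp only [if_true, zero_add]
    congr 1
    exact Finset.sum_congr rfl fun j hj => by simp [Finset.ne_of_mem_erase hj]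
  calc _ ≤ ∫ s, (n * b ^ 2 : ℝ) ∂(Measure.pi fun _ : Fin n => P) := by
        refine integral_mono_of_nonneg (ae_of_all _ fun s => integral_nonneg fun x => sq_nonneg _)
          (integrable_const _) (ae_of_all _ key)
    _ = _ := by simp

/-- The row excludes index `i`, so swapping coordinate `i` turns its own point into an independent
one. -/
lemma integral_rowStat_self_sq_le (h : IsHoeffdingPair P g q b) (i : Fin n) :
    ∫ p, rowStat q i p.1 (p.1 i) ^ 2
      ∂((Measure.pi fun _ : Fin n => P).prod (Measure.pi fun _ : Fin n => P)) ≤ n * b ^ 2 := by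
  refine le_trans (le_of_eq ?_) (h.integral_rowStat_sq_le i)
  have hb : IsBddMeas fun p : (Fin n → S) × (Fin n → S) => rowStat q i p.1 (p.1 i) ^ 2 :=
    (h.bddMeas_rowStat i (by fun_prop) (by fun_prop)).pow 2
  have hmp := measurePreserving_coordSwap (fun _ : Fin n => P) i
  conv_lhs => rw [← hmp.map_eq]
  rw [integral_map hmp.measurable.aemeasurable hb.measurable.aestronglyMeasurable]
  simp [coordSwap, rowStat_update]

lemma bddMeas_quadStat_increment (h : IsHoeffdingPair P g q b) (i : Fin n) :
    IsBddMeas fun p : (Fin n → S) × (Fin n → S) =>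
      quadStat q p.1 - quadStat q (coordSwap i p).1 :=
  (h.bddMeas_quadStat.comp measurable_fst).sub (h.bddMeas_quadStat.comp (measurable_fst.comp
    (measurePreserving_coordSwap (fun _ : Fin n => P) i).measurable))

lemma integral_quadStat_increment_sq_le (h : IsHoeffdingPair P g q b) (i : Fin n) :
    ∫ p, (quadStat q p.1 - quadStat q (coordSwap i p).1) ^ 2
      ∂((Measure.pi fun _ : Fin n => P).prod (Measure.pi fun _ : Fin n => P)) ≤
      16 * (n * b ^ 2) := by
  have b1 : IsBddMeas fun p : (Fin n → S) × (Fin n → S) => rowStat q i p.1 (p.1 i) ^ 2 :=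
    (h.bddMeas_rowStat i (by fun_prop) (by fun_prop)).pow 2
  have b2 : IsBddMeas fun p : (Fin n → S) × (Fin n → S) => rowStat q i p.1 (p.2 i) ^ 2 :=
    (h.bddMeas_rowStat i (by fun_prop) (by fun_prop)).pow 2
  calc _ ≤ ∫ p, (8 * rowStat q i p.1 (p.1 i) ^ 2 + 8 * rowStat q i p.1 (p.2 i) ^ 2)
        ∂((Measure.pi fun _ : Fin n => P).prod (Measure.pi fun _ : Fin n => P)) := by
        refine integral_mono (((h.bddMeas_quadStat_increment i).pow 2).integrable _)
          (((b1.const_mul 8).add (b2.const_mul 8)).integrable _) fun p => ?_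
        have := quadStat_sub_update h.symm i p.1 (p.2 i)
        simp only [coordSwap, this]
        nlinarith [sq_nonneg (rowStat q i p.1 (p.1 i) + rowStat q i p.1 (p.2 i))]
    _ ≤ _ := by
        rw [integral_add ((b1.const_mul 8).integrable _) ((b2.const_mul 8).integrable _),
          integral_const_mul, integral_const_mul]
        linarith [h.integral_rowStat_sq_le i, h.integral_rowStat_self_sq_le i]

/-- For `A = 0`, `B = 1` the drift is twice the statistic, so the exchangeable identity with `φ =
id` equates four times the second moment with the sum of the squared increments. An Efron–Stein
estimate thus replaces the expansion over quadruples of indices. -/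
lemma integral_quadStat_sq_le (h : IsHoeffdingPair P g q b) :
    ∫ x, quadStat q x ^ 2 ∂(Measure.pi fun _ : Fin n => P) ≤ 4 * (n ^ 2 * b ^ 2) := by
  have hE := h.isExchangeable (n := n) 0 1
  obtain ⟨C, hC⟩ := hE.bddMeas.bdd
  have h1 := hE.sum_integral_increment measurable_id ⟨C, hC⟩
  simp only [zero_mul, zero_add, one_mul, mul_one, id] at h1
  have h2 : ∑ i : Fin n, ∫ p, (quadStat q p.1 - quadStat q (coordSwap i p).1) *
      (quadStat q p.1 - quadStat q (coordSwap i p).1)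
      ∂((Measure.pi fun _ : Fin n => P).prod (Measure.pi fun _ : Fin n => P)) ≤
      ∑ i : Fin n, 16 * (n * b ^ 2) := by
    refine Finset.sum_le_sum fun i _ => ?_
    simpa [sq] using h.integral_quadStat_increment_sq_le i
  have h3 : ∫ p, 2 * quadStat q p.1 * quadStat q p.1
      ∂((Measure.pi fun _ : Fin n => P).prod (Measure.pi fun _ : Fin n => P)) =
      2 * ∫ x, quadStat q x ^ 2 ∂(Measure.pi fun _ : Fin n => P) := by
    rw [← integral_const_mul, ← integral_fst_prod _ (Measure.pi fun _ : Fin n => P)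
      ((h.bddMeas_quadStat.pow 2).const_mul 2)]
    simp only [sq, mul_assoc]
  rw [h1, h3] at h2
  simp only [Finset.sum_const, Finset.card_univ, Fintype.card_fin, nsmul_eq_mul] at h2
  linarith

lemma integral_abs_quadStat_le (h : IsHoeffdingPair P g q b) :
    ∫ x, |quadStat q x| ∂(Measure.pi fun _ : Fin n => P) ≤ 2 * (n * b) := by
  refine (integral_abs_le_sqrt _ h.bddMeas_quadStat).trans ?_
  refine Real.sqrt_le_iff.2 ⟨by have := h.nonneg; positivity, ?_⟩
  exact h.integral_quadStat_sq_le.trans_eq (by ring)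

lemma integral_abs_quadStat_increment_le (h : IsHoeffdingPair P g q b) (i : Fin n) :
    ∫ p, |quadStat q p.1 - quadStat q (coordSwap i p).1|
      ∂((Measure.pi fun _ : Fin n => P).prod (Measure.pi fun _ : Fin n => P)) ≤
      4 * (Real.sqrt n * b) := by
  refine (integral_abs_le_sqrt _ (h.bddMeas_quadStat_increment i)).trans ?_
  refine Real.sqrt_le_iff.2 ⟨by have := h.nonneg; positivity, ?_⟩
  refine (h.integral_quadStat_increment_sq_le i).trans_eq ?_
  rw [mul_pow, mul_pow, Real.sq_sqrt (by positivity)]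
  ring

lemma integral_abs_linStat_le (h : IsHoeffdingPair P g q b) :
    ∫ x, |linStat g x| ∂(Measure.pi fun _ : Fin n => P) ≤ Real.sqrt (n * ∫ x, g x ^ 2 ∂P) := by
  rw [← h.integral_linStat_sq]
  exact integral_abs_le_sqrt _ h.bddMeas_linStat

/-- Expanding `(g - g')²` leaves two sums of `g² - v` and a cross sum `g g'`, the latter centred
given one of the samples. Each has `L¹` norm at most `√n b²`. -/
lemma integral_abs_quadratic_variation_le (h : IsHoeffdingPair P g q b) :
    ∫ p, |n * ∫ x, g x ^ 2 ∂P - 1 / 2 * ∑ i, (g (p.1 i) - g (p.2 i)) ^ 2|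
      ∂((Measure.pi fun _ : Fin n => P).prod (Measure.pi fun _ : Fin n => P)) ≤
      2 * (Real.sqrt n * b ^ 2) := by
  set v := ∫ x, g x ^ 2 ∂P
  set Pn := Measure.pi fun _ : Fin n => P
  have hb0 := h.nonneg
  have hsq : ∀ x, g x ^ 2 ≤ b ^ 2 := fun x => sq_le_sq.2 ((h.abs_lin_le x).trans (le_abs_self b))
  have hv0 : 0 ≤ v := integral_nonneg fun x => sq_nonneg _
  have hv1 : v ≤ b ^ 2 := by
    calc v ≤ ∫ x, b ^ 2 ∂P := integral_mono ((h.bddMeas_lin.pow 2).integrable _)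
          (integrable_const _) hsq
      _ = b ^ 2 := by simp
  have bψ : IsBddMeas fun x => g x ^ 2 - v := (h.bddMeas_lin.pow 2).sub (.const v)
  have h1 : ∫ x, |∑ i, (g (x i) ^ 2 - v)| ∂Pn ≤ Real.sqrt n * b ^ 2 := by
    have := integral_abs_sum_pi_le (fun _ : Fin n => P) (ψ := fun _ x => g x ^ 2 - v)
      (fun _ => bψ.measurable) (fun _ => by
        rw [integral_sub ((h.bddMeas_lin.pow 2).integrable _) (integrable_const _)]
        simp [v]) (b := b ^ 2) (by positivity) (fun _ x => by
        rw [abs_le]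
        constructor <;> linarith [hsq x, sq_nonneg (g x)])
    simpa using this
  have bx : IsBddMeas fun x : Fin n → S => ∑ i, (g (x i) ^ 2 - v) :=
    IsBddMeas.sum _ fun i _ => bψ.comp (measurable_pi_apply i)
  have bxy : IsBddMeas fun p : (Fin n → S) × (Fin n → S) => ∑ i, g (p.2 i) * g (p.1 i) :=
    IsBddMeas.sum _ fun i _ => (h.bddMeas_lin.comp (by fun_prop)).mul
      (h.bddMeas_lin.comp (by fun_prop))
  have h2 : ∫ p, |∑ i, g (p.2 i) * g (p.1 i)| ∂(Pn.prod Pn) ≤ Real.sqrt n * b ^ 2 := by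
    rw [integral_prod_symm _ (bxy.abs.integrable _)]
    have key : ∀ s : Fin n → S, ∫ x, |∑ i, g (s i) * g (x i)| ∂Pn ≤ Real.sqrt n * b ^ 2 := by
      intro s
      have := integral_abs_sum_pi_le (fun _ : Fin n => P) (ψ := fun i x => g (s i) * g x)
        (fun i => (h.bddMeas_lin.const_mul (g (s i))).measurable) (fun i => by
          rw [integral_const_mul, h.integral_lin, mul_zero]) (b := b ^ 2) (by positivity)
          (fun i x => by
            rw [abs_mul, sq]
            exact mul_le_mul (h.abs_lin_le _) (h.abs_lin_le _) (abs_nonneg _) hb0)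
      simpa using this
    calc _ ≤ ∫ s, Real.sqrt n * b ^ 2 ∂Pn :=
          integral_mono_of_nonneg (ae_of_all _ fun s => integral_nonneg fun x => abs_nonneg _)
            (integrable_const _) (ae_of_all _ key)
      _ = _ := by simp
  have b1 : IsBddMeas fun p : (Fin n → S) × (Fin n → S) => |∑ i, (g (p.1 i) ^ 2 - v)| :=
    bx.abs.comp measurable_fst
  have b2 : IsBddMeas fun p : (Fin n → S) × (Fin n → S) => |∑ i, (g (p.2 i) ^ 2 - v)| :=
    bx.abs.comp measurable_snd
  have b4 : IsBddMeas fun p : (Fin n → S) × (Fin n → S) =>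
      ∑ i, (g (p.1 i) - g (p.2 i)) ^ 2 :=
    IsBddMeas.sum _ fun i _ => ((h.bddMeas_lin.comp (by fun_prop)).sub
      (h.bddMeas_lin.comp (by fun_prop))).pow 2
  calc _ ≤ ∫ p, (1 / 2 * |∑ i, (g (p.1 i) ^ 2 - v)| + 1 / 2 * |∑ i, (g (p.2 i) ^ 2 - v)| +
        |∑ i, g (p.2 i) * g (p.1 i)|) ∂(Pn.prod Pn) := by
        refine integral_mono (((IsBddMeas.const _).sub (b4.const_mul (1 / 2))).abs.integrable _)
          ((((b1.const_mul _).add (b2.const_mul _)).add bxy.abs).integrable _) fun p => ?_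
        have e : n * v - 1 / 2 * ∑ i, (g (p.1 i) - g (p.2 i)) ^ 2 =
            -(1 / 2 * ∑ i, (g (p.1 i) ^ 2 - v)) - 1 / 2 * ∑ i, (g (p.2 i) ^ 2 - v) +
              ∑ i, g (p.2 i) * g (p.1 i) := by
          simp only [Finset.mul_sum, ← Finset.sum_neg_distrib, ← Finset.sum_sub_distrib,
            ← Finset.sum_add_distrib]
          rw [← sub_eq_zero, sub_sub, ← Finset.sum_add_distrib]
          have : ∀ i, 1 / 2 * (g (p.1 i) - g (p.2 i)) ^ 2 +
              (-(1 / 2 * (g (p.1 i) ^ 2 - v)) - 1 / 2 * (g (p.2 i) ^ 2 - v) +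
                g (p.2 i) * g (p.1 i)) = v := fun i => by ring
          rw [Finset.sum_congr rfl fun i _ => this i]
          simp
        simp only [e]
        refine (abs_add_le _ _).trans (add_le_add ((abs_sub _ _).trans ?_) le_rfl)
        rw [abs_neg, abs_mul, abs_mul]
        norm_num
    _ ≤ _ := by
        rw [integral_add (((b1.const_mul _).add (b2.const_mul _)).integrable _)
          (bxy.abs.integrable _), integral_add ((b1.const_mul _).integrable _)
          ((b2.const_mul _).integrable _), integral_const_mul, integral_const_mul,
          integral_fst_prod Pn Pn bx.abs, integral_snd_prod Pn Pn bx.abs]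
        linarith

end IsHoeffdingPair

end Statistics

/-! ### The Berry–Esseen bound for linear plus degenerate quadratic statistics. -/

section Statistics

variable {S : Type*} [MeasurableSpace S] {n : ℕ} {g : S → ℝ} {q : S → S → ℝ}

namespace IsHoeffdingPair

variable {P : Measure S} {b : ℝ} [IsProbabilityMeasure P]

/-- In the squared increment the linear part fluctuates by `O(A² √n)` around its mean, which the
normalization cancels. Each quadratic increment is `O(√n)` in mean square, and `n B ≤ A` brings the
cross term and the square to the same order. -/
lemma integral_abs_one_sub_variation_le (h : IsHoeffdingPair P g q b) {A B : ℝ} (hA : 0 ≤ A)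
    (hB : 0 ≤ B) (hAB : n * B ≤ A) (hn : 1 ≤ n) (hnorm : A ^ 2 * (n * ∫ x, g x ^ 2 ∂P) = 1) :
    ∫ p, |1 - 1 / 2 * ∑ i, ((A * linStat g p.1 + B * quadStat q p.1) -
        (A * linStat g (coordSwap i p).1 + B * quadStat q (coordSwap i p).1)) ^ 2|
      ∂((Measure.pi fun _ : Fin n => P).prod (Measure.pi fun _ : Fin n => P)) ≤
      18 * (A ^ 2 * Real.sqrt n * b ^ 2) := by
  set v := ∫ x, g x ^ 2 ∂P
  set Pn := Measure.pi fun _ : Fin n => P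
  have hb0 := h.nonneg
  have hn1 : 1 ≤ Real.sqrt n := Real.one_le_sqrt.2 (by exact_mod_cast hn)
  have hsqn : Real.sqrt n ^ 2 = n := Real.sq_sqrt (by positivity)
  have bg : ∀ i, IsBddMeas fun p : (Fin n → S) × (Fin n → S) => g (p.1 i) - g (p.2 i) := fun i =>
    (h.bddMeas_lin.comp (by fun_prop)).sub (h.bddMeas_lin.comp (by fun_prop))
  have bd := fun i => h.bddMeas_quadStat_increment (n := n) i
  have b1 : IsBddMeas fun p : (Fin n → S) × (Fin n → S) =>
      |n * v - 1 / 2 * ∑ i, (g (p.1 i) - g (p.2 i)) ^ 2| :=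
    ((IsBddMeas.const _).sub ((IsBddMeas.sum _ fun i _ => (bg i).pow 2).const_mul _)).abs
  have b2 : IsBddMeas fun p : (Fin n → S) × (Fin n → S) =>
      ∑ i, |quadStat q p.1 - quadStat q (coordSwap i p).1| :=
    IsBddMeas.sum _ fun i _ => (bd i).abs
  have b3 : IsBddMeas fun p : (Fin n → S) × (Fin n → S) =>
      ∑ i, (quadStat q p.1 - quadStat q (coordSwap i p).1) ^ 2 :=
    IsBddMeas.sum _ fun i _ => (bd i).pow 2
  have e1 : ∀ (i : Fin n) (p : (Fin n → S) × (Fin n → S)),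
      (A * linStat g p.1 + B * quadStat q p.1) -
        (A * linStat g (coordSwap i p).1 + B * quadStat q (coordSwap i p).1) =
      A * (g (p.1 i) - g (p.2 i)) + B * (quadStat q p.1 - quadStat q (coordSwap i p).1) := by
    intro i p
    have := linStat_sub_update (g := g) i p.1 (p.2 i)
    simp only [coordSwap]
    linear_combination A * this
  simp_rw [e1]
  have bL : IsBddMeas fun p : (Fin n → S) × (Fin n → S) =>
      ∑ i, (A * (g (p.1 i) - g (p.2 i)) +
        B * (quadStat q p.1 - quadStat q (coordSwap i p).1)) ^ 2 :=
    IsBddMeas.sum _ fun i _ => (((bg i).const_mul A).add ((bd i).const_mul B)).pow 2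
  have pt : ∀ p : (Fin n → S) × (Fin n → S), |1 - 1 / 2 * ∑ i, (A * (g (p.1 i) - g (p.2 i)) +
        B * (quadStat q p.1 - quadStat q (coordSwap i p).1)) ^ 2| ≤
      A ^ 2 * |n * v - 1 / 2 * ∑ i, (g (p.1 i) - g (p.2 i)) ^ 2| +
        2 * A * B * b * ∑ i, |quadStat q p.1 - quadStat q (coordSwap i p).1| +
        1 / 2 * B ^ 2 * ∑ i, (quadStat q p.1 - quadStat q (coordSwap i p).1) ^ 2 := by
    intro p
    have e2 : 1 - 1 / 2 * ∑ i, (A * (g (p.1 i) - g (p.2 i)) +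
        B * (quadStat q p.1 - quadStat q (coordSwap i p).1)) ^ 2 =
        A ^ 2 * (n * v - 1 / 2 * ∑ i, (g (p.1 i) - g (p.2 i)) ^ 2) -
        A * B * ∑ i, (g (p.1 i) - g (p.2 i)) * (quadStat q p.1 - quadStat q (coordSwap i p).1) -
        1 / 2 * B ^ 2 * ∑ i, (quadStat q p.1 - quadStat q (coordSwap i p).1) ^ 2 := by
      rw [mul_sub, hnorm]
      simp only [add_sq, Finset.sum_add_distrib, mul_pow, Finset.mul_sum, mul_add]
      rw [← sub_eq_zero]
      have : ∑ i, 1 / 2 * (2 * (A * (g (p.1 i) - g (p.2 i))) *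
          (B * (quadStat q p.1 - quadStat q (coordSwap i p).1))) =
          ∑ i, A * B * ((g (p.1 i) - g (p.2 i)) *
            (quadStat q p.1 - quadStat q (coordSwap i p).1)) :=
        Finset.sum_congr rfl fun i _ => by ring
      rw [this]
      have : ∑ i, 1 / 2 * (A ^ 2 * (g (p.1 i) - g (p.2 i)) ^ 2) =
          ∑ i, A ^ 2 * (1 / 2 * (g (p.1 i) - g (p.2 i)) ^ 2) :=
        Finset.sum_congr rfl fun i _ => by ring
      rw [this]
      have : ∑ i, 1 / 2 * (B ^ 2 * (quadStat q p.1 - quadStat q (coordSwap i p).1) ^ 2) =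
          ∑ i, 1 / 2 * B ^ 2 * (quadStat q p.1 - quadStat q (coordSwap i p).1) ^ 2 :=
        Finset.sum_congr rfl fun i _ => by ring
      rw [this]
      ring
    have h2 : |∑ i, (g (p.1 i) - g (p.2 i)) * (quadStat q p.1 - quadStat q (coordSwap i p).1)| ≤
        2 * b * ∑ i, |quadStat q p.1 - quadStat q (coordSwap i p).1| := by
      refine (Finset.abs_sum_le_sum_abs _ _).trans ?_
      rw [Finset.mul_sum]
      refine Finset.sum_le_sum fun i _ => ?_
      rw [abs_mul]
      refine mul_le_mul_of_nonneg_right ((abs_sub _ _).trans ?_) (abs_nonneg _)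
      linarith [h.abs_lin_le (p.1 i), h.abs_lin_le (p.2 i)]
    have h3 : 0 ≤ ∑ i, (quadStat q p.1 - quadStat q (coordSwap i p).1) ^ 2 :=
      Finset.sum_nonneg fun i _ => sq_nonneg _
    rw [e2]
    refine (abs_sub _ _).trans (add_le_add ((abs_sub _ _).trans (add_le_add ?_ ?_)) ?_)
    · rw [abs_mul, abs_of_nonneg (sq_nonneg A)]
    · rw [abs_mul, abs_of_nonneg (mul_nonneg hA hB)]
      have := mul_le_mul_of_nonneg_left h2 (mul_nonneg hA hB)
      linarith
    · rw [abs_of_nonneg (by positivity)]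
  have i1 := h.integral_abs_quadratic_variation_le (n := n)
  have i2 : ∫ p, ∑ i, |quadStat q p.1 - quadStat q (coordSwap i p).1| ∂(Pn.prod Pn) ≤
      n * (4 * (Real.sqrt n * b)) := by
    rw [integral_finsetSum _ fun i _ => (bd i).abs.integrable _]
    refine (Finset.sum_le_sum fun i _ => h.integral_abs_quadStat_increment_le i).trans_eq ?_
    simp
  have i3 : ∫ p, ∑ i, (quadStat q p.1 - quadStat q (coordSwap i p).1) ^ 2 ∂(Pn.prod Pn) ≤
      n * (16 * (n * b ^ 2)) := by
    rw [integral_finsetSum _ fun i _ => ((bd i).pow 2).integrable _]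
    refine (Finset.sum_le_sum fun i _ => h.integral_quadStat_increment_sq_le i).trans_eq ?_
    simp
  refine (integral_mono (((IsBddMeas.const 1).sub (bL.const_mul _)).abs.integrable _)
    ((((b1.const_mul _).add (b2.const_mul _)).add (b3.const_mul _)).integrable _) pt).trans ?_
  rw [integral_add (((b1.const_mul _).add (b2.const_mul _)).integrable _)
    ((b3.const_mul _).integrable _), integral_add ((b1.const_mul _).integrable _)
    ((b2.const_mul _).integrable _), integral_const_mul, integral_const_mul, integral_const_mul]
  have j1 := mul_le_mul_of_nonneg_left i1 (sq_nonneg A)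
  have j2 := mul_le_mul_of_nonneg_left i2 (by positivity : 0 ≤ 2 * A * B * b)
  have j3 := mul_le_mul_of_nonneg_left i3 (by positivity : 0 ≤ 1 / 2 * B ^ 2)
  have k2 : 2 * A * B * b * (n * (4 * (Real.sqrt n * b))) ≤ 8 * (A ^ 2 * Real.sqrt n * b ^ 2) := by
    have := mul_le_mul_of_nonneg_left hAB (by positivity : 0 ≤ 8 * A * Real.sqrt n * b ^ 2)
    linarith
  have k3 : 1 / 2 * B ^ 2 * (n * (16 * (n * b ^ 2))) ≤ 8 * (A ^ 2 * Real.sqrt n * b ^ 2) := by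
    have h1 : (n * B) ^ 2 ≤ A ^ 2 := pow_le_pow_left₀ (by positivity) hAB 2
    have h2 := mul_le_mul_of_nonneg_left h1 (by positivity : 0 ≤ 8 * b ^ 2)
    have h3 := mul_le_mul_of_nonneg_left hn1 (by positivity : 0 ≤ 8 * A ^ 2 * b ^ 2)
    linarith
  linarith

/-- Here `A = 1/(σ √n)` and `B = A/(2 (n - 1))` are the coefficients in the normalized Hoeffding
decomposition of a U-statistic. The remainder `R` is the quadratic part itself, of `L¹` size `O(A
b)`, so every error term is `O(n^{-1/2})`. -/
theorem one_sub_gaussQ_le (h : IsHoeffdingPair P g q b) {σ : ℝ} (hσ : 0 < σ)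
    (hvar : ∫ x, g x ^ 2 ∂P = σ ^ 2) (hn : 2 ≤ n) (z : ℝ) :
    1 - gaussQ z - (60 * (b / σ) ^ 2 + 10 * (b / σ)) / Real.sqrt n ≤
      (Measure.pi fun _ : Fin n => P).real {x |
        linStat g x / (σ * Real.sqrt n) +
          quadStat q x / (2 * (n - 1) * (σ * Real.sqrt n)) ≤ z} := by
  set Pn := Measure.pi fun _ : Fin n => P
  have hb0 := h.nonneg
  have hn2 : (2 : ℝ) ≤ n := by exact_mod_cast hn
  have hn1 : 1 ≤ Real.sqrt n := Real.one_le_sqrt.2 (by linarith)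
  have hsqn : Real.sqrt n ^ 2 = n := Real.sq_sqrt (by positivity)
  obtain ⟨A, hA⟩ : ∃ A, A = 1 / (σ * Real.sqrt n) := ⟨_, rfl⟩
  obtain ⟨B, hB⟩ : ∃ B, B = 1 / (2 * (n - 1) * (σ * Real.sqrt n)) := ⟨_, rfl⟩
  have hA0 : 0 < A := by rw [hA]; positivity
  have hn3 : (0 : ℝ) < n - 1 := by linarith
  have hB0 : 0 < B := by rw [hB]; positivity
  have hB2 : B * (2 * (n - 1)) = A := by rw [hA, hB]; field_simp
  have hAB : n * B ≤ A := by rw [← hB2]; nlinarith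
  have hAσ : A * Real.sqrt n * σ = 1 := by rw [hA]; field_simp
  have hnorm : A ^ 2 * (n * ∫ x, g x ^ 2 ∂P) = 1 := by
    rw [hvar, ← hsqn, ← mul_pow, ← mul_pow, ← mul_assoc, hAσ, one_pow]
  have hE := h.isExchangeable (n := n) A B
  have hbq : IsBddMeas fun p : (Fin n → S) × (Fin n → S) => B * quadStat q p.1 :=
    (h.bddMeas_quadStat.comp measurable_fst).const_mul B
  have main := hE.one_sub_gaussQ_le hbq (fun p => by ring) (a := 6 * (A * b)) (fun i p => by
    have e1 := linStat_sub_update (g := g) i p.1 (p.2 i)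
    have e2 := quadStat_sub_update h.symm i p.1 (p.2 i)
    have e3 : (A * linStat g p.1 + B * quadStat q p.1) -
        (A * linStat g (coordSwap i p).1 + B * quadStat q (coordSwap i p).1) =
        A * (g (p.1 i) - g (p.2 i)) +
          2 * B * (rowStat q i p.1 (p.1 i) - rowStat q i p.1 (p.2 i)) := by
      simp only [coordSwap]
      linear_combination A * e1 + B * e2
    rw [e3]
    refine (abs_add_le _ _).trans ?_
    rw [abs_mul, abs_mul, abs_of_pos hA0, abs_of_pos (by positivity : 0 < 2 * B)]
    have h1 : |g (p.1 i) - g (p.2 i)| ≤ 2 * b :=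
      (abs_sub _ _).trans (by linarith [h.abs_lin_le (p.1 i), h.abs_lin_le (p.2 i)])
    have h2 : |rowStat q i p.1 (p.1 i) - rowStat q i p.1 (p.2 i)| ≤ 2 * ((n - 1) * b) :=
      (abs_sub _ _).trans ((add_le_add (abs_rowStat_le h.abs_quad_le i p.1 (p.1 i))
        (abs_rowStat_le h.abs_quad_le i p.1 (p.2 i))).trans_eq (by ring))
    have h3 := mul_le_mul_of_nonneg_left h1 hA0.le
    have h4 := mul_le_mul_of_nonneg_left h2 (by positivity : 0 ≤ 2 * B)
    have h5 : 2 * B * (2 * ((n - 1) * b)) = 2 * (A * b) := by rw [← hB2]; ring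
    have h6 := mul_nonneg hA0.le hb0
    linarith) z
  have hmeas : MeasurableSet {x : Fin n → S | A * linStat g x + B * quadStat q x ≤ z} :=
    measurableSet_le ((h.bddMeas_linStat.const_mul A).add
      (h.bddMeas_quadStat.const_mul B)).measurable measurable_const
  have eP : (Pn.prod Pn).real {p | A * linStat g p.1 + B * quadStat q p.1 ≤ z} =
      Pn.real {x | A * linStat g x + B * quadStat q x ≤ z} := by
    have := (measurePreserving_fst (μ := Pn) (ν := Pn)).measureReal_preimage
      hmeas.nullMeasurableSet
    exact this
  have eS : {x : Fin n → S | linStat g x / (σ * Real.sqrt n) +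
      quadStat q x / (2 * (n - 1) * (σ * Real.sqrt n)) ≤ z} =
      {x | A * linStat g x + B * quadStat q x ≤ z} := by
    ext x
    simp only [Set.mem_ofPred_eq]
    rw [hA, hB, div_eq_mul_one_div, div_eq_mul_one_div (quadStat q x),
      mul_comm (linStat g x), mul_comm (quadStat q x)]
  rw [eS, ← eP]
  refine le_trans (sub_le_sub_left ?_ _) main
  have hq := h.integral_abs_quadStat_le (n := n)
  have hl := h.integral_abs_linStat_le (n := n)
  have f1 := h.integral_abs_one_sub_variation_le hA0.le hB0.le hAB (by omega) hnorm
  have f2 : ∫ p, |B * quadStat q p.1| ∂(Pn.prod Pn) ≤ 2 * (A * b) := by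
    rw [integral_fst_prod Pn Pn (h.bddMeas_quadStat.const_mul B).abs]
    simp_rw [abs_mul]
    rw [integral_const_mul, abs_of_pos hB0]
    have h1 := mul_le_mul_of_nonneg_left hq hB0.le
    have h2 := mul_le_mul_of_nonneg_right hAB hb0
    linarith
  have f3 : ∫ p, |A * linStat g p.1 + 2 * B * quadStat q p.1| ∂(Pn.prod Pn) ≤
      1 + 4 * (A * b) := by
    have bl : IsBddMeas fun p : (Fin n → S) × (Fin n → S) => |linStat g p.1| :=
      h.bddMeas_linStat.abs.comp measurable_fst
    calc _ ≤ ∫ p, (A * |linStat g p.1| + 2 * |B * quadStat q p.1|) ∂(Pn.prod Pn) := by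
          refine integral_mono (hE.bddMeas_drift.abs.integrable _)
            (((bl.const_mul A).add (hbq.abs.const_mul 2)).integrable _) fun p => ?_
          refine (abs_add_le _ _).trans_eq ?_
          rw [abs_mul, abs_of_pos hA0, mul_assoc, abs_mul 2]
          norm_num
      _ ≤ _ := by
          rw [integral_add ((bl.const_mul A).integrable _) ((hbq.abs.const_mul 2).integrable _),
            integral_const_mul, integral_const_mul,
            integral_fst_prod Pn Pn h.bddMeas_linStat.abs]
          have h1 := mul_le_mul_of_nonneg_left hl hA0.le
          have h2 : A * Real.sqrt (n * ∫ x, g x ^ 2 ∂P) = 1 := by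
            rw [hvar, Real.sqrt_mul (by positivity), Real.sqrt_sq hσ.le, ← mul_assoc, hAσ]
          linarith
  have hAc : A = 1 / σ / Real.sqrt n := by rw [hA, div_div]
  have hAσ' : A ≤ 1 / σ := by rw [hAc]; exact div_le_self (by positivity) hn1
  rw [abs_of_nonneg (by positivity : 0 ≤ 6 * (A * b))]
  have f4 : 6 * (A * b) * ∫ p, |A * linStat g p.1 + 2 * B * quadStat q p.1| ∂(Pn.prod Pn) ≤
      6 * (A * b) * (1 + 4 * (1 / σ * b)) := by
    refine mul_le_mul_of_nonneg_left (f3.trans ?_) (by positivity)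
    have := mul_le_mul_of_nonneg_right hAσ' hb0
    linarith
  have f5 : (60 * (b / σ) ^ 2 + 10 * (b / σ)) / Real.sqrt n =
      36 * (A ^ 2 * Real.sqrt n * b ^ 2) + 4 * (A * b) + 6 * (A * b) * (1 + 4 * (1 / σ * b)) := by
    rw [hAc]
    field_simp
    ring
  rw [f5]
  linarith

end IsHoeffdingPair

end Statistics

/-! ### Tail estimates for U-statistics with a bounded kernel -/

/-- An exponential moment on `{H ≤ t}` is small when `H` is not concentrated on unit intervals. -/
lemma integral_exp_truncated_le {Ω : Type*} [MeasurableSpace Ω] (P : Measure Ω)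
    [IsProbabilityMeasure P] {H : Ω → ℝ} (hm : Measurable H) (h0 : ∀ ω, 0 ≤ H ω) {κ : ℝ}
    (hκ : ∀ s : ℝ, P.real {ω | s - 1 < H ω ∧ H ω ≤ s} ≤ κ) {l : ℝ} (hl : 0 < l) (t : ℝ) :
    ∫ ω, Set.indicator {ω | H ω ≤ t} (fun ω => Real.exp (l * (H ω - t))) ω ∂P ≤
      κ / (1 - Real.exp (-l)) := by
  have hr : Real.exp (-l) < 1 := by simpa using hl
  have hκ0 : 0 ≤ κ := measureReal_nonneg.trans (hκ 0)
  -- Cut `{H ≤ t}` into unit shells below `t`. As `H ≥ 0`, this many shells suffice, and shell `k`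
  -- carries a weight at most `e^{-l k}`.
  set K := ⌊t⌋₊ + 1
  have hs : ∀ k : ℕ, MeasurableSet {ω | t - k - 1 < H ω ∧ H ω ≤ t - k} := fun k =>
    (measurableSet_lt measurable_const hm).inter (measurableSet_le hm measurable_const)
  have pt : ∀ ω, Set.indicator {ω | H ω ≤ t} (fun ω => Real.exp (l * (H ω - t))) ω ≤
      ∑ k ∈ Finset.range K, Real.exp (-l) ^ k *
        Set.indicator {ω | t - k - 1 < H ω ∧ H ω ≤ t - k} (fun _ => (1 : ℝ)) ω := by
    intro ω
    have hn : ∀ k ∈ Finset.range K, 0 ≤ Real.exp (-l) ^ k *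
        Set.indicator {ω | t - k - 1 < H ω ∧ H ω ≤ t - k} (fun _ => (1 : ℝ)) ω := fun k _ =>
      mul_nonneg (by positivity) (Set.indicator_nonneg (fun _ _ => zero_le_one) _)
    by_cases hω : H ω ≤ t
    · rw [Set.indicator_of_mem (by exact hω)]
      have hfl := Nat.floor_le (sub_nonneg.2 hω)
      have hfl2 := Nat.lt_floor_add_one (t - H ω)
      have hmem : ⌊t - H ω⌋₊ ∈ Finset.range K := by
        rw [Finset.mem_range, Nat.lt_succ_iff]
        exact Nat.floor_le_floor (by linarith [h0 ω])
      refine le_trans ?_ (Finset.single_le_sum hn hmem)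
      rw [Set.indicator_of_mem (by constructor <;> linarith), mul_one, ← Real.exp_nat_mul]
      refine Real.exp_le_exp.2 ?_
      nlinarith
    · rw [Set.indicator_of_notMem (by exact hω)]
      exact Finset.sum_nonneg hn
  have hi : ∀ k ∈ Finset.range K, Integrable (fun ω => Real.exp (-l) ^ k *
      Set.indicator {ω | t - k - 1 < H ω ∧ H ω ≤ t - k} (fun _ => (1 : ℝ)) ω) P := fun k _ =>
    ((integrable_const _).indicator (hs k)).const_mul _
  calc _ ≤ ∫ ω, ∑ k ∈ Finset.range K, Real.exp (-l) ^ k *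
        Set.indicator {ω | t - k - 1 < H ω ∧ H ω ≤ t - k} (fun _ => (1 : ℝ)) ω ∂P :=
        integral_mono_of_nonneg (ae_of_all _ fun ω => Set.indicator_nonneg
          (fun _ _ => (Real.exp_pos _).le) _) (integrable_finsetSum _ hi) (ae_of_all _ pt)
    _ = ∑ k ∈ Finset.range K, Real.exp (-l) ^ k *
        P.real {ω | t - k - 1 < H ω ∧ H ω ≤ t - k} := by
        rw [integral_finsetSum _ hi]
        refine Finset.sum_congr rfl fun k _ => ?_
        rw [integral_const_mul, integral_indicator_const _ (hs k)]
        simp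
    _ ≤ ∑ k ∈ Finset.range K, Real.exp (-l) ^ k * κ :=
        Finset.sum_le_sum fun k _ => mul_le_mul_of_nonneg_left (hκ _) (by positivity)
    _ ≤ _ := by
        rw [← Finset.sum_mul, div_eq_inv_mul]
        refine mul_le_mul_of_nonneg_right ?_ hκ0
        rw [← tsum_geometric_of_lt_one (Real.exp_nonneg _) hr]
        exact (summable_geometric_of_lt_one (Real.exp_nonneg _) hr).sum_le_tsum _
          fun _ _ => by positivity

/-! ### The Hoeffding decomposition of a bounded, not necessarily symmetric, kernel. -/

section Kernel

variable {S : Type*}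

variable [MeasurableSpace S]

/-- The mean of the kernel `k`. -/
noncomputable def kernelMean (P : Measure S) (k : S → S → ℝ) : ℝ := ∫ x, ∫ y, k x y ∂P ∂P

/-- The projection of the symmetrized kernel. -/
noncomputable def kernelProj (P : Measure S) (k : S → S → ℝ) (x : S) : ℝ :=
  ∫ y, k x y ∂P + ∫ y, k y x ∂P

variable {P : Measure S} {k : S → S → ℝ}

/-- Summation over ordered pairs does not see the antisymmetric part of `k`, so half the symmetrized
kernel can be used. It splits into its mean, its projections and a remainder that
`isHoeffdingPair_kernel` shows to be degenerate. -/
lemma quadStat_eq_hoeffding {n : ℕ} (x : Fin n → S) :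
    quadStat k x = n * (n - 1) * kernelMean P k +
      (n - 1) * linStat (fun x => kernelProj P k x - 2 * kernelMean P k) x +
      1 / 2 * quadStat (fun x y => k x y + k y x - kernelProj P k x - kernelProj P k y +
        2 * kernelMean P k) x := by
  set m := kernelMean P k
  set h := kernelProj P k
  have hcard : ∀ i : Fin n, (((Finset.univ.erase i).card : ℕ) : ℝ) = n - 1 := fun i => by
    have : 1 ≤ n := by have := i.2; omega
    simp [Nat.cast_sub this]
  have hsymm : ∀ f : Fin n → Fin n → ℝ, ∑ i, ∑ j ∈ Finset.univ.erase i, f j i =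
      ∑ i, ∑ j ∈ Finset.univ.erase i, f i j := fun f =>
    Finset.sum_comm' (by simp [eq_comm])
  have e1 : ∑ i : Fin n, ∑ j ∈ Finset.univ.erase i, h (x i) = (n - 1) * ∑ i, h (x i) := by
    rw [Finset.mul_sum]
    exact Finset.sum_congr rfl fun i _ => by rw [Finset.sum_const, nsmul_eq_mul, hcard]
  have e2 := hsymm fun i _ => h (x i)
  have e3 := hsymm fun i j => k (x i) (x j)
  have e4 : ∑ i : Fin n, ∑ j ∈ Finset.univ.erase i, (2 * m) = n * (n - 1) * (2 * m) := by
    simp_rw [Finset.sum_const, nsmul_eq_mul, hcard, Finset.sum_const]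
    simp [mul_assoc]
  unfold quadStat rowStat linStat
  simp only [Finset.sum_add_distrib, Finset.sum_sub_distrib] at *
  rw [e2, e3, e4, e1]
  simp
  ring

variable [IsProbabilityMeasure P]

lemma abs_integral_le_of_abs_le {f : S → ℝ} {C : ℝ} (hC : ∀ x, |f x| ≤ C) : |∫ x, f x ∂P| ≤ C := by
  simpa using norm_integral_le_of_norm_le_const (μ := P) (f := f) (C := C) (ae_of_all _ hC)

lemma abs_kernelMean_le (hk1 : ∀ x y, |k x y| ≤ 1) : |kernelMean P k| ≤ 1 :=
  abs_integral_le_of_abs_le fun x => abs_integral_le_of_abs_le fun y => hk1 x y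

lemma abs_kernelProj_le (hk1 : ∀ x y, |k x y| ≤ 1) (x : S) : |kernelProj P k x| ≤ 2 := by
  refine (abs_add_le _ _).trans ?_
  linarith [abs_integral_le_of_abs_le (P := P) fun y => hk1 x y,
    abs_integral_le_of_abs_le (P := P) fun y => hk1 y x]

lemma isBddMeas_integral_right (hk : Measurable (Function.uncurry k)) (hk1 : ∀ x y, |k x y| ≤ 1) :
    IsBddMeas fun x => ∫ y, k x y ∂P :=
  .of_le (hk.stronglyMeasurable.integral_prod_right (ν := P)).measurable 1 fun x =>
    abs_integral_le_of_abs_le fun y => hk1 x y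

lemma isBddMeas_integral_left (hk : Measurable (Function.uncurry k)) (hk1 : ∀ x y, |k x y| ≤ 1) :
    IsBddMeas fun x => ∫ y, k y x ∂P :=
  isBddMeas_integral_right (k := fun x y => k y x) (hk.comp measurable_swap) fun x y => hk1 y x

lemma isBddMeas_kernelProj (hk : Measurable (Function.uncurry k)) (hk1 : ∀ x y, |k x y| ≤ 1) :
    IsBddMeas (kernelProj P k) :=
  (isBddMeas_integral_right hk hk1).add (isBddMeas_integral_left hk hk1)

lemma integral_kernelProj (hk : Measurable (Function.uncurry k)) (hk1 : ∀ x y, |k x y| ≤ 1) :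
    ∫ x, kernelProj P k x ∂P = 2 * kernelMean P k := by
  unfold kernelProj
  rw [integral_add ((isBddMeas_integral_right hk hk1).integrable P)
    ((isBddMeas_integral_left hk hk1).integrable P), two_mul, kernelMean]
  congr 1
  have hi : Integrable (Function.uncurry k) (P.prod P) :=
    (IsBddMeas.of_le hk 1 fun p => hk1 p.1 p.2).integrable _
  exact (integral_integral_swap hi).symm

/-- The Hoeffding decomposition of a bounded kernel. -/
lemma isHoeffdingPair_kernel (hk : Measurable (Function.uncurry k)) (hk1 : ∀ x y, |k x y| ≤ 1) :
    IsHoeffdingPair P (fun x => kernelProj P k x - 2 * kernelMean P k)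
      (fun x y => k x y + k y x - kernelProj P k x - kernelProj P k y + 2 * kernelMean P k) 8 where
  measurable_lin := (isBddMeas_kernelProj hk hk1).measurable.sub_const _
  measurable_quad := by
    have h := (isBddMeas_kernelProj (P := P) hk hk1).measurable
    exact (((hk.add (hk.comp measurable_swap)).sub (h.comp measurable_fst)).sub
      (h.comp measurable_snd)).add_const _
  abs_lin_le x := by
    have h1 := abs_le.1 (abs_kernelProj_le (P := P) hk1 x)
    have h2 := abs_le.1 (abs_kernelMean_le (P := P) hk1)
    rw [abs_le]
    constructor <;> linarith
  abs_quad_le x y := by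
    have h1 := abs_le.1 (abs_kernelProj_le (P := P) hk1 x)
    have h1' := abs_le.1 (abs_kernelProj_le (P := P) hk1 y)
    have h2 := abs_le.1 (abs_kernelMean_le (P := P) hk1)
    have h3 := abs_le.1 (hk1 x y)
    have h4 := abs_le.1 (hk1 y x)
    rw [abs_le]
    constructor <;> linarith
  integral_lin := by
    rw [integral_sub ((isBddMeas_kernelProj hk hk1).integrable P) (integrable_const _),
      integral_kernelProj hk hk1]
    simp
  symm x y := by ring
  integral_quad x := by
    have b1 : IsBddMeas fun y => k x y :=
      .of_le (hk.comp measurable_prodMk_left) 1 fun y => hk1 x y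
    have b2 : IsBddMeas fun y => k y x :=
      .of_le (hk.comp measurable_prodMk_right) 1 fun y => hk1 y x
    have b3 := isBddMeas_kernelProj (P := P) hk hk1
    rw [integral_add ((((b1.add b2).sub (.const _)).sub b3).integrable P) (integrable_const _),
      integral_sub (((b1.add b2).sub (.const _)).integrable P) (b3.integrable P),
      integral_sub ((b1.add b2).integrable P) (integrable_const _),
      integral_add (b1.integrable P) (b2.integrable P), integral_kernelProj hk hk1]
    simp [kernelProj]

end Kernel

/-! ### Choice of the decoding threshold. -/

section Threshold

/-- Interval probabilities under a two-sided Gaussian approximation with error `δ`. -/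
lemma measureReal_Ioc_le_of_gaussian {Ω : Type*} [MeasurableSpace Ω] {P : Measure Ω}
    [IsProbabilityMeasure P] {T : Ω → ℝ} (hT : Measurable T) {δ : ℝ} (hδ : 0 < δ)
    (hlow : ∀ z, 1 - gaussQ z - δ ≤ P.real {ω | T ω ≤ z})
    (hupp : ∀ z, 1 - gaussQ z - δ ≤ P.real {ω | -T ω ≤ z}) {u v : ℝ} (huv : u ≤ v) :
    P.real {ω | u < T ω ∧ T ω ≤ v} ≤ v - u + 3 * δ := by
  have h1 := hlow u
  -- Moving the point by `δ` makes `{T ≥ v + δ}` disjoint from `{T ≤ v}`. Atoms then do no harm, at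
  -- the price of the third `δ`.
  have h2 := hupp (-(v + δ))
  rw [gaussQ_neg] at h2
  have h3 := gaussQ_sub_le (show u ≤ v + δ by linarith)
  have m1 : MeasurableSet {ω | T ω ≤ u} := measurableSet_le hT measurable_const
  have m2 : MeasurableSet {ω | -T ω ≤ -(v + δ)} := measurableSet_le hT.neg measurable_const
  have m3 : MeasurableSet {ω | u < T ω ∧ T ω ≤ v} :=
    (measurableSet_lt measurable_const hT).inter (measurableSet_le hT measurable_const)
  have d1 : Disjoint {ω | T ω ≤ u} {ω | u < T ω ∧ T ω ≤ v} :=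
    Set.disjoint_left.2 fun ω h h' => absurd h'.1 (not_lt.2 h)
  have d2 : Disjoint ({ω | T ω ≤ u} ∪ {ω | u < T ω ∧ T ω ≤ v}) {ω | -T ω ≤ -(v + δ)} := by
    refine Set.disjoint_left.2 fun ω h h' => ?_
    have h' : -T ω ≤ -(v + δ) := h'
    rcases h with h | h
    · have h : T ω ≤ u := h
      linarith
    · have h : T ω ≤ v := h.2
      linarith
  have h4 : P.real (({ω | T ω ≤ u} ∪ {ω | u < T ω ∧ T ω ≤ v}) ∪ {ω | -T ω ≤ -(v + δ)}) ≤ 1 :=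
    measureReal_le_one
  rw [measureReal_union d2 m2, measureReal_union d1 m3] at h4
  linarith

lemma quadStat_nonneg {S : Type*} {k : S → S → ℝ} {n : ℕ} (hk0 : ∀ x y, 0 ≤ k x y)
    (x : Fin n → S) : 0 ≤ quadStat k x :=
  Finset.sum_nonneg fun _ _ => Finset.sum_nonneg fun _ _ => hk0 _ _

variable {S : Type*} [MeasurableSpace S] {P : Measure S} [IsProbabilityMeasure P]
  {k : S → S → ℝ}

lemma isBddMeas_quadStat {n : ℕ} (hk : Measurable (Function.uncurry k))
    (hk1 : ∀ x y, |k x y| ≤ 1) : IsBddMeas fun x : Fin n → S => quadStat k x :=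
  IsBddMeas.sum _ fun i _ => IsBddMeas.sum _ fun j _ => .of_le
    (hk.comp ((measurable_pi_apply (X := fun _ : Fin n => S) i).prodMk
      (measurable_pi_apply j)) :) 1 fun _ => hk1 _ _

/-- `H` is an affine function of the normalized statistic `T` with slope `ρ` of order `σ √n`. A
shift of `T` by `O(n^{-1/2})` thus moves `t` by only `O(1)`, and a unit interval of `H` is an
interval of `T` of length `O(n^{-1/2})`. -/
lemma exists_threshold_of_pos (hk : Measurable (Function.uncurry k)) (hk0 : ∀ x y, 0 ≤ k x y)
    (hk1 : ∀ x y, |k x y| ≤ 1) {σ : ℝ} (hσ : 0 < σ)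
    (hvar : ∫ x, (kernelProj P k x - 2 * kernelMean P k) ^ 2 ∂P = σ ^ 2) (z₀ : ℝ) {l : ℝ}
    (hl : 0 < l) : ∃ C₁ C₂ : ℝ, 0 < C₂ ∧ ∃ n₀ : ℕ, ∀ n : ℕ, n₀ ≤ n → ∃ t η : ℝ, 0 < η ∧
      t ≤ n * kernelMean P k + Real.sqrt n * σ * z₀ + C₁ ∧
      (Measure.pi fun _ : Fin n => P).real {x | t < quadStat k x / n + 1} ≤ gaussQ z₀ - η ∧
      ∫ x, Set.indicator {x | quadStat k x / n + 1 ≤ t}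
        (fun x => Real.exp (l * (quadStat k x / n + 1 - t))) x
          ∂(Measure.pi fun _ : Fin n => P) ≤ C₂ * η := by
  set m := kernelMean P k
  have hr : Real.exp (-l) < 1 := by simpa using hl
  set c := 60 * (8 / σ) ^ 2 + 10 * (8 / σ)
  have hc : 0 < c := by positivity
  set κ := gaussDensity (|z₀| + 1)
  have hκ : 0 < κ := gaussDensity_pos _
  -- Shifting by `h / √n` lowers the tail by at least `(c + 1) / √n`: the part `c / √n` pays for the
  -- Berry–Esseen error and the remaining `1 / √n` is `η`.
  set h := (c + 1) / κ
  have hh : 0 < h := by positivity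
  refine ⟨1 + |m| + σ * (|z₀| + h), (2 / σ + 3 * c) / (1 - Real.exp (-l)), div_pos (by positivity)
    (sub_pos.2 hr), max 2 ⌈h ^ 2⌉₊, fun n hn => ?_⟩
  have hn2' : 2 ≤ n := (le_max_left _ _).trans hn
  have hn2 : (2 : ℝ) ≤ n := by exact_mod_cast hn2'
  have hhn : h ≤ Real.sqrt n := by
    refine Real.le_sqrt_of_sq_le ((Nat.le_ceil _).trans ?_)
    exact_mod_cast (le_max_right _ _).trans hn
  set r := Real.sqrt n
  have hr1 : 1 ≤ r := Real.one_le_sqrt.2 (by linarith)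
  have hr0 : 0 < r := by linarith
  have hrr : r * r = n := Real.mul_self_sqrt (by linarith)
  have hp := isHoeffdingPair_kernel (P := P) hk hk1
  obtain ⟨T, hT⟩ : ∃ T : (Fin n → S) → ℝ, T = fun x =>
      linStat (fun x => kernelProj P k x - 2 * m) x / (σ * r) +
        quadStat (fun x y => k x y + k y x - kernelProj P k x - kernelProj P k y + 2 * m) x /
          (2 * (n - 1) * (σ * r)) := ⟨_, rfl⟩
  have hTm : Measurable T := by
    rw [hT]
    exact (hp.bddMeas_linStat.measurable.div_const _).add
      (hp.bddMeas_quadStat.measurable.div_const _)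
  have hlow : ∀ z, 1 - gaussQ z - c / r ≤ (Measure.pi fun _ : Fin n => P).real {x | T x ≤ z} :=
    fun z => by rw [hT]; exact hp.one_sub_gaussQ_le hσ hvar hn2' z
  have hupp : ∀ z, 1 - gaussQ z - c / r ≤ (Measure.pi fun _ : Fin n => P).real {x | -T x ≤ z} := by
    intro z
    have := hp.neg.one_sub_gaussQ_le hσ (by simpa only [neg_sq] using hvar) hn2' z
    convert this using 5 with x
    simp only [hT, linStat, quadStat, rowStat, Finset.sum_neg_distrib]
    ring
  have hn1 : (0 : ℝ) < n - 1 := by linarith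
  set ρ := (n - 1) * σ / r
  have hρ : 0 < ρ := by positivity
  have hH : ∀ x : Fin n → S, quadStat k x / n + 1 = (n - 1) * m + 1 + ρ * T x := by
    intro x
    have e : quadStat k x = n * (n - 1) * m +
      (n - 1) * linStat (fun x => kernelProj P k x - 2 * m) x +
      1 / 2 * quadStat (fun x y => k x y + k y x - kernelProj P k x - kernelProj P k y + 2 * m) x :=
      quadStat_eq_hoeffding x
    rw [e]
    simp only [hT, ρ]
    generalize linStat (fun x => kernelProj P k x - 2 * m) x = L
    generalize quadStat (fun x y => k x y + k y x - kernelProj P k x - kernelProj P k y +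
      2 * m) x = U
    have hn1' : r ^ 2 - 1 ≠ 0 := by rw [sq, hrr]; exact hn1.ne'
    rw [← hrr]
    field_simp
    ring
  have hHm : Measurable fun x : Fin n → S => quadStat k x / n + 1 :=
    ((isBddMeas_quadStat hk hk1).measurable.div_const _).add_const _
  have hle : ∀ (x : Fin n → S) (s : ℝ),
      quadStat k x / n + 1 ≤ s ↔ T x ≤ (s - (n - 1) * m - 1) / ρ := by
    intro x s
    rw [hH, le_div_iff₀ hρ]
    constructor <;> intro h <;> linarith
  have hlt : ∀ (x : Fin n → S) (s : ℝ),
      s < quadStat k x / n + 1 ↔ (s - (n - 1) * m - 1) / ρ < T x := fun x s => by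
    rw [← not_le, hle, not_le]
  refine ⟨(n - 1) * m + 1 + ρ * (z₀ + h / r), 1 / r, by positivity, ?_, ?_, ?_⟩
  · have e1 : ρ * (z₀ + h / r) = r * σ * z₀ + σ * (-(z₀ / r) + h * ((n - 1) / n)) := by
      simp only [ρ]
      rw [← hrr]
      field_simp
      ring
    have e2 : -(z₀ / r) ≤ |z₀| := by
      rw [← neg_div]
      calc -z₀ / r ≤ |z₀| / r := by gcongr; exact neg_le_abs z₀
        _ ≤ |z₀| := div_le_self (abs_nonneg _) hr1
    have e3 : h * ((n - 1) / n) ≤ h := by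
      refine mul_le_of_le_one_right hh.le ?_
      rw [div_le_one (by linarith)]
      linarith
    have e4 := mul_le_mul_of_nonneg_left (add_le_add e2 e3) hσ.le
    rw [e1]
    linarith [neg_le_abs m]
  · have e1 : {x : Fin n → S | (n - 1) * m + 1 + ρ * (z₀ + h / r) < quadStat k x / n + 1} =
        {x | T x ≤ z₀ + h / r}ᶜ := by
      ext x
      rw [Set.mem_ofPred_eq, hlt, Set.mem_compl_iff, Set.mem_ofPred_eq, not_le]
      rw [show ((n - 1) * m + 1 + ρ * (z₀ + h / r) - (n - 1) * m - 1) / ρ = z₀ + h / r by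
        field_simp; ring]
    rw [e1, probReal_compl_eq_one_sub (measurableSet_le hTm measurable_const)]
    have h1 := hlow (z₀ + h / r)
    have h2 := le_gaussQ_sub (x := z₀) (h := h / r) (by positivity) ((div_le_one hr0).2 hhn)
    change κ * (h / r) ≤ _ at h2
    have h3 : κ * (h / r) = c / r + 1 / r := by
      simp only [h]
      field_simp
    linarith
  · refine (integral_exp_truncated_le _ hHm (fun x => add_nonneg (div_nonneg
      (quadStat_nonneg hk0 x) (by linarith)) zero_le_one) (κ := (2 / σ + 3 * c) / r) (fun s => ?_)
      hl _).trans_eq (by field_simp)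
    have e1 : {x : Fin n → S | s - 1 < quadStat k x / n + 1 ∧ quadStat k x / n + 1 ≤ s} =
        {x | (s - 1 - (n - 1) * m - 1) / ρ < T x ∧ T x ≤ (s - (n - 1) * m - 1) / ρ} := by
      ext x
      rw [Set.mem_ofPred_eq, hle, hlt, Set.mem_ofPred_eq]
    rw [e1]
    refine (measureReal_Ioc_le_of_gaussian hTm (by positivity) hlow hupp ?_).trans ?_
    · gcongr
      linarith
    · have e2 : (s - (n - 1) * m - 1) / ρ - (s - 1 - (n - 1) * m - 1) / ρ = 1 / ρ := by
        field_simp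
        ring
      have e3 : 1 / ρ ≤ 2 / σ / r := by
        simp only [ρ]
        rw [one_div_div, div_div, div_le_div_iff₀ (by positivity) (by positivity)]
        nlinarith [mul_pos hσ hr0]
      have e4 : (2 / σ + 3 * c) / r = 2 / σ / r + 3 * (c / r) := by ring
      rw [e2, e4]
      linarith

/-- Without a linear part, `H` differs from `(n - 1) m + 1` by a degenerate statistic divided by `2
n`, which is bounded in `L²`. Chebyshev's inequality then allows a constant `η`, and the truncated
moment is trivially at most `1`. -/
lemma exists_threshold_of_zero (hk : Measurable (Function.uncurry k)) (hk1 : ∀ x y, |k x y| ≤ 1)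
    (hvar : ∫ x, (kernelProj P k x - 2 * kernelMean P k) ^ 2 ∂P = 0) {ε : ℝ}
    (hε : 0 < ε) {l : ℝ} (hl : 0 < l) : ∃ C₁ C₂ : ℝ, 0 < C₂ ∧ ∃ n₀ : ℕ, ∀ n : ℕ, n₀ ≤ n →
      ∃ t η : ℝ, 0 < η ∧ t ≤ n * kernelMean P k + C₁ ∧
      (Measure.pi fun _ : Fin n => P).real {x | t < quadStat k x / n + 1} ≤ ε - η ∧
      ∫ x, Set.indicator {x | quadStat k x / n + 1 ≤ t}
        (fun x => Real.exp (l * (quadStat k x / n + 1 - t))) x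
          ∂(Measure.pi fun _ : Fin n => P) ≤ C₂ * η := by
  set m := kernelMean P k
  -- The second moment is at most `128 n²`, so `r² = 256 / ε` makes the Chebyshev bound exactly `ε /
  -- 2`.
  set r := 16 / Real.sqrt ε
  have hr : 0 < r := by positivity
  have hr2 : r ^ 2 = 256 / ε := by
    simp only [r, div_pow]
    rw [Real.sq_sqrt hε.le]
    norm_num
  refine ⟨1 + |m| + r, 2 / ε, by positivity, 1, fun n hn => ⟨(n - 1) * m + 1 + r, ε / 2,
    by positivity, ?_, ?_, ?_⟩⟩
  · linarith [neg_le_abs m]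
  · have hp := isHoeffdingPair_kernel (P := P) hk hk1
    have hn0 : (0 : ℝ) < n := by exact_mod_cast hn
    have b1 := hp.bddMeas_linStat (n := n)
    have b2 := hp.bddMeas_quadStat (n := n)
    have h1 := hp.integral_linStat_sq (n := n)
    have h2 := hp.integral_quadStat_sq_le (n := n)
    rw [hvar, mul_zero] at h1
    set Pn := Measure.pi fun _ : Fin n => P
    have bD : IsBddMeas fun x : Fin n → S => (quadStat k x - n * (n - 1) * m) ^ 2 :=
      ((isBddMeas_quadStat hk hk1).sub (.const _)).pow 2
    have h3 : ∫ x, (quadStat k x - n * (n - 1) * m) ^ 2 ∂Pn ≤ 128 * (n : ℝ) ^ 2 := by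
      refine (integral_mono (bD.integrable Pn) ((((b1.pow 2).const_mul (2 * (n - 1 : ℝ) ^ 2)).add
        ((b2.pow 2).const_mul (1 / 2))).integrable Pn) fun x => ?_).trans ?_
      · simp only
        rw [quadStat_eq_hoeffding (P := P) (k := k) x]
        exact le_of_sub_nonneg (le_of_le_of_eq (sq_nonneg ((n - 1) *
          linStat (fun x => kernelProj P k x - 2 * m) x - 1 / 2 * quadStat (fun x y =>
            k x y + k y x - kernelProj P k x - kernelProj P k y + 2 * m) x)) (by ring))
      · rw [integral_add (((b1.pow 2).const_mul _).integrable Pn)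
          (((b2.pow 2).const_mul _).integrable Pn), integral_const_mul, integral_const_mul, h1]
        linarith
    have h4 := mul_meas_ge_le_integral_of_nonneg (μ := Pn) (ae_of_all _ fun x => sq_nonneg _)
      (bD.integrable Pn) ((n * r) ^ 2)
    have h5 : Pn.real {x | (n - 1) * m + 1 + r < quadStat k x / n + 1} ≤
        Pn.real {x | (n * r) ^ 2 ≤ (quadStat k x - n * (n - 1) * m) ^ 2} := by
      refine measureReal_mono fun x hx => ?_
      have hx : (n - 1) * m + 1 + r < quadStat k x / n + 1 := hx
      have hx2 : (n - 1) * m + r < quadStat k x / n := by linarith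
      rw [lt_div_iff₀ hn0] at hx2
      change (n * r) ^ 2 ≤ (quadStat k x - n * (n - 1) * m) ^ 2
      exact pow_le_pow_left₀ (by positivity) (by linarith) 2
    have h6 : (n * r) ^ 2 * Pn.real {x | (n - 1) * m + 1 + r < quadStat k x / n + 1} ≤
        128 * (n : ℝ) ^ 2 := (mul_le_mul_of_nonneg_left h5 (by positivity)).trans (h4.trans h3)
    rw [mul_pow, hr2, ← le_div_iff₀' (by positivity)] at h6
    refine h6.trans_eq ?_
    field_simp
    norm_num
  · rw [div_mul_div_comm, mul_comm ε, div_self (by positivity)]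
    calc _ ≤ ∫ x, (1 : ℝ) ∂(Measure.pi fun _ : Fin n => P) := by
          refine integral_mono_of_nonneg (ae_of_all _ fun x => Set.indicator_nonneg
            (fun _ _ => (Real.exp_pos _).le) _) (integrable_const _) (ae_of_all _ fun x => ?_)
          refine Set.indicator_le' (fun x hx => ?_) (fun _ _ => zero_le_one) x
          have hx : quadStat k x / n + 1 ≤ (n - 1) * m + 1 + r := hx
          exact Real.exp_le_one_iff.2 (mul_nonpos_of_nonneg_of_nonpos hl.le (by linarith))
      _ = 1 := by simp

theorem exists_threshold (hk : Measurable (Function.uncurry k)) (hk0 : ∀ x y, 0 ≤ k x y)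
    (hk1 : ∀ x y, |k x y| ≤ 1) {ε : ℝ} (hε0 : 0 < ε) (hε1 : ε < 1) {l : ℝ} (hl : 0 < l) :
    ∃ C₁ C₂ : ℝ, 0 < C₂ ∧ ∃ n₀ : ℕ, ∀ n : ℕ, n₀ ≤ n → ∃ t η : ℝ, 0 < η ∧
      t ≤ n * kernelMean P k +
        Real.sqrt (n * variance (kernelProj P k) P) * gaussQInv ε + C₁ ∧
      (Measure.pi fun _ : Fin n => P).real {x | t < quadStat k x / n + 1} ≤ ε - η ∧
      ∫ x, Set.indicator {x | quadStat k x / n + 1 ≤ t}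
        (fun x => Real.exp (l * (quadStat k x / n + 1 - t))) x
          ∂(Measure.pi fun _ : Fin n => P) ≤ C₂ * η := by
  have hv : variance (kernelProj P k) P =
      ∫ x, (kernelProj P k x - 2 * kernelMean P k) ^ 2 ∂P := by
    rw [variance_eq_integral (isBddMeas_kernelProj hk hk1).measurable.aemeasurable,
      integral_kernelProj hk hk1]
  rcases (variance_nonneg (kernelProj P k) P).eq_or_lt with h0 | h0
  · simp only [← h0, mul_zero, Real.sqrt_zero, zero_mul, add_zero]
    exact exists_threshold_of_zero hk hk1 (by rw [← hv, h0]) hε0 hl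
  · have := exists_threshold_of_pos hk hk0 hk1 (Real.sqrt_pos.2 h0)
      (by rw [← hv, Real.sq_sqrt h0.le]) (gaussQInv ε) hl
    simpa only [gaussQ_gaussQInv hε0 hε1, Real.sqrt_mul (Nat.cast_nonneg _)] using this

end Threshold

/-! ### Anti-concentration of sums of independent variables -/

section AntiConcentration

variable {ι S : Type*} [Fintype ι] [DecidableEq ι] [MeasurableSpace S] {ν : ι → Measure S}
  [∀ i, IsProbabilityMeasure (ν i)]

/-- Independence of one coordinate from a function of the others, obtained by replacing that
coordinate with an independent copy. -/
lemma integral_mul_eq_zero_of_update {ψ : S → ℝ} {G : (ι → S) → ℝ} (hψ : IsBddMeas ψ)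
    (hG : IsBddMeas G) (i : ι) (h0 : ∫ s, ψ s ∂ν i = 0)
    (hGi : ∀ x s, G (Function.update x i s) = G x) :
    ∫ x, ψ (x i) * G x ∂Measure.pi ν = 0 := by
  have b1 : IsBddMeas fun x : ι → S => ψ (x i) * G x := (hψ.comp (measurable_pi_apply i)).mul hG
  have hmp := measurePreserving_coordSwap ν i
  rw [← integral_fst_prod (Measure.pi ν) (Measure.pi ν) b1, ← hmp.map_eq,
    integral_map hmp.measurable.aemeasurable
      (b1.comp measurable_fst).measurable.aestronglyMeasurable]
  simp only [coordSwap, Function.update_self, hGi]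
  have b2 : IsBddMeas fun p : (ι → S) × (ι → S) => ψ (p.2 i) * G p.1 :=
    (hψ.comp (by fun_prop)).mul (hG.comp measurable_fst)
  rw [integral_prod _ (b2.integrable _)]
  simp_rw [integral_mul_const]
  rw [integral_comp_eval hψ.measurable.aestronglyMeasurable, h0]
  simp

/-- Truncation of `w - c` to `[-3/2, 3/2]`. -/
noncomputable def clampAt (c w : ℝ) : ℝ := max (-(3 / 2)) (min (w - c) (3 / 2))

lemma continuous_clampAt (c : ℝ) : Continuous (clampAt c) := by
  unfold clampAt; fun_prop

lemma abs_clampAt_le (c w : ℝ) : |clampAt c w| ≤ 3 / 2 := by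
  unfold clampAt
  rw [abs_le]
  exact ⟨le_max_left _ _, max_le (by norm_num) (min_le_right _ _)⟩

lemma monotone_clampAt (c : ℝ) : Monotone (clampAt c) := fun u v h =>
  max_le_max le_rfl (min_le_min (by linarith) le_rfl)

lemma clampAt_of_abs_le {c w : ℝ} (h : |w - c| ≤ 3 / 2) : clampAt c w = w - c := by
  rw [abs_le] at h
  unfold clampAt
  rw [min_eq_left h.2, max_eq_right h.1]

lemma mul_clampAt_sub_nonneg (c w ξ : ℝ) : 0 ≤ ξ * (clampAt c w - clampAt c (w - ξ)) := by
  rcases le_total 0 ξ with h | h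
  · exact mul_nonneg h (sub_nonneg.2 (monotone_clampAt c (by linarith)))
  · exact mul_nonneg_of_nonpos_of_nonpos h (sub_nonpos.2 (monotone_clampAt c (by linarith)))

/-- Let `W` be the sum and `f` a clamped identity. By centring, `E W f(W)` is the sum of `E ψ_i
(f(W) - f(W - ψ_i))`. All these terms are nonnegative, and on the event the `i`-th integrand is
`ψ_i² ≥ d_i²`. The left side is at most `(3/2) E|W|`. -/
lemma measureReal_sum_Ioc_le {ψ : ι → S → ℝ} (hm : ∀ i, Measurable (ψ i))
    (hb : ∀ i s, |ψ i s| ≤ 1) (h0 : ∀ i, ∫ s, ψ i s ∂ν i = 0) {d : ι → ℝ} (hd0 : ∀ i, 0 ≤ d i)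
    (hd : ∀ i s, d i ≤ |ψ i s|) (hD : 0 < ∑ i, d i ^ 2) (s : ℝ) :
    (Measure.pi ν).real {x | s - 1 < ∑ i, ψ i (x i) ∧ ∑ i, ψ i (x i) ≤ s} ≤
      3 / 2 * Real.sqrt (Fintype.card ι) / ∑ i, d i ^ 2 := by
  -- Centre of the interval: on the event `W` is within `1/2` of `c`, hence `W - ψ_i` within `3/2`,
  -- and the clamp is inactive at both points.
  set c := s - 1 / 2
  set W : (ι → S) → ℝ := fun x => ∑ i, ψ i (x i) with hW
  have bψ : ∀ i, IsBddMeas fun x : ι → S => ψ i (x i) := fun i =>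
    (IsBddMeas.of_le (hm i) 1 (hb i)).comp (measurable_pi_apply i)
  have bW : IsBddMeas W := IsBddMeas.sum _ fun i _ => bψ i
  have bc : ∀ {X : (ι → S) → ℝ}, IsBddMeas X → IsBddMeas fun x => clampAt c (X x) := fun hX =>
    .of_le ((continuous_clampAt c).measurable.comp hX.measurable) _ fun _ => abs_clampAt_le _ _
  have bm : ∀ i, IsBddMeas fun x => W x - ψ i (x i) := fun i => bW.sub (bψ i)
  have e1 : ∀ i, ∫ x, ψ i (x i) * clampAt c (W x - ψ i (x i)) ∂Measure.pi ν = 0 := by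
    intro i
    refine integral_mul_eq_zero_of_update (IsBddMeas.of_le (hm i) 1 (hb i)) (bc (bm i)) i (h0 i)
      fun x t => ?_
    congr 1
    simp only [hW]
    rw [← Finset.add_sum_erase _ _ (Finset.mem_univ i),
      ← Finset.add_sum_erase _ (fun j => ψ j (x j)) (Finset.mem_univ i), add_sub_cancel_left,
      add_sub_cancel_left]
    exact Finset.sum_congr rfl fun j hj => by simp [Finset.ne_of_mem_erase hj]
  have e2 : ∫ x, W x * clampAt c (W x) ∂Measure.pi ν =
      ∑ i, ∫ x, ψ i (x i) * (clampAt c (W x) - clampAt c (W x - ψ i (x i))) ∂Measure.pi ν := by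
    simp_rw [mul_sub]
    rw [Finset.sum_congr rfl fun i _ => integral_sub (((bψ i).mul (bc bW)).integrable _)
      (((bψ i).mul (bc (bm i))).integrable _)]
    simp_rw [e1, sub_zero]
    rw [← integral_finsetSum _ fun i _ => ((bψ i).mul (bc bW)).integrable _]
    simp_rw [← Finset.sum_mul]
    rfl
  have ms : MeasurableSet {x | s - 1 < W x ∧ W x ≤ s} :=
    (measurableSet_lt measurable_const bW.measurable).inter
      (measurableSet_le bW.measurable measurable_const)
  have e3 : ∀ i, d i ^ 2 * (Measure.pi ν).real {x | s - 1 < W x ∧ W x ≤ s} ≤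
      ∫ x, ψ i (x i) * (clampAt c (W x) - clampAt c (W x - ψ i (x i))) ∂Measure.pi ν := by
    intro i
    have : d i ^ 2 * (Measure.pi ν).real {x | s - 1 < W x ∧ W x ≤ s} =
        ∫ x, Set.indicator {x | s - 1 < W x ∧ W x ≤ s} (fun _ => d i ^ 2) x ∂Measure.pi ν := by
      rw [integral_indicator_const _ ms, smul_eq_mul, mul_comm]
    rw [this]
    refine integral_mono ((integrable_const _).indicator ms)
      (((bψ i).mul ((bc bW).sub (bc (bm i)))).integrable _) fun x => ?_
    by_cases hx : x ∈ {x | s - 1 < W x ∧ W x ≤ s}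
    · rw [Set.indicator_of_mem hx]
      have hx1 : s - 1 < W x := hx.1
      have hx2 : W x ≤ s := hx.2
      have hψ := abs_le.1 (hb i (x i))
      rw [clampAt_of_abs_le (by rw [abs_le]; simp only [c]; constructor <;> linarith),
        clampAt_of_abs_le (by rw [abs_le]; simp only [c]; constructor <;> linarith)]
      calc d i ^ 2 ≤ |ψ i (x i)| ^ 2 := pow_le_pow_left₀ (hd0 i) (hd i _) 2
        _ = _ := by rw [sq_abs]; ring
    · rw [Set.indicator_of_notMem hx]
      exact mul_clampAt_sub_nonneg _ _ _
  have e4 : ∫ x, W x * clampAt c (W x) ∂Measure.pi ν ≤ 3 / 2 * Real.sqrt (Fintype.card ι) := by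
    calc _ ≤ ∫ x, 3 / 2 * |W x| ∂Measure.pi ν := by
          refine integral_mono ((bW.mul (bc bW)).integrable _)
            ((bW.abs.const_mul _).integrable _) fun x => ?_
          refine (le_abs_self _).trans ?_
          rw [abs_mul, mul_comm]
          exact mul_le_mul_of_nonneg_right (abs_clampAt_le _ _) (abs_nonneg _)
      _ ≤ _ := by
          rw [integral_const_mul]
          have := integral_abs_sum_pi_le ν hm h0 zero_le_one hb
          rw [mul_one] at this
          linarith
  rw [le_div_iff₀ hD, mul_comm, Finset.sum_mul]
  exact (Finset.sum_le_sum fun i _ => e3 i).trans (e2 ▸ e4)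

end AntiConcentration

/-! ### Counting sign vectors with small weighted number of negative entries -/

section Counting

instance : MeasurableSingletonClass ℤˣ :=
  ⟨fun u => ⟨{(u : ℤ)}, measurableSet_singleton _, by ext v; simp [Units.ext_iff]⟩⟩

/-- Indicator of the negative unit. -/
def negInd (u : ℤˣ) : ℝ := if (u : ℤ) < 0 then 1 else 0

@[simp] lemma negInd_one : negInd 1 = 0 := by simp [negInd]

@[simp] lemma negInd_neg_one : negInd (-1) = 1 := by simp [negInd]

lemma measurable_of_units {β : Type*} [MeasurableSpace β] (f : ℤˣ → β) : Measurable f :=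
  measurable_of_countable f

/-- The law on signs that gives `-1` the odds `e ^ v`. -/
noncomputable def signLaw (v : ℝ) : Measure ℤˣ :=
  ENNReal.ofReal (Real.exp v / (1 + Real.exp v)) • Measure.dirac (-1) +
    ENNReal.ofReal (1 / (1 + Real.exp v)) • Measure.dirac 1

instance (v : ℝ) : IsProbabilityMeasure (signLaw v) := by
  constructor
  simp only [signLaw, Measure.add_apply, Measure.smul_apply, measure_univ, smul_eq_mul, mul_one]
  rw [← ENNReal.ofReal_add (by positivity) (by positivity), ← add_div, add_comm (Real.exp v),
    div_self (by positivity), ENNReal.ofReal_one]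

lemma signLaw_real_singleton (v : ℝ) (u : ℤˣ) :
    (signLaw v).real {u} = Real.exp (v * negInd u) / (1 + Real.exp v) := by
  have h1 : (-1 : ℤˣ) ≠ 1 := by decide
  have h2 : (1 : ℤˣ) ≠ -1 := by decide
  rcases Int.units_eq_one_or u with rfl | rfl
  · simp [signLaw, measureReal_def, h1, ENNReal.toReal_ofReal,
      (by positivity : 0 ≤ 1 + Real.exp v)]
  · simp [signLaw, measureReal_def, h2, ENNReal.toReal_ofReal,
      (by positivity : 0 ≤ Real.exp v / (1 + Real.exp v))]

lemma integral_signLaw (v : ℝ) (f : ℤˣ → ℝ) :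
    ∫ u, f u ∂signLaw v = Real.exp v / (1 + Real.exp v) * f (-1) + 1 / (1 + Real.exp v) * f 1 := by
  rw [integral_fintype .of_finite]
  have : (Finset.univ : Finset ℤˣ) = {1, -1} := rfl
  rw [this, Finset.sum_pair (by decide)]
  simp only [signLaw_real_singleton, smul_eq_mul]
  simp
  ring

lemma signLaw_pi_real_singleton {n : ℕ} (v : Fin n → ℝ) (u : Fin n → ℤˣ) :
    (Measure.pi fun i => signLaw (v i)).real {u} =
      Real.exp (∑ i, v i * negInd (u i)) / ∏ i, (1 + Real.exp (v i)) := by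
  rw [measureReal_def, Measure.pi_singleton, ENNReal.toReal_prod, Real.exp_sum,
    ← Finset.prod_div_distrib]
  exact Finset.prod_congr rfl fun i _ => signLaw_real_singleton _ _

/-- Under the tilted law the probability `p i` of a negative sign lies in `[δ, 1/2]`, with `δ`
depending only on `θ`. Both values of the centred indicator are then at least `δ` in modulus, as the
anti-concentration bound requires. -/
lemma measureReal_signLaw_Ioc_le {n : ℕ} {θ : ℝ} (hθ : θ ≤ 0) {w : Fin n → ℝ}
    (hw0 : ∀ i, 0 ≤ w i) (hw1 : ∀ i, w i ≤ 1) (hn : 0 < n) (hsq : (n : ℝ) / 3 ≤ ∑ i, w i ^ 2)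
    (s : ℝ) : (Measure.pi fun i => signLaw (θ * w i)).real
      {u | s - 1 < ∑ i, w i * negInd (u i) ∧ ∑ i, w i * negInd (u i) ≤ s} ≤
      9 / 2 * (1 + Real.exp (-θ)) ^ 2 / Real.sqrt n := by
  set p : Fin n → ℝ := fun i => Real.exp (θ * w i) / (1 + Real.exp (θ * w i))
  set δ := 1 / (1 + Real.exp (-θ))
  have hn' : (0 : ℝ) < n := by exact_mod_cast hn
  have hδ : 0 < δ := by positivity
  have hp1 : ∀ i, p i ≤ 1 / 2 := fun i => by
    have : Real.exp (θ * w i) ≤ 1 :=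
      Real.exp_le_one_iff.2 (mul_nonpos_of_nonpos_of_nonneg hθ (hw0 i))
    simp only [p]
    rw [div_le_div_iff₀ (by positivity) (by norm_num)]
    linarith
  have hpδ : ∀ i, δ ≤ p i := fun i => by
    have h1 : Real.exp (-(θ * w i)) ≤ Real.exp (-θ) :=
      Real.exp_le_exp.2 (by nlinarith [hw1 i, hw0 i])
    have h2 : p i = 1 / (1 + Real.exp (-(θ * w i))) := by
      simp only [p]
      rw [Real.exp_neg]
      field_simp
      ring
    rw [h2]
    simp only [δ]
    gcongr
  have hval : ∀ i (u : ℤˣ), δ ≤ |negInd u - p i| ∧ |negInd u - p i| ≤ 1 := by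
    intro i u
    have h1 := hp1 i
    have h2 := hpδ i
    rcases Int.units_eq_one_or u with rfl | rfl
    · rw [negInd_one, zero_sub, abs_neg, abs_of_nonneg (by linarith)]
      constructor <;> linarith
    · rw [negInd_neg_one, abs_of_nonneg (by linarith)]
      constructor <;> linarith
  have hD : δ ^ 2 * (n / 3) ≤ ∑ i, (w i * δ) ^ 2 := by
    simp_rw [mul_pow]
    rw [← Finset.sum_mul, mul_comm]
    exact mul_le_mul_of_nonneg_right hsq (by positivity)
  have hD0 : 0 < δ ^ 2 * (n / 3 : ℝ) := by positivity
  have h := measureReal_sum_Ioc_le (ν := fun i => signLaw (θ * w i))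
    (ψ := fun i u => w i * (negInd u - p i)) (fun i => measurable_of_units _) (fun i u => by
      rw [abs_mul, abs_of_nonneg (hw0 i)]
      exact mul_le_one₀ (hw1 i) (abs_nonneg _) (hval i u).2) (fun i => by
      rw [integral_signLaw]
      simp only [p, negInd_one, negInd_neg_one]
      field_simp
      ring) (d := fun i => w i * δ) (fun i => mul_nonneg (hw0 i) hδ.le) (fun i u => by
      rw [abs_mul, abs_of_nonneg (hw0 i)]
      exact mul_le_mul_of_nonneg_left (hval i u).1 (hw0 i)) (hD0.trans_le hD)
    (s - ∑ i, w i * p i)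
  have hset : {u : Fin n → ℤˣ | s - 1 < ∑ i, w i * negInd (u i) ∧ ∑ i, w i * negInd (u i) ≤ s} =
      {u | s - ∑ i, w i * p i - 1 < ∑ i, w i * (negInd (u i) - p i) ∧
        ∑ i, w i * (negInd (u i) - p i) ≤ s - ∑ i, w i * p i} := by
    ext u
    simp only [Set.mem_ofPred_eq, mul_sub, Finset.sum_sub_distrib]
    constructor <;> rintro ⟨h1, h2⟩ <;> constructor <;> linarith
  rw [hset]
  refine h.trans ((div_le_div_of_nonneg_left (by positivity) hD0 hD).trans_eq ?_)
  rw [Fintype.card_fin]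
  have hs : Real.sqrt n ^ 2 = n := Real.sq_sqrt hn'.le
  have hs0 : Real.sqrt n ≠ 0 := (Real.sqrt_pos.2 hn').ne'
  simp only [δ]
  rw [div_eq_div_iff (by positivity) hs0]
  field_simp
  rw [hs]
  ring

/-- Cramér-type bound with the exact polynomial prefactor, at a fixed tilt. -/
theorem card_weighted_neg_le {n : ℕ} {θ : ℝ} (hθ : θ < 0) {w : Fin n → ℝ}
    (hw0 : ∀ i, 0 ≤ w i) (hw1 : ∀ i, w i ≤ 1) (hn : 0 < n) (hsq : (n : ℝ) / 3 ≤ ∑ i, w i ^ 2)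
    (t : ℝ) : ((Finset.univ.filter fun u : Fin n → ℤˣ => ∑ i, w i * negInd (u i) ≤ t).card : ℝ) ≤
      2 ^ n * (9 / 2 * (1 + Real.exp (-θ)) ^ 2 / (1 - Real.exp θ) / Real.sqrt n) *
        Real.exp (∑ i, Real.log ((1 + Real.exp (θ * w i)) / 2) - θ * t) := by
  have h := integral_exp_truncated_le (Measure.pi fun i => signLaw (θ * w i))
    (H := fun u => ∑ i, w i * negInd (u i)) (measurable_of_countable _)
    (fun u => Finset.sum_nonneg fun i _ => mul_nonneg (hw0 i)
      (by unfold negInd; split_ifs <;> simp))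
    (measureReal_signLaw_Ioc_le hθ.le hw0 hw1 hn hsq) (neg_pos.2 hθ) t
  rw [integral_fintype .of_finite, neg_neg] at h
  set Z := ∏ i, (1 + Real.exp (θ * w i))
  have hZ : 0 < Z := Finset.prod_pos fun i _ => by positivity
  -- Change of measure: the tilted mass of `u` times `exp(-θ (H u - t))` is the constant `e^{θ t} /
  -- Z`, so the truncated moment counts the vectors.
  have e1 : ∑ u : Fin n → ℤˣ, (Measure.pi fun i => signLaw (θ * w i)).real {u} •
      Set.indicator {u | ∑ i, w i * negInd (u i) ≤ t}
        (fun u => Real.exp (-θ * (∑ i, w i * negInd (u i) - t))) u =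
      (Finset.univ.filter fun u : Fin n → ℤˣ => ∑ i, w i * negInd (u i) ≤ t).card *
        (Real.exp (θ * t) / Z) := by
    rw [← nsmul_eq_mul, ← Finset.sum_const, Finset.sum_filter]
    refine Finset.sum_congr rfl fun u _ => ?_
    rw [signLaw_pi_real_singleton]
    by_cases hu : ∑ i, w i * negInd (u i) ≤ t
    · rw [Set.indicator_of_mem (by exact hu), if_pos hu, smul_eq_mul, div_mul_eq_mul_div,
        ← Real.exp_add]
      congr 2
      simp_rw [mul_assoc]
      rw [← Finset.mul_sum]
      ring
    · rw [Set.indicator_of_notMem (by exact hu), if_neg hu, smul_zero]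
  have e2 : Z = 2 ^ n * Real.exp (∑ i, Real.log ((1 + Real.exp (θ * w i)) / 2)) := by
    rw [Real.exp_sum, Finset.prod_congr rfl fun i _ => Real.exp_log (by positivity),
      Finset.prod_div_distrib]
    simp only [Finset.prod_const, Finset.card_univ, Fintype.card_fin]
    exact (mul_div_cancel₀ _ (by positivity)).symm
  rw [e1, mul_div_assoc', div_le_iff₀ hZ] at h
  have e3 : Real.exp (θ * t) * Real.exp (-(θ * t)) = 1 := by
    rw [← Real.exp_add]; simp
  rw [sub_eq_add_neg _ (θ * t), Real.exp_add]
  have h' := mul_le_mul_of_nonneg_right h (Real.exp_pos (-(θ * t))).le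
  rw [mul_assoc, e3, mul_one] at h'
  refine h'.trans_eq ?_
  rw [e2]
  ring

end Counting

namespace BinaryChannel

variable {𝒴 : Type*} [MeasurableSpace 𝒴] (W : BinaryChannel 𝒴)

/-! ### Measurability of the channel quantities -/

lemma measurable_llr : Measurable W.llr :=
  (W.measurable_qPos.div W.measurable_qNeg).ennreal_log

lemma measurable_reliability : Measurable W.reliability := by
  have h : Measurable EReal.abs := EReal.measurable_of_measurable_real (by
    change Measurable fun x : ℝ => ENNReal.ofReal |x|
    exact measurable_id.abs.ennreal_ofReal)
  exact h.comp W.measurable_llr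

lemma measurable_hard : Measurable W.hard :=
  Measurable.ite (measurableSet_le measurable_const W.measurable_llr) measurable_const
    measurable_const

lemma flip_eq (x : ℤˣ) (y : 𝒴) : W.flip x y = negInd (W.hard y * x) := rfl

lemma measurable_flip (x : ℤˣ) : Measurable (W.flip x) :=
  (measurable_of_units fun u => negInd (u * x)).comp W.measurable_hard

lemma measurable_flip_prod : Measurable fun z : ℤˣ × 𝒴 => W.flip z.1 z.2 :=
  measurable_from_prod_countable_right W.measurable_flip

lemma flip_eq_zero_or_one (x : ℤˣ) (y : 𝒴) : W.flip x y = 0 ∨ W.flip x y = 1 := by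
  unfold flip; split_ifs <;> simp

lemma flip_nonneg (x : ℤˣ) (y : 𝒴) : 0 ≤ W.flip x y := by
  rcases W.flip_eq_zero_or_one x y with h | h <;> rw [h]; norm_num

lemma flip_le_one (x : ℤˣ) (y : 𝒴) : W.flip x y ≤ 1 := by
  rcases W.flip_eq_zero_or_one x y with h | h <;> rw [h]; norm_num

lemma measurable_rank {n : ℕ} (i : Fin n) :
    Measurable fun y : Fin n → 𝒴 => (W.rank y i : ℝ) := by
  classical
  have h : (fun y : Fin n → 𝒴 => (W.rank y i : ℝ)) = fun y => ∑ j : Fin n,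
      if W.reliability (y j) < W.reliability (y i) ∨
        (W.reliability (y j) = W.reliability (y i) ∧ j ≤ i) then (1 : ℝ) else 0 := by
    funext y
    rw [rank, Finset.card_filter]
    push_cast
    exact Finset.sum_congr rfl fun j _ => by congr
  rw [h]
  have hr : ∀ j : Fin n, Measurable fun y : Fin n → 𝒴 => W.reliability (y j) := fun j =>
    W.measurable_reliability.comp (measurable_pi_apply j)
  refine Finset.measurable_sum _ fun j _ => Measurable.ite ?_ measurable_const measurable_const
  exact (measurableSet_lt (hr j) (hr i)).union
    ((measurableSet_eq_fun (hr j) (hr i)).inter (MeasurableSet.const _))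

lemma measurable_metric {n : ℕ} (x : Fin n → ℤˣ) : Measurable (W.metric x) := by
  unfold metric
  refine Measurable.const_mul (Finset.measurable_sum _ fun i _ => ?_) _
  exact ((W.measurable_rank i).div_const _).mul
    ((W.measurable_flip _).comp (measurable_pi_apply i))

/-! ### The pairwise kernel behind the metric -/

open Classical in
/-- The pairwise kernel `E * 1_{Λ' ≤ Λ}` whose U-statistic dominates the decoding metric. -/
noncomputable def pairKernel (z z' : ℤˣ × 𝒴) : ℝ :=
  W.flip z.1 z.2 * if W.reliability z'.2 ≤ W.reliability z.2 then 1 else 0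

lemma measurable_pairKernel : Measurable (Function.uncurry W.pairKernel) := by
  refine (W.measurable_flip_prod.comp measurable_fst).mul
    (Measurable.ite ?_ measurable_const measurable_const)
  exact measurableSet_le (W.measurable_reliability.comp (measurable_snd.comp measurable_snd))
    (W.measurable_reliability.comp (measurable_snd.comp measurable_fst))

lemma pairKernel_nonneg (z z' : ℤˣ × 𝒴) : 0 ≤ W.pairKernel z z' :=
  mul_nonneg (W.flip_nonneg _ _) (by split_ifs <;> norm_num)

lemma abs_pairKernel_le (z z' : ℤˣ × 𝒴) : |W.pairKernel z z'| ≤ 1 := by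
  rw [abs_of_nonneg (W.pairKernel_nonneg z z')]
  exact mul_le_one₀ (W.flip_le_one _ _) (by split_ifs <;> norm_num) (by split_ifs <;> norm_num)

lemma joint_apply {s : Set (ℤˣ × 𝒴)} (hs : MeasurableSet s) :
    W.joint s = ∑ x : ℤˣ, 2⁻¹ * W.law x {y | (x, y) ∈ s} := by
  simp only [joint, Measure.smul_apply, smul_eq_mul, Measure.finsetSum_apply, Finset.mul_sum]
  exact Finset.sum_congr rfl fun x _ => by
    rw [Measure.map_apply measurable_prodMk_left hs]; rfl

instance : IsProbabilityMeasure W.joint := by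
  constructor
  rw [W.joint_apply MeasurableSet.univ]
  simp [ENNReal.mul_inv_cancel]

lemma integral_pairKernel_right (z : ℤˣ × 𝒴) :
    ∫ z', W.pairKernel z z' ∂W.joint = W.flip z.1 z.2 * W.relCdf (W.reliability z.2) := by
  classical
  simp only [pairKernel]
  rw [integral_const_mul, relCdf]
  congr 1
  have hm : MeasurableSet {z' : ℤˣ × 𝒴 | W.reliability z'.2 ≤ W.reliability z.2} :=
    measurableSet_le (W.measurable_reliability.comp measurable_snd) measurable_const
  have := integral_indicator_const (μ := W.joint) (1 : ℝ) hm
  rw [smul_eq_mul, mul_one] at this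
  rw [← this]
  congr 1
  ext z'
  simp [Set.indicator_apply]

lemma integral_pairKernel_left (z : ℤˣ × 𝒴) :
    ∫ z', W.pairKernel z' z ∂W.joint = W.errTail (W.reliability z.2) := by
  classical
  have hm : MeasurableSet {z' : ℤˣ × 𝒴 |
      W.flip z'.1 z'.2 = 1 ∧ W.reliability z.2 ≤ W.reliability z'.2} :=
    (measurableSet_eq_fun W.measurable_flip_prod measurable_const).inter
      (measurableSet_le measurable_const (W.measurable_reliability.comp measurable_snd))
  have := integral_indicator_const (μ := W.joint) (1 : ℝ) hm
  rw [smul_eq_mul, mul_one] at this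
  rw [errTail, ← this]
  congr 1
  ext z'
  simp only [pairKernel, Set.indicator_apply, Set.mem_ofPred_eq]
  rcases W.flip_eq_zero_or_one z'.1 z'.2 with h | h <;> simp [h]

lemma kernelMean_pairKernel : kernelMean W.joint W.pairKernel = W.mu := by
  simp only [kernelMean, integral_pairKernel_right, mu, mul_comm]

lemma variance_kernelProj_pairKernel :
    variance (kernelProj W.joint W.pairKernel) W.joint = W.sigmaSq := by
  rw [sigmaSq]
  congr 1
  funext z
  rw [kernelProj, integral_pairKernel_right, integral_pairKernel_left]

/-! ### Ranks -/

section Rank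

variable {n : ℕ} (y : Fin n → 𝒴)

/-- Rank counts predecessors in the lexicographic order of reliability and position. Going up in
that order keeps all predecessors and adds the index itself. -/
lemma rank_injective : Function.Injective (W.rank y) := by
  have key : ∀ i j : Fin n, W.reliability (y i) < W.reliability (y j) ∨
      (W.reliability (y i) = W.reliability (y j) ∧ i < j) → W.rank y i < W.rank y j := by
    intro i j hij
    refine Finset.card_lt_card (Finset.ssubset_iff_of_subset (fun a ha => ?_) |>.2 ⟨j, ?_, ?_⟩)
    · simp only [Finset.mem_filter, Finset.mem_univ, true_and] at ha ⊢
      rcases hij with h | ⟨h, h'⟩ <;> rcases ha with h2 | ⟨h2, h2'⟩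
      · exact Or.inl (h2.trans h)
      · exact Or.inl (h2 ▸ h)
      · exact Or.inl (h ▸ h2)
      · exact Or.inr ⟨h2.trans h, h2'.trans h'.le⟩
    · simp
    · simp only [Finset.mem_filter, Finset.mem_univ, true_and, not_or, not_lt, not_and, not_le]
      rcases hij with h | ⟨h, h'⟩
      · exact ⟨h.le, fun h2 => absurd h2 h.ne'⟩
      · exact ⟨h.le, fun _ => h'⟩
  intro i j hij
  by_contra hne
  rcases lt_trichotomy (W.reliability (y i)) (W.reliability (y j)) with h | h | h
  · exact (key i j (Or.inl h)).ne hij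
  · rcases lt_or_gt_of_ne hne with h' | h'
    · exact (key i j (Or.inr ⟨h, h'⟩)).ne hij
    · exact (key j i (Or.inr ⟨h.symm, h'⟩)).ne hij.symm
  · exact (key j i (Or.inl h)).ne hij.symm

lemma one_le_rank (i : Fin n) : 1 ≤ W.rank y i :=
  Finset.card_pos.2 ⟨i, by simp⟩

lemma rank_le (i : Fin n) : W.rank y i ≤ n :=
  (Finset.card_le_univ _).trans_eq (Fintype.card_fin n)

/-- The ranks are a permutation of `1, …, n`. -/
lemma sum_rank (f : ℕ → ℝ) : ∑ i, f (W.rank y i) = ∑ i ∈ Finset.range n, f (i + 1) := by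
  have h : Finset.univ.image (fun i => W.rank y i - 1) = Finset.range n := by
    refine Finset.eq_of_subset_of_card_le (fun a ha => ?_) ?_
    · obtain ⟨i, -, rfl⟩ := Finset.mem_image.1 ha
      have := W.one_le_rank y i
      have := W.rank_le y i
      rw [Finset.mem_range]
      omega
    · rw [Finset.card_image_of_injective, Finset.card_univ, Fintype.card_fin, Finset.card_range]
      intro i j hij
      have h1 := W.one_le_rank y i
      have h2 := W.one_le_rank y j
      exact W.rank_injective y (by simp only at hij; omega)
  rw [← h, Finset.sum_image]
  · exact Finset.sum_congr rfl fun i _ => by rw [Nat.sub_add_cancel (W.one_le_rank y i)]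
  · intro i _ j _ hij
    have h1 := W.one_le_rank y i
    have h2 := W.one_le_rank y j
    exact W.rank_injective y (by simp only at hij; omega)

lemma mul_metric_eq (hn : 0 < n) (x : Fin n → ℤˣ) :
    n * W.metric x y = ∑ i, (W.rank y i : ℝ) / n * W.flip (x i) (y i) := by
  have : (n : ℝ) ≠ 0 := by positivity
  rw [metric]
  field_simp

/-- Counting every tie, whatever its position, can only raise the rank and leaves a kernel free of
positions. The `1` is the index itself. -/
lemma rank_le_one_add_sum (i : Fin n) (x : Fin n → ℤˣ) :
    (W.rank y i : ℝ) * W.flip (x i) (y i) ≤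
      1 + ∑ j ∈ Finset.univ.erase i, W.pairKernel (x i, y i) (x j, y j) := by
  classical
  have h1 : (W.rank y i : ℝ) ≤ ∑ j : Fin n,
      if W.reliability (y j) ≤ W.reliability (y i) then (1 : ℝ) else 0 := by
    rw [rank, Finset.card_filter]
    push_cast
    refine Finset.sum_le_sum fun j _ => ?_
    split_ifs with h1 h2 h2
    · exact le_rfl
    · exact absurd (h1.elim le_of_lt fun h => h.1.le) h2
    · exact zero_le_one
    · exact le_rfl
  rw [← Finset.add_sum_erase _ _ (Finset.mem_univ i), if_pos le_rfl] at h1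
  have h2 := mul_le_mul_of_nonneg_right h1 (W.flip_nonneg (x i) (y i))
  simp only [pairKernel, ← Finset.mul_sum]
  nlinarith [W.flip_le_one (x i) (y i)]

lemma mul_metric_le (hn : 0 < n) (x : Fin n → ℤˣ) :
    n * W.metric x y ≤ quadStat W.pairKernel (fun i => (x i, y i)) / n + 1 := by
  have hn' : (0 : ℝ) < n := by exact_mod_cast hn
  rw [W.mul_metric_eq y hn]
  have h := Finset.sum_le_sum fun i (_ : i ∈ Finset.univ) => W.rank_le_one_add_sum y i x
  rw [Finset.sum_add_distrib] at h
  simp only [Finset.sum_const, Finset.card_univ, Fintype.card_fin, nsmul_eq_mul, mul_one] at h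
  simp_rw [div_mul_eq_mul_div]
  rw [← Finset.sum_div, div_add_one hn'.ne']
  refine (div_le_div_iff_of_pos_right hn').2 ?_
  unfold quadStat rowStat
  linarith

lemma cube_div_three_le_sum (n : ℕ) :
    (n : ℝ) ^ 3 / 3 ≤ ∑ i ∈ Finset.range n, ((i + 1 : ℕ) : ℝ) ^ 2 := by
  induction n with
  | zero => simp
  | succ n ih =>
    rw [Finset.sum_range_succ]
    push_cast at ih ⊢
    have : (0 : ℝ) ≤ n := n.cast_nonneg
    nlinarith

/-- The number of words that beat a given word, for a fixed channel output. -/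
theorem card_metric_le {θ : ℝ} (hθ : θ < 0) (hn : 0 < n) (d : ℝ) :
    ((Finset.univ.filter fun x : Fin n → ℤˣ => W.metric x y ≤ d).card : ℝ) ≤
      2 ^ n * (9 / 2 * (1 + Real.exp (-θ)) ^ 2 / (1 - Real.exp θ) / Real.sqrt n) *
        Real.exp (n * cgf θ - θ * (n * d)) := by
  have hn' : (0 : ℝ) < n := by exact_mod_cast hn
  have hcard : (Finset.univ.filter fun x : Fin n → ℤˣ => W.metric x y ≤ d).card =
      (Finset.univ.filter fun u : Fin n → ℤˣ =>
        ∑ i, (W.rank y i : ℝ) / n * negInd (u i) ≤ n * d).card := by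
    -- Multiplication by the hard decisions sends a word to its flip pattern, and the ranks do not
    -- depend on the word.
    refine Finset.card_equiv (Equiv.mulLeft fun i => W.hard (y i)) fun x => ?_
    simp only [Finset.mem_filter, Finset.mem_univ, true_and, Equiv.coe_mulLeft, Pi.mul_apply,
      ← flip_eq]
    rw [← W.mul_metric_eq y hn]
    exact (mul_le_mul_iff_right₀ hn').symm
  rw [hcard]
  refine (card_weighted_neg_le hθ (fun i => by positivity) (fun i => ?_) hn ?_ _).trans ?_
  · rw [div_le_one hn']
    exact_mod_cast W.rank_le y i
  · rw [W.sum_rank y fun r => ((r : ℝ) / n) ^ 2]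
    simp_rw [div_pow]
    rw [← Finset.sum_div, le_div_iff₀ (by positivity)]
    refine le_trans (le_of_eq ?_) (cube_div_three_le_sum n)
    ring
  · refine mul_le_mul_of_nonneg_left (Real.exp_le_exp.2 (sub_le_sub_right ?_ _)) ?_
    · rw [W.sum_rank y fun r => Real.log ((1 + Real.exp (θ * ((r : ℝ) / n))) / 2)]
      exact sum_log_le_mul_cgf hθ.le hn
    · have : 0 < 1 - Real.exp θ := sub_pos.2 (by simpa using hθ)
      positivity

end Rank

end BinaryChannel

/-! ### Averaging over codebooks -/

section Averaging

variable {α : Type*} [Fintype α]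

/-- Resampling one codeword preserves the uniform law on codebooks: exchanging the old and the new
codeword is an involution. -/
lemma sum_sum_update {M : ℕ} (m : Fin M) (F : (Fin M → α) → ℝ) :
    ∑ c : Fin M → α, ∑ a : α, F (Function.update c m a) = Fintype.card α * ∑ c, F c := by
  have h : ∑ p : (Fin M → α) × α, F (Function.update p.1 m p.2) =
      ∑ p : (Fin M → α) × α, F p.1 :=
    Fintype.sum_bijective (fun p : (Fin M → α) × α => (Function.update p.1 m p.2, p.1 m))
      (Function.Involutive.bijective fun p => by simp) _ _ fun p => rfl
  rw [Fintype.sum_prod_type, Fintype.sum_prod_type] at h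
  rw [h, Finset.mul_sum]
  simp

lemma card_mul_sum_eval {M : ℕ} (m : Fin M) (β : α → ℝ) :
    Fintype.card α * ∑ c : Fin M → α, β (c m) = Fintype.card (Fin M → α) * ∑ a, β a := by
  rw [← sum_sum_update m fun c => β (c m)]
  simp [Finset.card_univ]

lemma card_sq_mul_sum_eval {M : ℕ} {m m' : Fin M} (h : m ≠ m') (γ : α → α → ℝ) :
    (Fintype.card α : ℝ) ^ 2 * ∑ c : Fin M → α, γ (c m) (c m') =
      Fintype.card (Fin M → α) * ∑ a, ∑ b, γ a b := by
  rw [sq, mul_assoc, ← sum_sum_update m fun c => γ (c m) (c m')]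
  simp only [Function.update_self, Function.update_of_ne h.symm]
  rw [card_mul_sum_eval m' fun b => ∑ a, γ a b, Finset.sum_comm]

/-- Some codebook does at least as well as the average over all codebooks. -/
lemma exists_codebook_le [Nonempty α] {M : ℕ} (hM : 0 < M) (β : α → ℝ) (γ : α → α → ℝ) :
    ∃ c : Fin M → α, (1 / (M : ℝ)) * ∑ m, (β (c m) + ∑ m' ∈ Finset.univ.erase m, γ (c m) (c m')) ≤
      1 / (Fintype.card α : ℝ) * ∑ a, β a +
        (M - 1) * (1 / (Fintype.card α : ℝ) ^ 2 * ∑ a, ∑ b, γ a b) := by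
  have hK : (0 : ℝ) < Fintype.card α := by exact_mod_cast Fintype.card_pos
  have hM' : (0 : ℝ) < M := by exact_mod_cast hM
  have h1 : ∀ m : Fin M, ∑ c : Fin M → α, β (c m) =
      Fintype.card (Fin M → α) * (1 / (Fintype.card α : ℝ) * ∑ a, β a) := fun m => by
    have := card_mul_sum_eval m β
    field_simp
    linarith
  have h2 : ∀ m m' : Fin M, m ≠ m' → ∑ c : Fin M → α, γ (c m) (c m') =
      Fintype.card (Fin M → α) * (1 / (Fintype.card α : ℝ) ^ 2 * ∑ a, ∑ b, γ a b) :=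
    fun m m' h => by
      have := card_sq_mul_sum_eval h γ
      field_simp
      linarith
  have hcard : ∀ m : Fin M, (((Finset.univ.erase m).card : ℕ) : ℝ) = M - 1 := fun m => by
    simp [Nat.cast_sub (show 1 ≤ M from hM)]
  have h3 : ∀ m : Fin M, ∑ c : Fin M → α, (β (c m) + ∑ m' ∈ Finset.univ.erase m, γ (c m) (c m')) =
      Fintype.card (Fin M → α) * (1 / (Fintype.card α : ℝ) * ∑ a, β a +
        (M - 1) * (1 / (Fintype.card α : ℝ) ^ 2 * ∑ a, ∑ b, γ a b)) := by
    intro m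
    rw [Finset.sum_add_distrib, h1, Finset.sum_comm, Finset.sum_congr rfl fun m' hm' =>
      h2 m m' (Finset.ne_of_mem_erase hm').symm, Finset.sum_const, nsmul_eq_mul, hcard]
    ring
  obtain ⟨c, -, hc⟩ := Finset.exists_le_of_sum_le (s := (Finset.univ : Finset (Fin M → α)))
    (f := fun c => (1 / (M : ℝ)) * ∑ m, (β (c m) + ∑ m' ∈ Finset.univ.erase m, γ (c m) (c m')))
    (g := fun _ => 1 / (Fintype.card α : ℝ) * ∑ a, β a +
        (M - 1) * (1 / (Fintype.card α : ℝ) ^ 2 * ∑ a, ∑ b, γ a b)) Finset.univ_nonempty (by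
      rw [← Finset.mul_sum, Finset.sum_comm, Finset.sum_congr rfl fun m _ => h3 m]
      simp only [Finset.sum_const, Finset.card_univ, Fintype.card_fin, nsmul_eq_mul]
      rw [← mul_assoc, one_div_mul_cancel hM'.ne', one_mul])
  exact ⟨c, hc⟩

end Averaging

/-! ### The i.i.d. input-output law as a mixture over transmitted words. -/

namespace BinaryChannel

variable {𝒴 : Type*} [MeasurableSpace 𝒴] (W : BinaryChannel 𝒴)

instance {n : ℕ} (x : Fin n → ℤˣ) : IsProbabilityMeasure (W.blockLaw x) := by
  unfold blockLaw; infer_instance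

lemma measurable_zip {n : ℕ} (x : Fin n → ℤˣ) :
    Measurable fun (y : Fin n → 𝒴) i => (x i, y i) :=
  measurable_pi_lambda _ fun i => measurable_const.prodMk (measurable_pi_apply i)

lemma pi_joint (n : ℕ) : (Measure.pi fun _ : Fin n => W.joint) =
    ∑ x : Fin n → ℤˣ, (2⁻¹ : ℝ≥0∞) ^ n • (W.blockLaw x).map fun y i => (x i, y i) := by
  refine Measure.pi_eq fun s hs => ?_
  simp only [W.joint_apply (hs _), Measure.finsetSum_apply, Measure.smul_apply, smul_eq_mul]
  rw [Finset.prod_univ_sum, Fintype.piFinset_univ]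
  refine Finset.sum_congr rfl fun x _ => ?_
  rw [Measure.map_apply (measurable_zip x) (MeasurableSet.univ_pi hs), Finset.prod_mul_distrib]
  simp only [Finset.prod_const, Finset.card_univ, Fintype.card_fin]
  congr 1
  have : (fun (y : Fin n → 𝒴) i => (x i, y i)) ⁻¹' Set.univ.pi s =
      Set.univ.pi fun i => {y | (x i, y) ∈ s i} := by
    ext y; simp [Set.mem_pi]
  rw [this, blockLaw, Measure.pi_pi]

lemma integral_pi_joint {n : ℕ} {F : (Fin n → ℤˣ × 𝒴) → ℝ} (hF : IsBddMeas F) :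
    ∫ z, F z ∂(Measure.pi fun _ : Fin n => W.joint) =
      1 / (Fintype.card (Fin n → ℤˣ) : ℝ) *
        ∑ x : Fin n → ℤˣ, ∫ y, F (fun i => (x i, y i)) ∂W.blockLaw x := by
  have hfin : ((2⁻¹ : ℝ≥0∞) ^ n) ≠ ⊤ := by simp
  have hmap : ∀ x : Fin n → ℤˣ, IsFiniteMeasure ((W.blockLaw x).map fun y i => (x i, y i)) :=
    fun x => inferInstance
  rw [pi_joint, integral_finsetSum_measure fun x _ => (hF.integrable _).smul_measure hfin,
    Finset.mul_sum]
  refine Finset.sum_congr rfl fun x _ => ?_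
  rw [integral_smul_measure, integral_map (measurable_zip x).aemeasurable
    hF.measurable.aestronglyMeasurable]
  simp

lemma measureReal_pi_joint {n : ℕ} {A : Set (Fin n → ℤˣ × 𝒴)} (hA : MeasurableSet A) :
    (Measure.pi fun _ : Fin n => W.joint).real A = 1 / (Fintype.card (Fin n → ℤˣ) : ℝ) *
        ∑ x : Fin n → ℤˣ, (W.blockLaw x).real {y | (fun i => (x i, y i)) ∈ A} := by
  have hb : IsBddMeas (A.indicator fun _ => (1 : ℝ)) :=
    .of_le (measurable_const.indicator hA) 1 fun z => by
      by_cases hz : z ∈ A <;> simp [hz]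
  have h := W.integral_pi_joint hb
  rw [integral_indicator_const _ hA, smul_eq_mul, mul_one] at h
  rw [h]
  congr 1
  refine Finset.sum_congr rfl fun x _ => ?_
  have := integral_indicator_const (μ := W.blockLaw x) (1 : ℝ) (measurable_zip x hA)
  rw [smul_eq_mul, mul_one] at this
  exact (this.symm.trans rfl).symm

/-! ### Decoders -/

/-- A minimizer is chosen as a function of the pattern of minimizing messages, which is measurable
with finitely many values. Without an actual decoder, the requirement defining `maxSize` would hold
vacuously. -/
lemma exists_isDecoder {n M : ℕ} (hM : 0 < M) (c : Fin M → Fin n → ℤˣ) :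
    ∃ dec, W.IsDecoder c dec := by
  classical
  set D : (Fin M → Prop) → Fin M := fun p => if h : ∃ m, p m then h.choose else ⟨0, hM⟩
  have hpat : Measurable fun (y : Fin n → 𝒴) (m : Fin M) =>
      ∀ m', W.metric (c m) y ≤ W.metric (c m') y := by
    refine measurable_pi_lambda _ fun m => ?_
    refine measurableSet_setOfPred.1 ?_
    have : {y : Fin n → 𝒴 | ∀ m', W.metric (c m) y ≤ W.metric (c m') y} =
        ⋂ m', {y | W.metric (c m) y ≤ W.metric (c m') y} := by ext y; simp
    rw [this]
    exact MeasurableSet.iInter fun m' =>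
      measurableSet_le (W.measurable_metric _) (W.measurable_metric _)
  refine ⟨fun y => D fun m => ∀ m', W.metric (c m) y ≤ W.metric (c m') y,
    (measurable_of_countable D).comp hpat, fun y m => ?_⟩
  have hex : ∃ m, ∀ m', W.metric (c m) y ≤ W.metric (c m') y := by
    have : Nonempty (Fin M) := ⟨⟨0, hM⟩⟩
    exact Finite.exists_min fun m => W.metric (c m) y
  simp only [D, dif_pos hex]
  exact hex.choose_spec m

/-- The correct-decoding probabilities sum to at most the number of words, because for each word the
decoding regions are disjoint. Boundedness matters because the supremum of an unbounded set of
naturals is `0` by default. -/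
lemma bddAbove_sizes (n : ℕ) {ε : ℝ} (hε : ε < 1) :
    BddAbove {M : ℕ | 0 < M ∧ ∃ c : Fin M → Fin n → ℤˣ,
      ∀ dec : (Fin n → 𝒴) → Fin M, W.IsDecoder c dec → W.avgError c dec ≤ ε} := by
  refine ⟨⌈(Fintype.card (Fin n → ℤˣ) : ℝ) / (1 - ε)⌉₊, ?_⟩
  rintro M ⟨hM, c, hc⟩
  obtain ⟨dec, hdec⟩ := W.exists_isDecoder hM c
  have hM' : (0 : ℝ) < M := by exact_mod_cast hM
  have h := hc dec hdec
  rw [avgError, one_div_mul_eq_div, div_le_iff₀ hM'] at h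
  have hms : ∀ m, MeasurableSet {y | dec y = m} := fun m => hdec.1 (measurableSet_singleton m)
  have h1 : ∀ m, (W.blockLaw (c m)).real {y | dec y ≠ m} =
      1 - (W.blockLaw (c m)).real {y | dec y = m} := fun m =>
    probReal_compl_eq_one_sub (hms m)
  have h2 : ∑ m, (W.blockLaw (c m)).real {y | dec y = m} ≤ Fintype.card (Fin n → ℤˣ) := by
    calc _ ≤ ∑ m, ∑ x : Fin n → ℤˣ, (W.blockLaw x).real {y | dec y = m} :=
          Finset.sum_le_sum fun m _ => Finset.single_le_sum
            (f := fun x => (W.blockLaw x).real {y | dec y = m})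
            (fun x _ => measureReal_nonneg) (Finset.mem_univ (c m))
      _ = ∑ x : Fin n → ℤˣ, ∑ m, (W.blockLaw x).real {y | dec y = m} := Finset.sum_comm
      _ ≤ ∑ x : Fin n → ℤˣ, 1 := by
          refine Finset.sum_le_sum fun x _ => ?_
          rw [← measureReal_biUnion_finset (μ := W.blockLaw x) (f := fun m => {y | dec y = m})
            (fun a _ b _ hab => Set.disjoint_left.2
              fun y (hy : dec y = a) (hy' : dec y = b) => hab (hy ▸ hy')) fun m _ => hms m]
          exact measureReal_le_one
      _ = _ := by simp
  simp_rw [h1, Finset.sum_sub_distrib] at h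
  simp only [Finset.sum_const, Finset.card_univ, Fintype.card_fin, nsmul_eq_mul, mul_one] at h
  have h3 : (M : ℝ) ≤ (Fintype.card (Fin n → ℤˣ) : ℝ) / (1 - ε) := by
    rw [le_div_iff₀ (by linarith)]
    linarith
  exact_mod_cast h3.trans (Nat.le_ceil _)

/-- The competitors that beat or tie with the transmitted word bound the error probability. -/
lemma avgError_le {n M : ℕ} {c : Fin M → Fin n → ℤˣ} {dec : (Fin n → 𝒴) → Fin M}
    (h : W.IsDecoder c dec) : W.avgError c dec ≤
      (1 / (M : ℝ)) * ∑ m, (W.blockLaw (c m)).real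
        {y | ∃ m' ∈ Finset.univ.erase m, W.metric (c m') y ≤ W.metric (c m) y} := by
  refine mul_le_mul_of_nonneg_left (Finset.sum_le_sum fun m _ => ?_) (by positivity)
  exact measureReal_mono fun y (hy : dec y ≠ m) =>
    ⟨dec y, Finset.mem_erase.2 ⟨hy, Finset.mem_univ _⟩, h.2 y m⟩

/-- The random coding bound, with the tilt `θ` and the threshold `t` as parameters. -/
theorem exists_codebook_avgError_le {n M : ℕ} (hn : 0 < n) (hM : 0 < M) {θ : ℝ} (hθ : θ < 0)
    (t : ℝ) : ∃ c : Fin M → Fin n → ℤˣ, ∀ dec : (Fin n → 𝒴) → Fin M, W.IsDecoder c dec →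
      W.avgError c dec ≤
        (Measure.pi fun _ : Fin n => W.joint).real {z | t < quadStat W.pairKernel z / n + 1} +
        (M - 1) * (9 / 2 * (1 + Real.exp (-θ)) ^ 2 / (1 - Real.exp θ) / Real.sqrt n *
          Real.exp (n * cgf θ - θ * t) *
          ∫ z, Set.indicator {z | quadStat W.pairKernel z / n + 1 ≤ t}
            (fun z => Real.exp (-θ * (quadStat W.pairKernel z / n + 1 - t))) z
              ∂(Measure.pi fun _ : Fin n => W.joint)) := by
  classical
  set H : (Fin n → ℤˣ × 𝒴) → ℝ := fun z => quadStat W.pairKernel z / n + 1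
  set Kθ := 9 / 2 * (1 + Real.exp (-θ)) ^ 2 / (1 - Real.exp θ) / Real.sqrt n
  have hKθ : 0 ≤ Kθ := by
    have : 0 < 1 - Real.exp θ := sub_pos.2 (by simpa using hθ)
    positivity
  have hHm : Measurable H :=
    ((isBddMeas_quadStat W.measurable_pairKernel W.abs_pairKernel_le).measurable.div_const
      _).add_const _
  set β : (Fin n → ℤˣ) → ℝ := fun x => (W.blockLaw x).real {y | t < H fun i => (x i, y i)}
  set γ : (Fin n → ℤˣ) → (Fin n → ℤˣ) → ℝ := fun x x' => (W.blockLaw x).real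
    {y | H (fun i => (x i, y i)) ≤ t ∧ W.metric x' y ≤ W.metric x y}
  -- `β` is the probability that the transmitted word is atypical, and `γ` that a given competitor
  -- wins or ties when it is typical. A repeated codeword counts as a winning competitor.
  obtain ⟨c, hc⟩ := exists_codebook_le hM β γ
  refine ⟨c, fun dec hdec => (W.avgError_le hdec).trans (le_trans ?_ (hc.trans ?_))⟩
  · refine mul_le_mul_of_nonneg_left (Finset.sum_le_sum fun m _ => ?_) (by positivity)
    have hsub : {y | ∃ m' ∈ Finset.univ.erase m, W.metric (c m') y ≤ W.metric (c m) y} ⊆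
        {y | t < H fun i => (c m i, y i)} ∪ ⋃ m' ∈ Finset.univ.erase m,
          {y | H (fun i => (c m i, y i)) ≤ t ∧ W.metric (c m') y ≤ W.metric (c m) y} := by
      rintro y ⟨m', hm', hle⟩
      rcases lt_or_ge t (H fun i => (c m i, y i)) with h | h
      · exact Or.inl h
      · exact Or.inr (Set.mem_biUnion hm' ⟨h, hle⟩)
    refine (measureReal_mono hsub).trans ((measureReal_union_le _ _).trans ?_)
    exact add_le_add le_rfl (measureReal_biUnion_finset_le _ _)
  · have hM1 : (0 : ℝ) ≤ M - 1 := by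
      have : (1 : ℝ) ≤ M := by exact_mod_cast hM
      linarith
    have hset : MeasurableSet {z | t < H z} := measurableSet_lt measurable_const hHm
    have hset2 : MeasurableSet {z | H z ≤ t} := measurableSet_le hHm measurable_const
    refine add_le_add (W.measureReal_pi_joint hset).ge (mul_le_mul_of_nonneg_left ?_ hM1)
    have bF : IsBddMeas fun z => Set.indicator {z | H z ≤ t}
        (fun z => Real.exp (-θ * (H z - t))) z := by
      refine .of_le (Measurable.indicator (by fun_prop) hset2) 1 fun z => ?_
      by_cases hz : H z ≤ t
      · rw [Set.indicator_of_mem (by exact hz), abs_of_pos (Real.exp_pos _)]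
        exact Real.exp_le_one_iff.2
          (mul_nonpos_of_nonneg_of_nonpos (by linarith) (by linarith))
      · rw [Set.indicator_of_notMem (by exact hz)]
        simp
    rw [W.integral_pi_joint bF, Finset.mul_sum, Finset.mul_sum, Finset.mul_sum]
    refine Finset.sum_le_sum fun x _ => ?_
    have hK : (0 : ℝ) < Fintype.card (Fin n → ℤˣ) := by exact_mod_cast Fintype.card_pos
    have hcard : (Fintype.card (Fin n → ℤˣ) : ℝ) = 2 ^ n := by simp
    have hms : ∀ x' : Fin n → ℤˣ, MeasurableSet
        {y | H (fun i => (x i, y i)) ≤ t ∧ W.metric x' y ≤ W.metric x y} := fun x' =>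
      (measurableSet_le (hHm.comp (measurable_zip x)) measurable_const).inter
        (measurableSet_le (W.measurable_metric _) (W.measurable_metric _))
    have bFx : IsBddMeas fun y : Fin n → 𝒴 => Set.indicator {z | H z ≤ t}
        (fun z => Real.exp (-θ * (H z - t))) fun i => (x i, y i) := bF.comp (measurable_zip x)
    have hint : ∀ x', Integrable (Set.indicator
        {y | H (fun i => (x i, y i)) ≤ t ∧ W.metric x' y ≤ W.metric x y} fun _ => (1 : ℝ))
        (W.blockLaw x) := fun x' => (integrable_const _).indicator (hms x')
    have hsum : ∑ x', γ x x' = ∫ y, ∑ x', Set.indicator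
        {y | H (fun i => (x i, y i)) ≤ t ∧ W.metric x' y ≤ W.metric x y} (fun _ => (1 : ℝ)) y
          ∂W.blockLaw x := by
      rw [integral_finsetSum _ fun x' _ => hint x']
      refine Finset.sum_congr rfl fun x' _ => ?_
      rw [integral_indicator_const _ (hms x'), smul_eq_mul, mul_one]
    have hle : ∑ x', γ x x' ≤ 2 ^ n * Kθ * Real.exp (n * cgf θ - θ * t) *
        ∫ y, Set.indicator {z | H z ≤ t} (fun z => Real.exp (-θ * (H z - t)))
          (fun i => (x i, y i)) ∂W.blockLaw x := by
      rw [hsum, ← integral_const_mul]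
      refine integral_mono (integrable_finsetSum _ fun x' _ => hint x')
        ((bFx.const_mul _).integrable _) fun y => ?_
      by_cases hy : H (fun i => (x i, y i)) ≤ t
      · have e1 : ∑ x', Set.indicator {y | H (fun i => (x i, y i)) ≤ t ∧
            W.metric x' y ≤ W.metric x y} (fun _ => (1 : ℝ)) y =
            ((Finset.univ.filter fun x' => W.metric x' y ≤ W.metric x y).card : ℝ) := by
          simp [Set.indicator_apply, hy]
        simp only [e1]
        rw [Set.indicator_of_mem (by exact hy), mul_assoc, ← Real.exp_add]
        refine (W.card_metric_le y hθ hn _).trans (mul_le_mul_of_nonneg_left ?_ (by positivity))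
        refine Real.exp_le_exp.2 ?_
        -- The count is taken at the random level `d = W.metric x y`, and `-θ > 0` lets `n d` be
        -- replaced by its upper bound `H`.
        have := mul_le_mul_of_nonneg_left (W.mul_metric_le y hn x) (neg_pos.2 hθ).le
        simp only [H]
        linarith
      · simp [hy]
    have := mul_le_mul_of_nonneg_left hle
      (by positivity : 0 ≤ 1 / (Fintype.card (Fin n → ℤˣ) : ℝ) ^ 2)
    refine this.trans_eq ?_
    rw [hcard]
    field_simp

end BinaryChannel

/-! ### The lower bound on the code size. -/

namespace BinaryChannel

variable {𝒴 : Type*} [MeasurableSpace 𝒴] (W : BinaryChannel 𝒴)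

lemma le_maxSize {n M : ℕ} {ε : ℝ} (hε : ε < 1) (hM : 0 < M) {c : Fin M → Fin n → ℤˣ}
    (hc : ∀ dec : (Fin n → 𝒴) → Fin M, W.IsDecoder c dec → W.avgError c dec ≤ ε) :
    M ≤ W.maxSize n ε :=
  le_csSup (W.bddAbove_sizes n hε) ⟨hM, c, hc⟩

/-- The random coding lower bound on the optimal codebook size, at a fixed tilting `θ < 0`. -/
theorem exists_le_log_maxSize {θ : ℝ} (hθ : θ < 0) {ε : ℝ} (hε0 : 0 < ε) (hε1 : ε < 1) :
    ∃ C : ℝ, ∃ n₀ : ℕ, 0 < n₀ ∧ ∀ n : ℕ, n₀ ≤ n →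
      n * (θ * W.mu - cgf θ) + θ * Real.sqrt (n * W.sigmaSq) * gaussQInv ε
        + 1 / 2 * Real.log n - C ≤ Real.log (W.maxSize n ε) := by
  obtain ⟨C₁, C₂, hC₂, n₀, h⟩ := exists_threshold (P := W.joint) W.measurable_pairKernel
    W.pairKernel_nonneg W.abs_pairKernel_le hε0 hε1 (neg_pos.2 hθ)
  rw [W.kernelMean_pairKernel, W.variance_kernelProj_pairKernel] at h
  set B : ℝ := 9 / 2 * (1 + Real.exp (-θ)) ^ 2 / (1 - Real.exp θ) with hBdef
  have hB : 0 < B := by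
    have : 0 < 1 - Real.exp θ := sub_pos.2 (by simpa using hθ)
    positivity
  refine ⟨Real.log (B * C₂) - θ * C₁, max n₀ 1, by positivity, fun n hn => ?_⟩
  have hn1 : 0 < n := (le_max_right n₀ 1).trans hn
  have hn' : (0 : ℝ) < n := by exact_mod_cast hn1
  obtain ⟨t, η, hη, ht, hover, hint⟩ := h n ((le_max_left _ _).trans hn)
  have hs : 0 < Real.sqrt n := Real.sqrt_pos.2 hn'
  -- The size at which the competitor term equals `η`. Taking `M = ⌈T⌉₊` gives both `M - 1 ≤ T`, as
  -- the error bound needs, and `T ≤ M`, as the logarithm needs.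
  set T : ℝ := Real.sqrt n * Real.exp (θ * t - n * cgf θ) / (B * C₂) with hT
  have hT0 : 0 < T := by positivity
  have hM : 0 < ⌈T⌉₊ := Nat.ceil_pos.2 hT0
  obtain ⟨c, hc⟩ := W.exists_codebook_avgError_le hn1 hM hθ t
  have hsize : ⌈T⌉₊ ≤ W.maxSize n ε := by
    refine W.le_maxSize hε1 hM fun dec hdec => (hc dec hdec).trans ?_
    have h1 : (0 : ℝ) ≤ ⌈T⌉₊ - 1 := sub_nonneg.2 (by exact_mod_cast hM)
    have h2 : (⌈T⌉₊ : ℝ) - 1 ≤ T := by linarith [Nat.ceil_lt_add_one hT0.le]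
    have h3 : T * (B / Real.sqrt n * Real.exp (n * cgf θ - θ * t) * (C₂ * η)) = η := by
      rw [hT, ← neg_sub (θ * t), Real.exp_neg]
      field_simp
    have h4 := (mul_le_mul_of_nonneg_left (mul_le_mul_of_nonneg_left hint
      (by positivity : 0 ≤ B / Real.sqrt n * Real.exp (n * cgf θ - θ * t))) h1).trans
      (mul_le_mul_of_nonneg_right h2 (by positivity))
    linarith
  have hlog : Real.log T = 1 / 2 * Real.log n + (θ * t - n * cgf θ) - Real.log (B * C₂) := by
    rw [hT, Real.log_div (by positivity) (by positivity), Real.log_mul hs.ne' (Real.exp_ne_zero _),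
      Real.log_exp, Real.log_sqrt hn'.le]
    ring
  have hle : Real.log T ≤ Real.log (W.maxSize n ε) :=
    Real.log_le_log hT0 ((Nat.le_ceil T).trans (by exact_mod_cast hsize))
  -- An upper bound on `t` becomes a lower bound on `θ * t`, since `θ` is negative.
  have := mul_le_mul_of_nonpos_left ht hθ.le
  linarith

end BinaryChannel

end Orbgrand

theorem theorem4 {𝒴 : Type*} [MeasurableSpace 𝒴] (W : Orbgrand.BinaryChannel 𝒴)
    (hmu : 0 < W.mu ∧ W.mu < 1 / 4) :
    (∃! θ : ℝ, Orbgrand.IsMaximizer W.mu θ) ∧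
    ∀ θμ VORB : ℝ, Orbgrand.IsMaximizer W.mu θμ → VORB = θμ ^ 2 * W.sigmaSq →
    ∀ ε : ℝ, 0 < ε → ε < 1 →
      (∃ C : ℝ, ∃ n₀ : ℕ, ∀ n : ℕ, n₀ ≤ n →
        (n : ℝ) * Orbgrand.rateFn W.mu - Real.sqrt (n * VORB) * Orbgrand.gaussQInv ε
          + 1 / 2 * Real.log n - C ≤ Real.log (W.maxSize n ε)) ∧
      (∃ C : ℝ, ∃ n₀ : ℕ, ∀ n : ℕ, n₀ ≤ n →
        Orbgrand.rateFn W.mu - Real.sqrt (VORB / n) * Orbgrand.gaussQInv ε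
          + Real.log n / (2 * n) - C / n ≤ W.maxRate n ε) := by
  have hbound : ∀ θμ VORB : ℝ, Orbgrand.IsMaximizer W.mu θμ → VORB = θμ ^ 2 * W.sigmaSq →
      ∀ ε : ℝ, 0 < ε → ε < 1 → ∃ C : ℝ, ∃ n₀ : ℕ, 0 < n₀ ∧ ∀ n : ℕ, n₀ ≤ n →
        (n : ℝ) * Orbgrand.rateFn W.mu - Real.sqrt (n * VORB) * Orbgrand.gaussQInv ε
          + 1 / 2 * Real.log n - C ≤ Real.log (W.maxSize n ε) := by
    rintro θ _ hθ rfl ε hε0 hε1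
    have hθ0 := hθ.neg hmu.2
    obtain ⟨C, n₀, hn₀, h⟩ := W.exists_le_log_maxSize hθ0 hε0 hε1
    refine ⟨C, n₀, hn₀, fun n hn => ?_⟩
    -- The square root of `θ ^ 2` is `-θ`, which produces the minus sign in front of the dispersion
    -- term.
    have hs : Real.sqrt (n * (θ ^ 2 * W.sigmaSq)) = -θ * Real.sqrt (n * W.sigmaSq) := by
      rw [mul_left_comm, Real.sqrt_mul (sq_nonneg θ), Real.sqrt_sq_eq_abs, abs_of_neg hθ0]
    have := h n hn
    rw [hθ.rateFn_eq, hs]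
    linarith
  obtain ⟨θ₀, hθ₀⟩ := Orbgrand.exists_isMaximizer hmu.1 hmu.2
  refine ⟨⟨θ₀, hθ₀, fun t ht => Orbgrand.isMaximizer_unique ht hθ₀⟩,
    fun θ V hθ hV ε hε0 hε1 => ?_⟩
  obtain ⟨C, n₀, hn₀, h⟩ := hbound θ V hθ hV ε hε0 hε1
  refine ⟨⟨C, n₀, h⟩, C, n₀, fun n hn => ?_⟩
  have hn' : (0 : ℝ) < n := by exact_mod_cast hn₀.trans_le hn
  have hs : Real.sqrt (V / n) = Real.sqrt (n * V) / n := by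
    rw [← Real.sqrt_sq hn'.le, ← Real.sqrt_div' _ (sq_nonneg _), Real.sqrt_sq hn'.le]
    congr 1
    field_simp
  rw [Orbgrand.BinaryChannel.maxRate, hs, one_div_mul_eq_div, le_div_iff₀ hn']
  refine (le_of_eq ?_).trans (h n hn)
  field_simp
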